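/- Consider the circular planar restricted three-body problem with mass ratio $0<\mu<1$, $$H_\mu(p,q)=\tfrac12|p+iq|^2-\frac{\mu}{|q-(1-\mu)|}-\frac{1-\mu}{|q+\mu|}-\tfrac12|q|^2,\qquad p,q\in\mathbb C .$$ Let $r_1=r_1(\mu)\in(0,1)$ be the unique solution of $\frac{1-\mu}{(1-r)^2}-\frac{\mu}{r^2}=1-\mu-r$, let $l_1(\mu)=(p,q)=(-i(1-\mu-r_1),\,1-\mu-r_1)$ be the first Lagrange point and $L_1(\mu)=H_\mu(l_1(\mu))$. In elliptic-hyperbolic coordinates $(y,x)\in\mathbb R^2\times(\mathbb R\times\mathbb R/2\pi\mathbb Z)$, given with $\zeta=x_1+ix_2$ by $q=\frac12\cosh\zeta+\frac12-\mu$ and $p=2(y_1+iy_2)/\overline{\sinh\zeta}-i(\frac12-\mu)$, the function $\frac14|\sinh\zeta|^2(H_\mu-E)$ extends to the smooth regularized Hamiltonian $$\hat H_{\mu,E}(y,x)=\tfrac12\Big(y_1+\tfrac{\sin 2x_2}{8}\Big)^2+\tfrac12\Big(y_2+\tfrac{\sinh 2x_1}{8}\Big)^2+V_{\mu,E}(x),$$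 $$V_{\mu,E}(x)=-\tfrac{E\cosh^2x_1}{4}-\tfrac{\cosh x_1}{2}-\tfrac{\sinh^2 2x_1}{128}+\tfrac{E\cos^2x_2}{4}-\tfrac{\sin^22x_2}{128}+(1-2\mu)\Big(\tfrac{\cos x_2}{2}-\tfrac1{16}\big(\tfrac12-\mu+\cosh x_1\cos x_2\big)(\cosh^2x_1-\cos^2x_2)\Big).$$ Its Hamiltonian flow is $\dot y=-\partial_x\hat H_{\mu,E}$, $\dot x=\partial_y\hat H_{\mu,E}$. The point $l_1(\mu)$ corresponds to the two singularities $S_\pm(\mu)$ with $x=(0,\pm\arccos(1-2r_1))$ and $y=(-\frac18\sin 2x_2,0)$, which are saddle-center rest points of $\hat H_{\mu,L_1(\mu)}$. A periodic orbit is a pair $P=(\gamma,T)$ of a non-constant trajectory $\gamma$ of this flow in $\hat H_{\mu,E}^{-1}(0)\subset\mathbb R^2\times(\mathbb R\times\mathbb R/2\pi\mathbb Z)$ and a (not necessarily minimal) period $T>0$. For $E>L_1(\mu)$, a Lyapunov orbit is a simple periodic orbit in $\hat H_{\mu,E}^{-1}(0)$ that belongs to a continuous family of simple periodic orbits in $\hat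 H_{\mu,e}^{-1}(0)$, $L_1(\mu)<e\le E$, shrinking to $S_+(\mu)$ or to $S_-(\mu)$ as $e\to L_1(\mu)^+$. For $E\le L_1(\mu)$ there is none. The Conley–Zehnder index of $P$ is defined as follows. Let $J(y,x)=(-x,y)$ and $K(y_1,y_2,x_1,x_2)=(-y_2,y_1,x_2,-x_1)$. Along $\gamma$ the tangent space of the energy surface modulo the flow direction is trivialized by the global frame $(K\nabla\hat H_{\mu,E},\,JK\nabla\hat H_{\mu,E})/|\nabla\hat H_{\mu,E}|$. Let $I_P\subset\mathbb R$ be the set of total variations of argument over $[0,T]$, divided by $2\pi$, of the nonzero solutions of the linearized flow along $\gamma$, tangent to the energy surface and taken modulo the flow direction, in this frame. Then $\mu_{\mathrm{CZ}}(P)=2k$ if $k\in I_P-\varepsilon$ for all sufficiently small $\varepsilon>0$, and $\mu_{\mathrm{CZ}}(P)=2k+1$ if $I_P-\varepsilon\subset(k,k+1)$ for all sufficiently small $\varepsilon>0$. **Theorem.** Let $0<\mu_0<1$ and $N\in\mathbb N$. There exist an open neighborhood $\mathcal U_N\subset\mathbb R^2\times(\mathbb R\times\mathbb R/2\pi\mathbb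 Z)$ of the saddle-center singularities $S_\pm(\mu_0)$ and $\delta>0$ such that for all $(\mu,E)$ with $|\mu-\mu_0|<\delta$ and $|E-L_1(\mu_0)|<\delta$, every periodic orbit $P\subset\hat H_{\mu,E}^{-1}(0)$ that enters $\mathcal U_N$ and is not a cover of a Lyapunov orbit satisfies $\mu_{\mathrm{CZ}}(P)>N$. -/

import Mathlib

open Filter Topology
open scoped RealInnerProductSpace

noncomputable section

namespace CR3BP

/-! ## The circular planar restricted three-body problem -/

/-- The Hamiltonian of the circular planar restricted three-body problem in rotating coordinates
`q = q₁ + i q₂` (position) and `p = p₁ + i p₂` (momentum). -/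
def rotHamiltonian (μ : ℝ) (p q : ℂ) : ℝ :=
  ‖p + Complex.I * q‖ ^ 2 / 2 - μ / ‖q - (1 - μ)‖ - (1 - μ) / ‖q + μ‖ - ‖q‖ ^ 2 / 2

/-- `r` is the distance from the moon `1 - μ` to a rest point `1 - μ - r` on the segment between
the primaries. -/
def IsFirstLagrangeRadius (μ r : ℝ) : Prop :=
  0 < r ∧ r < 1 ∧ (1 - μ) / (1 - r) ^ 2 - μ / r ^ 2 = 1 - μ - r

theorem existsUnique_firstLagrangeRadius {μ : ℝ} (h0 : 0 < μ) (h1 : μ < 1) :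
    ∃! r, IsFirstLagrangeRadius μ r := by
  -- clear denominators
  have key : ∀ r : ℝ, 0 < r → r < 1 →
      ((1 - μ) / (1 - r) ^ 2 - μ / r ^ 2 = 1 - μ - r ↔
        (1 - μ) * r ^ 2 - μ * (1 - r) ^ 2 - (1 - μ - r) * (r ^ 2 * (1 - r) ^ 2) = 0) := by
    intro r hr0 hr1
    have e1 : r ≠ 0 := hr0.ne'
    have e2 : (1 - r) ≠ 0 := by linarith
    rw [div_sub_div _ _ (pow_ne_zero 2 e2) (pow_ne_zero 2 e1),
      div_eq_iff (mul_ne_zero (pow_ne_zero 2 e2) (pow_ne_zero 2 e1))]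
    constructor <;> intro h <;> linarith
  have hex : ∃ r ∈ Set.Icc (0 : ℝ) 1,
      (1 - μ) * r ^ 2 - μ * (1 - r) ^ 2 - (1 - μ - r) * (r ^ 2 * (1 - r) ^ 2) = 0 := by
    have hc : ContinuousOn (fun r : ℝ =>
        (1 - μ) * r ^ 2 - μ * (1 - r) ^ 2 - (1 - μ - r) * (r ^ 2 * (1 - r) ^ 2))
        (Set.Icc 0 1) := by fun_prop
    have := intermediate_value_Icc (zero_le_one' ℝ) hc
    exact this ⟨by norm_num; linarith, by norm_num; linarith⟩
  obtain ⟨r, ⟨hr0, hr1⟩, hr⟩ := hex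
  have hr0' : 0 < r := by
    rcases hr0.eq_or_lt with h | h
    · subst h; norm_num at hr; linarith
    · exact h
  have hr1' : r < 1 := by
    rcases hr1.eq_or_lt with h | h
    · subst h; norm_num at hr; linarith
    · exact h
  have mono : ∀ a b : ℝ, 0 < a → a < b → b < 1 →
      (1 - μ) / (1 - a) ^ 2 - μ / a ^ 2 - (1 - μ - a) <
        (1 - μ) / (1 - b) ^ 2 - μ / b ^ 2 - (1 - μ - b) := by
    intro a b ha hab hb
    have i1 : (1 - μ) / (1 - a) ^ 2 ≤ (1 - μ) / (1 - b) ^ 2 := by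
      apply div_le_div_of_nonneg_left (by linarith) (by nlinarith) (by nlinarith)
    have i2 : μ / b ^ 2 ≤ μ / a ^ 2 := by
      apply div_le_div_of_nonneg_left h0.le (by positivity) (by nlinarith)
    linarith
  refine ⟨r, ⟨hr0', hr1', (key r hr0' hr1').2 hr⟩, ?_⟩
  rintro s ⟨hs0, hs1, hs⟩
  have hr' := (key r hr0' hr1').2 hr
  rcases lt_trichotomy s r with h | h | h
  · have := mono s r hs0 h hr1'; linarith
  · exact h
  · have := mono r s hr0' h hs1; linarith

/-- The distance `r₁(μ)` between the moon and the first Lagrange point. -/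
def firstLagrangeRadius (μ : ℝ) : ℝ := sInf {r | IsFirstLagrangeRadius μ r}

theorem firstLagrangeRadius_spec {μ : ℝ} (h0 : 0 < μ) (h1 : μ < 1) :
    IsFirstLagrangeRadius μ (firstLagrangeRadius μ) := by
  obtain ⟨r, hr, hu⟩ := existsUnique_firstLagrangeRadius h0 h1
  have : {r | IsFirstLagrangeRadius μ r} = {r} := by
    ext s
    exact ⟨fun h => hu s h, fun h => by rw [Set.mem_singleton_iff] at h; subst h; exact hr⟩
  rw [firstLagrangeRadius, this, csInf_singleton]
  exact hr

/-- The position `l̂₁(μ) = 1 - μ - r₁(μ)` of the first Lagrange point. -/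
def firstLagrangePosition (μ : ℝ) : ℝ := 1 - μ - firstLagrangeRadius μ

/-- The first Lagrange value `L₁(μ)`, the energy of the rest point `l₁(μ)`, whose position is `l̂₁`
and whose momentum is `p = -i l̂₁`. -/
def firstLagrangeValue (μ : ℝ) : ℝ :=
  rotHamiltonian μ (-Complex.I * firstLagrangePosition μ) (firstLagrangePosition μ)

/-! ## The regularized system in elliptic-hyperbolic coordinates -/

/-- The universal cover of the regularized phase space, with coordinates `(y₁, y₂, x₁, x₂)`. -/
abbrev LiftedPhase := EuclideanSpace ℝ (Fin 4)

/-- The regularized phase space `ℝ² × (ℝ × ℝ/2πℤ)`. -/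
abbrev Phase := (ℝ × ℝ) × (ℝ × Real.Angle)

/-- The covering map `(y₁, y₂, x₁, x₂) ↦ ((y₁, y₂), (x₁, x₂ mod 2π))`. -/
def toPhase (z : LiftedPhase) : Phase := ((z 0, z 1), (z 2, (z 3 : Real.Angle)))

/-- The regularized potential `V_{μ,E}(x)`. -/
def regPotential (μ E x₁ x₂ : ℝ) : ℝ :=
  -(E * Real.cosh x₁ ^ 2) / 4 - Real.cosh x₁ / 2 - Real.sinh (2 * x₁) ^ 2 / 128
    + E * Real.cos x₂ ^ 2 / 4 - Real.sin (2 * x₂) ^ 2 / 128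
    + (1 - 2 * μ) * (Real.cos x₂ / 2
      - (1 / 2 - μ + Real.cosh x₁ * Real.cos x₂) * (Real.cosh x₁ ^ 2 - Real.cos x₂ ^ 2) / 16)

/-- The regularized Hamiltonian `Ĥ_{μ,E}(y, x)`, lifted to `ℝ⁴`; it is `2π`-periodic in `x₂`. -/
def regHamiltonian (μ E : ℝ) (z : LiftedPhase) : ℝ :=
  ((z 0 + Real.sin (2 * z 3) / 8) ^ 2 + (z 1 + Real.sinh (2 * z 2) / 8) ^ 2) / 2
    + regPotential μ E (z 2) (z 3)

/-- Away from collisions `Ĥ_{μ,E}` is the time rescaling `|sinh ζ|² (H_μ - E) / 4` of the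
three-body Hamiltonian in the coordinates `ζ = x₁ + i x₂`, `q = cosh ζ / 2 + (1/2 - μ)`,
`p = 2 (y₁ + i y₂) / conj (sinh ζ) - i (1/2 - μ)`. -/
theorem regHamiltonian_eq (μ E : ℝ) (z : LiftedPhase)
    (h : Complex.sinh (z 2 + z 3 * Complex.I) ≠ 0) :
    regHamiltonian μ E z = ‖Complex.sinh (z 2 + z 3 * Complex.I)‖ ^ 2 / 4 *
      (rotHamiltonian μ
        (2 * (z 0 + z 1 * Complex.I) /
          (starRingEnd ℂ) (Complex.sinh (z 2 + z 3 * Complex.I)) - Complex.I * (1 / 2 - μ))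
        (Complex.cosh (z 2 + z 3 * Complex.I) / 2 + (1 / 2 - μ)) - E) := by
  set C := Real.cosh (z 2) with hC
  set S := Real.sinh (z 2) with hS
  set c := Real.cos (z 3) with hc
  set s := Real.sin (z 3) with hs
  have hCS : C ^ 2 = S ^ 2 + 1 := Real.cosh_sq (z 2)
  have hcs : s ^ 2 + c ^ 2 = 1 := Real.sin_sq_add_cos_sq (z 3)
  have hsh : Complex.sinh (z 2 + z 3 * Complex.I) = ⟨S * c, C * s⟩ := by
    rw [Complex.sinh_add, Complex.sinh_mul_I, Complex.cosh_mul_I, Complex.mk_eq_add_mul_I,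
      hC, hS, hc, hs]
    push_cast
    ring
  have hch : Complex.cosh (z 2 + z 3 * Complex.I) = ⟨C * c, S * s⟩ := by
    rw [Complex.cosh_add, Complex.sinh_mul_I, Complex.cosh_mul_I, Complex.mk_eq_add_mul_I,
      hC, hS, hc, hs]
    push_cast
    ring
  have nsq : ∀ a b : ℝ, ‖(⟨a, b⟩ : ℂ)‖ ^ 2 = a ^ 2 + b ^ 2 := by
    intro a b
    rw [Complex.sq_norm, Complex.normSq_mk]; ring
  have hC1 : 1 ≤ C := Real.one_le_cosh _
  have hc1 : c ≤ 1 := Real.cos_le_one _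
  have hc2 : -1 ≤ c := Real.neg_one_le_cos _
  rw [hsh] at h
  have hD : (S * c) ^ 2 + (C * s) ^ 2 = (C - c) * (C + c) := by
    have e1 : S ^ 2 = C ^ 2 - 1 := by linarith
    have e2 : s ^ 2 = 1 - c ^ 2 := by linarith
    rw [mul_pow, mul_pow, e1, e2]; ring
  have hDne : (C - c) * (C + c) ≠ 0 := by
    rw [← hD, ← nsq]
    exact pow_ne_zero 2 (norm_ne_zero_iff.2 h)
  have hm : C - c ≠ 0 := left_ne_zero_of_mul hDne
  have hp : C + c ≠ 0 := right_ne_zero_of_mul hDne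
  have n1 : ‖Complex.cosh (z 2 + z 3 * Complex.I) / 2 + (1 / 2 - μ) - (1 - μ)‖ = (C - c) / 2 := by
    have : Complex.cosh (z 2 + z 3 * Complex.I) / 2 + (1 / 2 - μ) - (1 - μ)
        = ⟨(C * c - 1) / 2, S * s / 2⟩ := by
      rw [hch]
      apply Complex.ext <;> simp <;> ring
    rw [this, ← sq_eq_sq₀ (norm_nonneg _) (by linarith), nsq]
    have e1 : S ^ 2 = C ^ 2 - 1 := by linarith
    have e2 : s ^ 2 = 1 - c ^ 2 := by linarith
    rw [div_pow, div_pow, mul_pow, e1, e2]; ring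
  have n2 : ‖Complex.cosh (z 2 + z 3 * Complex.I) / 2 + (1 / 2 - μ) + μ‖ = (C + c) / 2 := by
    have : Complex.cosh (z 2 + z 3 * Complex.I) / 2 + (1 / 2 - μ) + μ
        = ⟨(C * c + 1) / 2, S * s / 2⟩ := by
      rw [hch]
      apply Complex.ext <;> simp <;> ring
    rw [this, ← sq_eq_sq₀ (norm_nonneg _) (by linarith), nsq]
    have e1 : S ^ 2 = C ^ 2 - 1 := by linarith
    have e2 : s ^ 2 = 1 - c ^ 2 := by linarith
    rw [div_pow, div_pow, mul_pow, e1, e2]; ring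
  have n3 : ‖Complex.cosh (z 2 + z 3 * Complex.I) / 2 + (1 / 2 - μ)‖ ^ 2
      = (C * c / 2 + (1 / 2 - μ)) ^ 2 + (S * s / 2) ^ 2 := by
    have : Complex.cosh (z 2 + z 3 * Complex.I) / 2 + (1 / 2 - μ)
        = ⟨C * c / 2 + (1 / 2 - μ), S * s / 2⟩ := by
      rw [hch]
      apply Complex.ext <;> simp
    rw [this, nsq]
  have n4 : ‖2 * (z 0 + z 1 * Complex.I) /
          (starRingEnd ℂ) (Complex.sinh (z 2 + z 3 * Complex.I)) - Complex.I * (1 / 2 - μ)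
      + Complex.I * (Complex.cosh (z 2 + z 3 * Complex.I) / 2 + (1 / 2 - μ))‖ ^ 2
      = ((2 * z 0 + s * c / 2) ^ 2 + (2 * z 1 + C * S / 2) ^ 2) / ((C - c) * (C + c)) := by
    have hcj : (starRingEnd ℂ) (⟨S * c, C * s⟩ : ℂ) ≠ 0 := by
      simpa using h
    have : 2 * (z 0 + z 1 * Complex.I) /
          (starRingEnd ℂ) (Complex.sinh (z 2 + z 3 * Complex.I)) - Complex.I * (1 / 2 - μ)
      + Complex.I * (Complex.cosh (z 2 + z 3 * Complex.I) / 2 + (1 / 2 - μ))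
      = ⟨2 * z 0 + s * c / 2, 2 * z 1 + C * S / 2⟩ / (starRingEnd ℂ) (⟨S * c, C * s⟩ : ℂ) := by
      have e3 : (⟨2 * z 0 + s * c / 2, 2 * z 1 + C * S / 2⟩ : ℂ) = 2 * (z 0 + z 1 * Complex.I)
          + Complex.I * (⟨C * c, S * s⟩ / 2) * (starRingEnd ℂ) (⟨S * c, C * s⟩ : ℂ) := by
        apply Complex.ext
        · simp
          linear_combination (-(s * c) / 2) * hCS
        · simp
          linear_combination (-(C * S) / 2) * hcs
      rw [e3, hsh, hch, add_div, mul_div_cancel_right₀ _ hcj]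
      ring
    rw [this, norm_div, div_pow, nsq, Complex.norm_conj, nsq, hD]
  unfold rotHamiltonian
  rw [n1, n2, n3, n4, hsh, nsq, hD]
  unfold regHamiltonian regPotential
  rw [Real.sin_two_mul, Real.sinh_two_mul, ← hC, ← hS, ← hc, ← hs]
  field_simp
  have e1 : S ^ 2 = C ^ 2 - 1 := by linarith
  have e2 : s ^ 2 = 1 - c ^ 2 := by linarith
  ring_nf
  simp only [e1, e2]
  ring

/-- The saddle-center singularities `S_±(μ)`, `σ = ± 1`, over the first Lagrange point. They lie at
`x₁ = 0`, `x₂ = ± arccos (1 - 2 r₁)`, `y = -F(x)`. -/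
def saddleCenter (μ σ : ℝ) : LiftedPhase :=
  let x₂ := σ * Real.arccos (1 - 2 * firstLagrangeRadius μ)
  !₂[-(Real.sin (2 * x₂) / 8), 0, 0, x₂]

/-! ## Hamiltonian dynamics on `ℝ⁴` -/

/-- The standard complex structure `J (y, x) = (-x, y)`. -/
def stdJ (v : LiftedPhase) : LiftedPhase := !₂[-v 2, -v 3, v 0, v 1]

/-- A second quaternionic unit `K`, anticommuting with `J`: in complex coordinates
`w_j = y_j + i x_j` it is `(w₁, w₂) ↦ (-conj w₂, conj w₁)`. -/
def stdK (v : LiftedPhase) : LiftedPhase := !₂[-v 1, v 0, v 3, -v 2]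

/-- The Hamiltonian vector field `J ∇H`, i.e. `ẏ = -∂H/∂x`, `ẋ = ∂H/∂y`. -/
def hamVectorField (H : LiftedPhase → ℝ) (z : LiftedPhase) : LiftedPhase := stdJ (gradient H z)

/-- `(γ, T)` is a (not necessarily simple) periodic orbit of the flow on the zero level of `H` in
the phase space `ℝ² × (ℝ × ℝ/2πℤ)`; `γ` is a lift of the trajectory to `ℝ⁴`. Rest points do not
count as periodic orbits. -/
structure IsPeriodicOrbit (H : LiftedPhase → ℝ) (γ : ℝ → LiftedPhase) (T : ℝ) : Prop where
  pos : 0 < T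
  trajectory : ∀ t, HasDerivAt γ (hamVectorField H (γ t)) t
  level : ∀ t, H (γ t) = 0
  periodic : ∀ t, toPhase (γ (t + T)) = toPhase (γ t)
  nonconstant : ∃ t, toPhase (γ t) ≠ toPhase (γ 0)

/-- A periodic orbit with its minimal period. -/
structure IsSimplePeriodicOrbit (H : LiftedPhase → ℝ) (γ : ℝ → LiftedPhase) (T : ℝ) : Prop
    extends IsPeriodicOrbit H γ T where
  minimal : ∀ t, 0 < t → t < T → toPhase (γ t) ≠ toPhase (γ 0)

/-- `(γ, T)` is a `k`-fold cover of `(γ', T')` for some `k ≥ 1`, up to a shift of time. -/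
def IsCoverOf (γ : ℝ → LiftedPhase) (T : ℝ) (γ' : ℝ → LiftedPhase) (T' : ℝ) : Prop :=
  ∃ k : ℕ, 1 ≤ k ∧ T = k * T' ∧ ∃ s, ∀ t, toPhase (γ t) = toPhase (γ' (t + s))

/-- `(γ, T)` is a Lyapunov orbit near the first Lagrange point at energy `E > L₁(μ)`: it belongs to
a continuous family `(G e, P e)`, `L₁(μ) < e ≤ E`, of simple periodic orbits of energies `e`, which
shrinks to one of the saddle-centers `S_±(μ)` as `e → L₁(μ)`. -/
def IsLyapunovOrbit (μ E : ℝ) (γ : ℝ → LiftedPhase) (T : ℝ) : Prop :=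
  firstLagrangeValue μ < E ∧
  ∃ (G : ℝ → ℝ → LiftedPhase) (P : ℝ → ℝ),
    G E = γ ∧ P E = T ∧
    ContinuousOn (Function.uncurry G) (Set.Ioc (firstLagrangeValue μ) E ×ˢ Set.univ) ∧
    ContinuousOn P (Set.Ioc (firstLagrangeValue μ) E) ∧
    (∀ e ∈ Set.Ioc (firstLagrangeValue μ) E,
      IsSimplePeriodicOrbit (regHamiltonian μ e) (G e) (P e)) ∧
    ∃ σ : ℝ, (σ = 1 ∨ σ = -1) ∧
      ∀ W ∈ 𝓝 (toPhase (saddleCenter μ σ)),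
        ∀ᶠ e in 𝓝[>] firstLagrangeValue μ, ∀ t, toPhase (G e t) ∈ W

/-! ## The Conley–Zehnder index -/

/-- `v` solves the linearized Hamiltonian equation along `γ`. -/
def IsLinearizedSolution (H : LiftedPhase → ℝ) (γ v : ℝ → LiftedPhase) : Prop :=
  ∀ t, HasDerivAt v (fderiv ℝ (hamVectorField H) (γ t) (v t)) t

/-- The energy surface has the tangent space `(∇H)^⊥`, spanned by the vector field `J∇H` and by the
frame `(K∇H, JK∇H)`, which is positively oriented for the symplectic form. The last two vectors
trivialize the quotient of the tangent space by the flow direction (equivalently, the contact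
structure) over the whole surface. The coordinates of `v` in this frame, up to the positive factor
`‖∇H‖²`, as a complex number. -/
def transverseCoord (H : LiftedPhase → ℝ) (z v : LiftedPhase) : ℂ :=
  ⟨⟪stdK (gradient H z), v⟫, ⟪stdJ (stdK (gradient H z)), v⟫⟩

/-- The set `I_P` of the total variations of argument, in turns, over `[0, T]` of the nonzero
solutions of the linearized flow on the energy surface modulo the flow direction, in the global
frame above. -/
def rotationSet (H : LiftedPhase → ℝ) (γ : ℝ → LiftedPhase) (T : ℝ) : Set ℝ :=
  {d | ∃ (v : ℝ → LiftedPhase) (θ : ℝ → ℝ),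
    IsLinearizedSolution H γ v ∧
    ⟪gradient H (γ 0), v 0⟫ = 0 ∧
    transverseCoord H (γ 0) (v 0) ≠ 0 ∧
    Continuous θ ∧
    (∀ t, transverseCoord H (γ t) (v t) =
      ‖transverseCoord H (γ t) (v t)‖ * Complex.exp (θ t * Complex.I)) ∧
    d = (θ T - θ 0) / (2 * Real.pi)}

/-- `m` is the Conley–Zehnder index of `(γ, T)`: for all sufficiently small `ε > 0`, either
`m = 2k` with `k ∈ I_P - ε`, or `m = 2k + 1` with `I_P - ε ⊆ (k, k + 1)`. -/
def IsConleyZehnderIndex (H : LiftedPhase → ℝ) (γ : ℝ → LiftedPhase) (T : ℝ) (m : ℤ) : Prop :=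
  (rotationSet H γ T).Nonempty ∧
  ((∃ k : ℤ, m = 2 * k ∧ ∀ᶠ ε in 𝓝[>] (0 : ℝ), (k : ℝ) + ε ∈ rotationSet H γ T) ∨
   (∃ k : ℤ, m = 2 * k + 1 ∧ ∀ᶠ ε in 𝓝[>] (0 : ℝ), ∀ d ∈ rotationSet H γ T,
      d - ε ∈ Set.Ioo (k : ℝ) (k + 1)))

end CR3BP

end

open Filter Topology
open scoped RealInnerProductSpace

noncomputable section

namespace CR3BP

/-! ## Globally Lipschitz differential equations -/

section ODE

open Set

variable {E : Type*} [NormedAddCommGroup E] [NormedSpace ℝ E]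

theorem exists_local_solution [CompleteSpace E] {f : ℝ → E → E} {K : NNReal}
    (hf : ∀ t, LipschitzWith K (f t)) (hc : ∀ x, Continuous fun t => f t x) (t₀ : ℝ) (x₀ : E) :
    ∃ α : ℝ → E, α t₀ = x₀ ∧ ∀ t ∈ Ioo (t₀ - 1 / (2 * (K + 1))) (t₀ + 1 / (2 * (K + 1))),
      HasDerivAt α (f t (α t)) t := by
  set h : ℝ := 1 / (2 * (K + 1)) with hh
  have hpos : 0 < h := by positivity
  obtain ⟨M, hM⟩ := (isCompact_Icc (a := t₀ - h) (b := t₀ + h)).exists_bound_of_continuousOn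
    (hc x₀).continuousOn
  have hM0 : 0 ≤ M := (norm_nonneg _).trans (hM t₀ ⟨by linarith, by linarith⟩)
  have ht₀ : t₀ ∈ Icc (t₀ - h) (t₀ + h) := ⟨by linarith, by linarith⟩
  have hPL : IsPicardLindelof f (⟨t₀, ht₀⟩ : Icc (t₀ - h) (t₀ + h)) x₀ ⟨M + 1, by linarith⟩ 0
      ⟨M + K * (M + 1), by positivity⟩ K := by
    refine ⟨fun t _ => (hf t).lipschitzOnWith, fun x _ => (hc x).continuousOn, ?_, ?_⟩
    · intro t ht x hx
      have h1 := (hf t).dist_le_mul x x₀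
      rw [dist_eq_norm, dist_eq_norm] at h1
      rw [Metric.mem_closedBall, dist_eq_norm] at hx
      have h2 : ‖f t x‖ ≤ ‖f t x - f t x₀‖ + ‖f t x₀‖ := by
        simpa using norm_add_le (f t x - f t x₀) (f t x₀)
      have h3 := hM t ht
      have h4 : (K : ℝ) * ‖x - x₀‖ ≤ K * (M + 1) := by gcongr; exact hx
      show ‖f t x‖ ≤ M + K * (M + 1)
      linarith
    · show (M + K * (M + 1)) * max (t₀ + h - t₀) (t₀ - (t₀ - h)) ≤ M + 1 - 0
      rw [add_sub_cancel_left, sub_sub_cancel, max_self, hh, mul_one_div, div_le_iff₀ (by positivity)]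
      have : (0 : ℝ) ≤ K := K.2
      nlinarith
  obtain ⟨α, h0, hα⟩ := hPL.exists_eq_forall_mem_Icc_hasDerivWithinAt₀
  exact ⟨α, h0, fun t ht => (hα t (Ioo_subset_Icc_self ht)).hasDerivAt (Icc_mem_nhds ht.1 ht.2)⟩

/-- Gluing a solution on `(a, b)` to a solution on `(c, d)` along a common value. -/
theorem glue_solutions {f : ℝ → E → E} {K : NNReal} (hf : ∀ t, LipschitzWith K (f t))
    {α β : ℝ → E} {a b c d s : ℝ} (hα : ∀ t ∈ Ioo a b, HasDerivAt α (f t (α t)) t)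
    (hβ : ∀ t ∈ Ioo c d, HasDerivAt β (f t (β t)) t) (hs : s ∈ Ioo a b) (hs' : s ∈ Ioo c d)
    (h : α s = β s) :
    ∃ η : ℝ → E, (∀ t < s, η t = α t) ∧ (∀ t, s ≤ t → η t = β t) ∧
      ∀ t ∈ Ioo a d, HasDerivAt η (f t (η t)) t := by
  have hEq : EqOn α β (Ioo (max a c) (min b d)) := by
    refine ODE_solution_unique_of_mem_Ioo (v := f) (s := fun _ => univ) (K := K)
      (fun t _ => (hf t).lipschitzOnWith)
      (t₀ := s) ⟨max_lt hs.1 hs'.1, lt_min hs.2 hs'.2⟩ ?_ ?_ h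
    · exact fun t ht => ⟨hα t ⟨(le_max_left _ _).trans_lt ht.1, ht.2.trans_le (min_le_left _ _)⟩,
        trivial⟩
    · exact fun t ht => ⟨hβ t ⟨(le_max_right _ _).trans_lt ht.1, ht.2.trans_le (min_le_right _ _)⟩,
        trivial⟩
  have hev : ∀ t, t < s → (fun r => if r < s then α r else β r) =ᶠ[𝓝 t] α := fun t ht => by
    filter_upwards [Iio_mem_nhds ht] with r hr
    exact if_pos hr
  refine ⟨fun t => if t < s then α t else β t, fun t ht => if_pos ht, fun t ht => if_neg ht.not_gt,
    fun t ht => ?_⟩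
  rcases lt_trichotomy t s with hts | rfl | hts
  · simp only [hts, if_true]
    exact (hα t ⟨ht.1, hts.trans hs.2⟩).congr_of_eventuallyEq (hev t hts)
  · have : (fun r => if r < t then α r else β r) =ᶠ[𝓝 t] β := by
      filter_upwards [Ioo_mem_nhds (max_lt hs.1 hs'.1) (lt_min hs.2 hs'.2)] with r hr
      split_ifs
      · exact hEq hr
      · rfl
    simp only [lt_irrefl, if_false]
    exact (hβ t hs').congr_of_eventuallyEq this
  · have : (fun r => if r < s then α r else β r) =ᶠ[𝓝 t] β := by
      filter_upwards [Ioi_mem_nhds hts] with r hr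
      exact if_neg (not_lt.2 (le_of_lt hr))
    simp only [hts.not_gt, if_false]
    exact (hβ t ⟨hs'.1.trans hts, ht.2⟩).congr_of_eventuallyEq this

theorem exists_global_solution [CompleteSpace E] {f : ℝ → E → E} {K : NNReal}
    (hf : ∀ t, LipschitzWith K (f t)) (hc : ∀ x, Continuous fun t => f t x) (x₀ : E) :
    ∃ α : ℝ → E, α 0 = x₀ ∧ ∀ t, HasDerivAt α (f t (α t)) t := by
  set h : ℝ := 1 / (2 * (K + 1)) with hh
  have hpos : 0 < h := by positivity
  have key : ∀ n : ℕ, ∃ α : ℝ → E, α 0 = x₀ ∧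
      ∀ t ∈ Ioo (-((n + 2) * (h / 2))) ((n + 2) * (h / 2)), HasDerivAt α (f t (α t)) t := by
    intro n
    induction n with
    | zero =>
      obtain ⟨α, h0, hα⟩ := exists_local_solution hf hc 0 x₀
      refine ⟨α, h0, fun t ht => hα t ⟨?_, ?_⟩⟩
      · have := ht.1; push_cast at this; linarith
      · have := ht.2; push_cast at this; linarith
    | succ n ih =>
      obtain ⟨α, h0, hα⟩ := ih
      have hn : (0 : ℝ) ≤ n * h := by positivity
      set s : ℝ := (n + 2) * (h / 2) - h / 4 with hs
      obtain ⟨β, hβ0, hβ⟩ := exists_local_solution hf hc s (α s)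
      obtain ⟨η, η1, η2, hη⟩ := glue_solutions hf hα hβ (s := s)
        ⟨by rw [hs]; linarith, by rw [hs]; linarith⟩ ⟨by linarith, by linarith⟩ hβ0.symm
      obtain ⟨β', hβ'0, hβ'⟩ := exists_local_solution hf hc (-s) (η (-s))
      obtain ⟨ζ, ζ1, ζ2, hζ⟩ := glue_solutions hf hβ' hη (s := -s)
        ⟨by linarith, by linarith⟩ ⟨by rw [hs]; linarith, by linarith⟩ hβ'0
      refine ⟨ζ, ?_, fun t ht => hζ t ⟨?_, ?_⟩⟩
      · rw [ζ2 0 (by rw [hs]; linarith), η1 0 (by rw [hs]; linarith), h0]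
      · have := ht.1; push_cast at this; rw [hs]; linarith
      · have := ht.2; push_cast at this; rw [hs]; linarith
  choose α h0 hα using key
  have hagree : ∀ (m n : ℕ) (t : ℝ), t ∈ Ioo (-((m + 2 : ℝ) * (h / 2))) ((m + 2) * (h / 2)) → m ≤ n →
      α m t = α n t := by
    intro m n t ht hmn
    have hmn' : (m : ℝ) ≤ n := by exact_mod_cast hmn
    have hle : (m + 2 : ℝ) * (h / 2) ≤ (n + 2) * (h / 2) := by gcongr
    refine ODE_solution_unique_of_mem_Ioo (v := f) (s := fun _ => univ) (K := K)
      (fun t _ => (hf t).lipschitzOnWith) (t₀ := 0) ⟨?_, by positivity⟩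
      (fun t ht => ⟨hα m t ht, trivial⟩)
      (fun t ht => ⟨hα n t ⟨by linarith [ht.1], by linarith [ht.2]⟩, trivial⟩) ?_ ht
    · rw [neg_lt_zero]; positivity
    · rw [h0, h0]
  have hN : ∀ t : ℝ, ∃ n : ℕ, t ∈ Ioo (-((n + 2 : ℝ) * (h / 2))) ((n + 2) * (h / 2)) := by
    intro t
    obtain ⟨n, hn⟩ := exists_nat_gt (|t| / (h / 2))
    rw [div_lt_iff₀ (by positivity)] at hn
    refine ⟨n, ?_, ?_⟩
    · have := neg_abs_le t; nlinarith
    · have := le_abs_self t; nlinarith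
  choose N hN using hN
  refine ⟨fun t => α (N t) t, h0 _, fun t => ?_⟩
  refine (hα (N t) t (hN t)).congr_of_eventuallyEq ?_
  filter_upwards [Ioo_mem_nhds (hN t).1 (hN t).2] with r hr
  rcases le_total (N t) (N r) with hle | hle
  · exact (hagree _ _ r hr hle).symm
  · exact hagree _ _ r (hN r) hle

theorem global_solution_unique {f : ℝ → E → E} {K : NNReal}
    (hf : ∀ t, LipschitzWith K (f t)) {α β : ℝ → E} (hα : ∀ t, HasDerivAt α (f t (α t)) t)
    (hβ : ∀ t, HasDerivAt β (f t (β t)) t) {t₀ : ℝ} (h : α t₀ = β t₀) : α = β :=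
  ODE_solution_unique_univ (v := f) (s := fun _ => univ) (fun t => (hf t).lipschitzOnWith)
    (fun t => ⟨hα t, trivial⟩) (fun t => ⟨hβ t, trivial⟩) h

/-- Continuous dependence: the distance of trajectories of two vector fields. -/
theorem dist_trajectories_le {f g : E → E} {K : NNReal} (hf : LipschitzWith K f) {η : ℝ}
    (hfg : ∀ x, ‖g x - f x‖ ≤ η)
    {α β : ℝ → E} (hα : ∀ t, HasDerivAt α (f (α t)) t)
    (hβ : ∀ t, HasDerivAt β (g (β t)) t) (t : ℝ) :
    dist (α t) (β t) ≤ gronwallBound (dist (α 0) (β 0)) K η |t| := by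
  rcases le_total 0 t with ht | ht
  · have := dist_le_of_approx_trajectories_ODE (v := fun _ => f) (εf := 0) (εg := η)
      (fun _ => hf) (f := α) (g := β) (a := 0) (b := t)
      (HasDerivAt.continuousOn fun r _ => hα r) (fun r _ => (hα r).hasDerivWithinAt)
      (fun r _ => (dist_self _).le)
      (HasDerivAt.continuousOn fun r _ => hβ r) (fun r _ => (hβ r).hasDerivWithinAt)
      (fun r _ => by rw [dist_eq_norm]; exact hfg _) le_rfl t ⟨ht, le_rfl⟩
    rw [abs_of_nonneg ht]
    rwa [zero_add, sub_zero] at this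
  · have hα' : ∀ r, HasDerivAt (fun r => α (-r)) (-f (α (-r))) r := fun r => by
      simpa [Function.comp_def] using (hα (-r)).scomp r (hasDerivAt_neg r)
    have hβ' : ∀ r, HasDerivAt (fun r => β (-r)) (-g (β (-r))) r := fun r => by
      simpa [Function.comp_def] using (hβ (-r)).scomp r (hasDerivAt_neg r)
    have := dist_le_of_approx_trajectories_ODE (v := fun _ x => -f x) (εf := 0) (εg := η) (K := K)
      (fun _ => hf.neg) (f := fun r => α (-r)) (g := fun r => β (-r))
      (a := 0) (b := -t)
      (HasDerivAt.continuousOn fun r _ => hα' r) (fun r _ => (hα' r).hasDerivWithinAt)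
      (fun r _ => (dist_self _).le)
      (HasDerivAt.continuousOn fun r _ => hβ' r) (fun r _ => (hβ' r).hasDerivWithinAt)
      (fun r _ => by rw [dist_neg_neg, dist_eq_norm]; exact hfg _) le_rfl (-t)
      ⟨by linarith, le_rfl⟩
    simpa [abs_of_nonpos ht] using this

end ODE

end CR3BP

namespace CR3BP

/-! ## Lagrangian pairs and their complex determinant -/

theorem inner_lifted (a b : LiftedPhase) :
    ⟪a, b⟫ = a 0 * b 0 + a 1 * b 1 + a 2 * b 2 + a 3 * b 3 := by
  simp [PiLp.inner_apply, Fin.sum_univ_four, mul_comm]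

theorem norm_sq_lifted (a : LiftedPhase) :
    ‖a‖ ^ 2 = a 0 ^ 2 + a 1 ^ 2 + a 2 ^ 2 + a 3 ^ 2 := by
  simp [EuclideanSpace.norm_sq_eq, Fin.sum_univ_four]

theorem lifted_ext {a b : LiftedPhase} (h0 : a 0 = b 0) (h1 : a 1 = b 1) (h2 : a 2 = b 2)
    (h3 : a 3 = b 3) : a = b := by
  ext i
  fin_cases i <;> assumption

@[simp] theorem stdJ_zero_apply (v : LiftedPhase) : stdJ v 0 = -v 2 := rfl
@[simp] theorem stdJ_one_apply (v : LiftedPhase) : stdJ v 1 = -v 3 := rfl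
@[simp] theorem stdJ_two_apply (v : LiftedPhase) : stdJ v 2 = v 0 := rfl
@[simp] theorem stdJ_three_apply (v : LiftedPhase) : stdJ v 3 = v 1 := rfl
@[simp] theorem stdK_zero_apply (v : LiftedPhase) : stdK v 0 = -v 1 := rfl
@[simp] theorem stdK_one_apply (v : LiftedPhase) : stdK v 1 = v 0 := rfl
@[simp] theorem stdK_two_apply (v : LiftedPhase) : stdK v 2 = v 3 := rfl
@[simp] theorem stdK_three_apply (v : LiftedPhase) : stdK v 3 = -v 2 := rfl

/-- The standard symplectic form. -/
def symp (a b : LiftedPhase) : ℝ := a 0 * b 2 + a 1 * b 3 - a 2 * b 0 - a 3 * b 1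

/-- The complex determinant of two vectors of `ℝ⁴ = ℂ²`, with `w_j = y_j + i x_j`. -/
def cdet (a b : LiftedPhase) : ℂ :=
  ⟨a 0 * b 1 - a 2 * b 3 - a 1 * b 0 + a 3 * b 2, a 0 * b 3 + a 2 * b 1 - a 1 * b 2 - a 3 * b 0⟩

theorem transverseCoord_eq_cdet (H : LiftedPhase → ℝ) (z v : LiftedPhase) :
    transverseCoord H z v = cdet (gradient H z) v := by
  apply Complex.ext
  · simp only [transverseCoord, inner_lifted, cdet, stdK_zero_apply, stdK_one_apply,
      stdK_two_apply, stdK_three_apply]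
    ring
  · simp only [transverseCoord, inner_lifted, cdet, stdK_zero_apply, stdK_one_apply,
      stdK_two_apply, stdK_three_apply, stdJ_zero_apply, stdJ_one_apply, stdJ_two_apply,
      stdJ_three_apply]
    ring

theorem cdet_stdJ_left (a b : LiftedPhase) : cdet (stdJ a) b = Complex.I * cdet a b := by
  apply Complex.ext <;> simp [cdet] <;> ring

theorem symp_stdJ_left (a b : LiftedPhase) : symp (stdJ a) b = -⟪a, b⟫ := by
  simp only [symp, inner_lifted, stdJ_zero_apply, stdJ_one_apply, stdJ_two_apply,
      stdJ_three_apply]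
  ring

theorem cdet_add_right (a b c : LiftedPhase) : cdet a (b + c) = cdet a b + cdet a c := by
  apply Complex.ext <;> simp [cdet] <;> ring

theorem cdet_smul_right (r : ℝ) (a b : LiftedPhase) : cdet a (r • b) = r * cdet a b := by
  apply Complex.ext <;> simp [cdet] <;> ring

theorem normSq_cdet {a b : LiftedPhase} (h : symp a b = 0) :
    Complex.normSq (cdet a b) = ‖a‖ ^ 2 * ‖b‖ ^ 2 - ⟪a, b⟫ ^ 2 := by
  simp only [symp] at h
  rw [Complex.normSq_apply, norm_sq_lifted, norm_sq_lifted, inner_lifted]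
  simp only [cdet]
  linear_combination (-(a 0 * b 2 + a 1 * b 3 - a 2 * b 0 - a 3 * b 1)) * h

/-- The symplectic map `y₁ ↦ s₁ (y₁ + c x₂)`, `y₂ ↦ s₂ (y₂ + c x₁)`, `x₁ ↦ x₁ / s₁`,
`x₂ ↦ x₂ / s₂`. -/
def twist (s₁ s₂ c : ℝ) (z : LiftedPhase) : LiftedPhase :=
  !₂[s₁ * (z 0 + c * z 3), s₂ * (z 1 + c * z 2), z 2 / s₁, z 3 / s₂]

/-- The inverse transpose of `twist s₁ s₂ c`. -/
def twistDual (s₁ s₂ c : ℝ) (z : LiftedPhase) : LiftedPhase :=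
  !₂[z 0 / s₁, z 1 / s₂, s₁ * (z 2 - c * z 1), s₂ * (z 3 - c * z 0)]

section twist

variable (s₁ s₂ c : ℝ)

@[simp] theorem twist_zero_apply (z : LiftedPhase) :
    twist s₁ s₂ c z 0 = s₁ * (z 0 + c * z 3) := rfl
@[simp] theorem twist_one_apply (z : LiftedPhase) :
    twist s₁ s₂ c z 1 = s₂ * (z 1 + c * z 2) := rfl
@[simp] theorem twist_two_apply (z : LiftedPhase) : twist s₁ s₂ c z 2 = z 2 / s₁ := rfl
@[simp] theorem twist_three_apply (z : LiftedPhase) : twist s₁ s₂ c z 3 = z 3 / s₂ := rfl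
@[simp] theorem twistDual_zero_apply (z : LiftedPhase) :
    twistDual s₁ s₂ c z 0 = z 0 / s₁ := rfl
@[simp] theorem twistDual_one_apply (z : LiftedPhase) :
    twistDual s₁ s₂ c z 1 = z 1 / s₂ := rfl
@[simp] theorem twistDual_two_apply (z : LiftedPhase) :
    twistDual s₁ s₂ c z 2 = s₁ * (z 2 - c * z 1) := rfl
@[simp] theorem twistDual_three_apply (z : LiftedPhase) :
    twistDual s₁ s₂ c z 3 = s₂ * (z 3 - c * z 0) := rfl

theorem twist_stdJ (z : LiftedPhase) :
    twist s₁ s₂ c (stdJ z) = stdJ (twistDual s₁ s₂ c z) := by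
  apply lifted_ext <;> simp <;> ring

theorem twist_sub_smul (z w : LiftedPhase) (r q : ℝ) :
    twist s₁ s₂ c (r • z - q • w) = r • twist s₁ s₂ c z - q • twist s₁ s₂ c w := by
  apply lifted_ext <;> simp <;> ring

variable {s₁ s₂}

theorem inner_twistDual_twist (h₁ : s₁ ≠ 0) (h₂ : s₂ ≠ 0) (p z : LiftedPhase) :
    ⟪twistDual s₁ s₂ c p, twist s₁ s₂ c z⟫ = ⟪p, z⟫ := by
  simp only [inner_lifted, twist_zero_apply, twist_one_apply, twist_two_apply, twist_three_apply,
    twistDual_zero_apply, twistDual_one_apply, twistDual_two_apply, twistDual_three_apply]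
  field_simp
  ring

theorem symp_twist (h₁ : s₁ ≠ 0) (h₂ : s₂ ≠ 0) (a b : LiftedPhase) :
    symp (twist s₁ s₂ c a) (twist s₁ s₂ c b) = symp a b := by
  simp only [symp, twist_zero_apply, twist_one_apply, twist_two_apply, twist_three_apply]
  field_simp
  ring

end twist

/-- The Plücker relation. -/
theorem plucker {a b : LiftedPhase} (h : symp a b = 0) :
    (a 0 * b 1 - a 1 * b 0) * (a 2 * b 3 - a 3 * b 2) + (a 0 * b 2 - a 2 * b 0) ^ 2
      = (a 0 * b 3 - a 3 * b 0) * (a 2 * b 1 - a 1 * b 2) := by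
  simp only [symp] at h
  linear_combination (a 0 * b 2 - a 2 * b 0) * h

/-- The real relations expressing that a twist turns the determinant of a Lagrangian pair by half a
turn have only the trivial solution. -/
theorem twist_half_turn {s₁ s₂ : ℝ} (h₁ : 0 < s₁) (h₂ : 0 < s₂) {c r P Q A A' B : ℝ} (hr0 : 0 ≤ r)
    (hpl : P * Q + B ^ 2 = A * A')
    (E1 : s₁ * s₂ * (P + 2 * c * B - c ^ 2 * Q) - Q / (s₁ * s₂) = -r * (P - Q))
    (E2 : s₁ / s₂ * A + s₂ / s₁ * A' = -r * (A + A')) :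
    P - Q = 0 ∧ A + A' = 0 := by
  have hAA : A * A' ≤ 0 := by
    have h3 : (s₁ / s₂ + r) * A ^ 2 = -((s₂ / s₁ + r) * (A * A')) := by
      linear_combination A * E2
    have h4 : 0 ≤ (s₁ / s₂ + r) * A ^ 2 := by positivity
    have h5 : 0 < s₂ / s₁ + r := by positivity
    by_contra hlt
    push Not at hlt
    have := mul_pos h5 hlt
    linarith
  obtain ⟨S, hS⟩ : ∃ S, S = s₁ * s₂ := ⟨_, rfl⟩
  rw [← hS] at E1
  have hS0 : 0 < S := hS ▸ mul_pos h₁ h₂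
  have h3 : S * (A * A' - (B - c * Q) ^ 2) + r * (A * A' - B ^ 2) = (1 / S + r) * Q ^ 2 := by
    have : S * (P + 2 * c * B - c ^ 2 * Q) * Q + r * P * Q = (1 / S + r) * Q ^ 2 := by
      linear_combination Q * E1
    rw [← this, ← hpl]
    ring
  have h4 : 0 < 1 / S + r := by positivity
  have h5 : S * (A * A' - (B - c * Q) ^ 2) ≤ 0 :=
    mul_nonpos_of_nonneg_of_nonpos hS0.le (by linarith [sq_nonneg (B - c * Q)])
  have h6 : r * (A * A' - B ^ 2) ≤ 0 :=
    mul_nonpos_of_nonneg_of_nonpos hr0 (by linarith [sq_nonneg B])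
  have hQ0 : Q = 0 := by
    have : Q ^ 2 ≤ 0 := by
      by_contra hlt
      push Not at hlt
      have := mul_pos h4 hlt
      linarith
    exact pow_eq_zero_iff (two_ne_zero) |>.1 (le_antisymm this (sq_nonneg _))
  subst hQ0
  simp only [mul_zero, sub_zero, zero_div, zero_add, ne_eq, OfNat.ofNat_ne_zero,
    not_false_eq_true, zero_pow] at h3 hpl E1 h5
  have h7 : S * (A * A' - B ^ 2) = 0 := by linarith
  have hB0 : B = 0 := by
    have h8 : A * A' - B ^ 2 = 0 := (mul_eq_zero.1 h7).resolve_left hS0.ne'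
    have : B ^ 2 ≤ 0 := by linarith
    exact pow_eq_zero_iff (two_ne_zero) |>.1 (le_antisymm this (sq_nonneg _))
  subst hB0
  have hP0 : P = 0 := by
    have : (S + r) * P = 0 := by linear_combination E1
    exact (mul_eq_zero.1 this).resolve_left (by positivity)
  have hAA0 : A * A' = 0 := by rw [← hpl]; ring
  have hAz : A = 0 := by
    have : (s₁ / s₂ + r) * A ^ 2 = 0 := by
      linear_combination A * E2 - (s₂ / s₁ + r) * hAA0
    exact pow_eq_zero_iff (two_ne_zero) |>.1 ((mul_eq_zero.1 this).resolve_left (by positivity))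
  subst hAz
  have hAz' : A' = 0 := by
    have : (s₂ / s₁ + r) * A' = 0 := by linear_combination E2
    exact (mul_eq_zero.1 this).resolve_left (by positivity)
  exact ⟨by rw [hP0, sub_zero], by rw [hAz', zero_add]⟩

/-- A twist rotates the determinant of a Lagrangian pair by less than half a turn. -/
theorem cdet_twist_div_mem_slitPlane {s₁ s₂ : ℝ} (h₁ : 0 < s₁) (h₂ : 0 < s₂) (c : ℝ)
    {a b : LiftedPhase} (h : symp a b = 0) (hD : cdet a b ≠ 0) :
    cdet (twist s₁ s₂ c a) (twist s₁ s₂ c b) / cdet a b ∈ Complex.slitPlane := by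
  rw [Complex.mem_slitPlane_iff]
  by_contra hcon
  push Not at hcon
  obtain ⟨hre, him⟩ := hcon
  obtain ⟨z, hz⟩ : ∃ z, z = cdet (twist s₁ s₂ c a) (twist s₁ s₂ c b) / cdet a b := ⟨_, rfl⟩
  rw [← hz] at hre him
  have hzD : cdet (twist s₁ s₂ c a) (twist s₁ s₂ c b) = z * cdet a b := by
    rw [hz, div_mul_cancel₀ _ hD]
  obtain ⟨r, hr0, hr⟩ : ∃ r : ℝ, 0 ≤ r ∧ z = ((-r : ℝ) : ℂ) :=
    ⟨-z.re, by linarith, by apply Complex.ext <;> simp [him]⟩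
  rw [hr] at hzD
  have e1 := congrArg Complex.re hzD
  have e2 := congrArg Complex.im hzD
  rw [Complex.re_ofReal_mul] at e1
  rw [Complex.im_ofReal_mul] at e2
  simp only [cdet, twist_zero_apply, twist_one_apply, twist_two_apply, twist_three_apply] at e1 e2
  have hpl := plucker h
  simp only [symp] at h
  have n1 := h₁.ne'
  have n2 := h₂.ne'
  obtain ⟨f1, f2⟩ := twist_half_turn h₁ h₂ (c := c) hr0 hpl
    (by
      field_simp at e1 ⊢
      linear_combination e1 + s₁ ^ 2 * s₂ ^ 2 * c * h)
    (by
      field_simp at e2 ⊢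
      linear_combination e2)
  apply hD
  apply Complex.ext
  · simp only [cdet, Complex.zero_re]
    linarith
  · simp only [cdet, Complex.zero_im]
    linarith

/-- The rotation of a Lagrangian pair `(a, b)` moving with velocities `(J α, J β)`. -/
theorem im_cdet_deriv {a b : LiftedPhase} (h : symp a b = 0) (α β : LiftedPhase) :
    ((cdet (stdJ α) b + cdet a (stdJ β)) * (starRingEnd ℂ) (cdet a b)).im =
      ⟪α, a⟫ * ‖b‖ ^ 2 - (⟪α, b⟫ + ⟪β, a⟫) * ⟪a, b⟫ + ⟪β, b⟫ * ‖a‖ ^ 2 := by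
  simp only [symp] at h
  simp only [cdet, Complex.mul_im, Complex.add_re, Complex.add_im, Complex.conj_re,
    Complex.conj_im, norm_sq_lifted, inner_lifted, stdJ_zero_apply, stdJ_one_apply,
    stdJ_two_apply, stdJ_three_apply]
  generalize a 0 = a0 at *
  generalize a 1 = a1 at *
  generalize a 2 = a2 at *
  generalize a 3 = a3 at *
  generalize b 0 = b0 at *
  generalize b 1 = b1 at *
  generalize b 2 = b2 at *
  generalize b 3 = b3 at *
  linear_combination ((α 2 * b0 + α 3 * b1 - α 0 * b2 - α 1 * b3)
    - (β 2 * a0 + β 3 * a1 - β 0 * a2 - β 1 * a3)) * h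

theorem diag_trace {a b : LiftedPhase} (h : symp a b = 0) (m₁ m₂ : ℝ) :
    (m₁ * (a 0 ^ 2 + a 2 ^ 2) + m₂ * (a 1 ^ 2 + a 3 ^ 2)) * ‖b‖ ^ 2
      - 2 * (m₁ * (a 0 * b 0 + a 2 * b 2) + m₂ * (a 1 * b 1 + a 3 * b 3)) * ⟪a, b⟫
      + (m₁ * (b 0 ^ 2 + b 2 ^ 2) + m₂ * (b 1 ^ 2 + b 3 ^ 2)) * ‖a‖ ^ 2
      = (m₁ + m₂) * Complex.normSq (cdet a b) := by
  simp only [symp] at h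
  rw [Complex.normSq_apply, norm_sq_lifted, norm_sq_lifted, inner_lifted]
  simp only [cdet]
  generalize a 0 = a0 at *
  generalize a 1 = a1 at *
  generalize a 2 = a2 at *
  generalize a 3 = a3 at *
  generalize b 0 = b0 at *
  generalize b 1 = b1 at *
  generalize b 2 = b2 at *
  generalize b 3 = b3 at *
  linear_combination 2 * (m₁ * (a0 * b2 - a2 * b0) + m₂ * (a1 * b3 - a3 * b1)) * h

/-- If the quadratic form of `S` dominates the diagonal form with weights `m₁, m₂` in twisted
coordinates, then a Lagrangian pair rotates at rate at least `m₁ + m₂` under the flow of `J S`. -/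
theorem rotation_rate {s₁ s₂ : ℝ} (h₁ : s₁ ≠ 0) (h₂ : s₂ ≠ 0) (c : ℝ) {m₁ m₂ : ℝ}
    (S : LiftedPhase →ₗ[ℝ] LiftedPhase)
    (hS : ∀ z, m₁ * (twist s₁ s₂ c z 0 ^ 2 + twist s₁ s₂ c z 2 ^ 2)
      + m₂ * (twist s₁ s₂ c z 1 ^ 2 + twist s₁ s₂ c z 3 ^ 2) ≤ ⟪S z, z⟫)
    {X v : LiftedPhase} (h : symp X v = 0) :
    (m₁ + m₂) * Complex.normSq (cdet (twist s₁ s₂ c X) (twist s₁ s₂ c v)) ≤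
    ((cdet (twist s₁ s₂ c (stdJ (S X))) (twist s₁ s₂ c v)
      + cdet (twist s₁ s₂ c X) (twist s₁ s₂ c (stdJ (S v))))
      * (starRingEnd ℂ) (cdet (twist s₁ s₂ c X) (twist s₁ s₂ c v))).im := by
  have hab : symp (twist s₁ s₂ c X) (twist s₁ s₂ c v) = 0 := by rw [symp_twist c h₁ h₂, h]
  rw [twist_stdJ, twist_stdJ, im_cdet_deriv hab, inner_twistDual_twist c h₁ h₂,
    inner_twistDual_twist c h₁ h₂, inner_twistDual_twist c h₁ h₂, inner_twistDual_twist c h₁ h₂,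
    ← diag_trace hab]
  set a := twist s₁ s₂ c X with ha
  set b := twist s₁ s₂ c v with hb
  have hG : 0 ≤ ‖a‖ ^ 2 * ‖b‖ ^ 2 - ⟪a, b⟫ ^ 2 := by
    rw [← normSq_cdet hab]; exact Complex.normSq_nonneg _
  rcases eq_or_ne b 0 with hb0 | hb0
  · have hv0 : v = 0 := by
      have e0 : b 0 = 0 := by rw [hb0]; rfl
      have e1 : b 1 = 0 := by rw [hb0]; rfl
      have e2 : b 2 = 0 := by rw [hb0]; rfl
      have e3 : b 3 = 0 := by rw [hb0]; rfl
      simp only [hb, twist_zero_apply, twist_one_apply, twist_two_apply, twist_three_apply,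
        mul_eq_zero, div_eq_zero_iff, h₁, h₂, false_or, or_false] at e0 e1 e2 e3
      rw [e3] at e0
      rw [e2] at e1
      exact lifted_ext (by simpa using e0) (by simpa using e1) e2 e3
    rw [hb0, hv0]
    simp
  · have hbpos : 0 < ‖b‖ ^ 2 := by positivity
    have k1 := hS (‖b‖ ^ 2 • X - ⟪a, b⟫ • v)
    have k2 := hS v
    rw [twist_sub_smul, ← ha, ← hb] at k1
    rw [← hb] at k2
    have k2' := mul_le_mul_of_nonneg_right k2 hG
    simp only [map_sub, map_smul, inner_sub_left, inner_sub_right, inner_smul_left,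
      inner_smul_right, PiLp.sub_apply, PiLp.smul_apply, smul_eq_mul, conj_trivial] at k1
    refine le_of_mul_le_mul_left ?_ hbpos
    linarith

end CR3BP

namespace CR3BP

/-! ## Continuous arguments of plane curves -/

/-- `θ` is a continuous argument of the curve `D`. -/
structure IsArgument (D : ℝ → ℂ) (θ : ℝ → ℝ) : Prop where
  continuous : Continuous θ
  polar : ∀ t, D t = ‖D t‖ * Complex.exp (θ t * Complex.I)

theorem IsArgument.hasDerivAt {D : ℝ → ℂ} {θ : ℝ → ℝ} (h : IsArgument D θ) {D' : ℂ} {t : ℝ}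
    (hD : HasDerivAt D D' t) (h0 : D t ≠ 0) : HasDerivAt θ (D' / D t).im t := by
  set u : ℂ := Complex.exp (-(θ t * Complex.I)) with hu
  have hu0 : u ≠ 0 := Complex.exp_ne_zero _
  have hw : HasDerivAt (fun s => D s * u) (D' * u) t := hD.mul_const u
  have hwt : D t * u = (‖D t‖ : ℂ) := by
    conv_lhs => rw [h.polar t]
    rw [hu, mul_assoc, ← Complex.exp_add, add_neg_cancel, Complex.exp_zero, mul_one]
  have hsl : D t * u ∈ Complex.slitPlane := by
    rw [hwt]
    exact Complex.ofReal_mem_slitPlane.2 (norm_pos_iff.2 h0)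
  have hlog := hw.clog_real hsl
  have him : HasDerivAt (fun s => (Complex.log (D s * u)).im) (D' * u / (D t * u)).im t := by
    simpa [Function.comp_def] using Complex.imCLM.hasFDerivAt.comp_hasDerivAt t hlog
  rw [mul_div_mul_right _ _ hu0] at him
  have hev : θ =ᶠ[𝓝 t] fun s => θ t + (Complex.log (D s * u)).im := by
    have h1 : ∀ᶠ s in 𝓝 t, |θ s - θ t| < Real.pi := by
      have := (h.continuous.tendsto t).sub_const (θ t)
      rw [sub_self] at this
      have h2 := this.eventually (Metric.ball_mem_nhds 0 Real.pi_pos)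
      filter_upwards [h2] with s hs
      simpa using hs
    have h2 : ∀ᶠ s in 𝓝 t, D s ≠ 0 := hD.continuousAt.eventually_ne h0
    filter_upwards [h1, h2] with s hs hs0
    have : D s * u = (‖D s‖ : ℝ) * Complex.exp ((θ s - θ t : ℝ) * Complex.I) := by
      conv_lhs => rw [h.polar s]
      rw [hu, mul_assoc, ← Complex.exp_add]
      congr 2
      push_cast
      ring
    rw [Complex.log_im, this, Complex.arg_real_mul _ (norm_pos_iff.2 hs0), Complex.arg_exp_mul_I,
      toIocMod_eq_self _ |>.2]
    · ring
    · rw [abs_lt] at hs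
      exact ⟨by linarith, by linarith⟩
  exact (him.const_add (θ t)).congr_of_eventuallyEq hev

theorem div_im_eq (a b : ℂ) : (a / b).im = (a * (starRingEnd ℂ) b).im / Complex.normSq b := by
  rw [Complex.div_im, Complex.mul_im, Complex.conj_re, Complex.conj_im]
  ring

/-- Integrating a lower bound of the angular velocity. -/
theorem IsArgument.increment_ge {D D' : ℝ → ℂ} {θ : ℝ → ℝ} (h : IsArgument D θ) {κ t₁ t₂ : ℝ}
    (ht : t₁ ≤ t₂) (hD : ∀ t, HasDerivAt D (D' t) t) (h0 : ∀ t, D t ≠ 0)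
    (hκ : ∀ t ∈ Set.Icc t₁ t₂,
      κ * Complex.normSq (D t) ≤ (D' t * (starRingEnd ℂ) (D t)).im) :
    κ * (t₂ - t₁) ≤ θ t₂ - θ t₁ := by
  have hder : ∀ t, HasDerivAt θ (D' t / D t).im t := fun t => h.hasDerivAt (hD t) (h0 t)
  refine (convex_Icc t₁ t₂).mul_sub_le_image_sub_of_le_deriv h.continuous.continuousOn
    (fun t _ => (hder t).differentiableAt.differentiableWithinAt) ?_ t₁ ⟨le_rfl, ht⟩ t₂
    ⟨ht, le_rfl⟩ ht
  intro t ht'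
  rw [(hder t).deriv, div_im_eq, le_div_iff₀ (Complex.normSq_pos.2 (h0 t))]
  exact hκ t (interior_subset ht')

theorem IsArgument.increment_le {D D' : ℝ → ℂ} {θ : ℝ → ℝ} (h : IsArgument D θ) {κ t₁ t₂ : ℝ}
    (ht : t₁ ≤ t₂) (hD : ∀ t, HasDerivAt D (D' t) t) (h0 : ∀ t, D t ≠ 0)
    (hκ : ∀ t ∈ Set.Icc t₁ t₂,
      (D' t * (starRingEnd ℂ) (D t)).im ≤ κ * Complex.normSq (D t)) :
    θ t₂ - θ t₁ ≤ κ * (t₂ - t₁) := by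
  have hder : ∀ t, HasDerivAt θ (D' t / D t).im t := fun t => h.hasDerivAt (hD t) (h0 t)
  refine (convex_Icc t₁ t₂).image_sub_le_mul_sub_of_deriv_le h.continuous.continuousOn
    (fun t _ => (hder t).differentiableAt.differentiableWithinAt) ?_ t₁ ⟨le_rfl, ht⟩ t₂
    ⟨ht, le_rfl⟩ ht
  intro t ht'
  rw [(hder t).deriv, div_im_eq, div_le_iff₀ (Complex.normSq_pos.2 (h0 t))]
  exact hκ t (interior_subset ht')

/-- A continuously differentiable curve in the punctured plane has an argument, given by the
integral of its angular velocity. -/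
theorem isArgument_integral {D D' : ℝ → ℂ} (hD : ∀ t, HasDerivAt D (D' t) t)
    (hc : Continuous D') (h0 : ∀ t, D t ≠ 0) {φ : ℝ}
    (hφ : D 0 = ‖D 0‖ * Complex.exp (φ * Complex.I)) :
    IsArgument D fun t => φ + ∫ s in (0 : ℝ)..t, (D' s / D s).im := by
  have hDc : Continuous D := continuous_iff_continuousAt.2 fun t => (hD t).continuousAt
  have hq : Continuous fun s => D' s / D s := hc.div hDc h0
  have hI : ∀ t, HasDerivAt (fun t => ∫ s in (0 : ℝ)..t, D' s / D s) (D' t / D t) t := fun t =>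
    intervalIntegral.integral_hasDerivAt_right (hq.intervalIntegrable _ _)
      (hq.stronglyMeasurableAtFilter _ _) hq.continuousAt
  have him : ∀ t, (∫ s in (0 : ℝ)..t, (D' s / D s).im)
      = (∫ s in (0 : ℝ)..t, D' s / D s).im := fun t => by
    have := Complex.imCLM.intervalIntegral_comp_comm (hq.intervalIntegrable 0 t)
      (μ := MeasureTheory.volume)
    simpa using this
  have hconst : ∀ t, D t * Complex.exp (-∫ s in (0 : ℝ)..t, D' s / D s) = D 0 := by
    have hder : ∀ t, HasDerivAt
        (fun t => D t * Complex.exp (-∫ s in (0 : ℝ)..t, D' s / D s)) 0 t := fun t => by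
      refine ((hD t).mul ((hI t).fun_neg.cexp)).congr_deriv ?_
      have := mul_div_cancel₀ (D' t) (h0 t)
      linear_combination -(Complex.exp (-∫ s in (0 : ℝ)..t, D' s / D s)) * this
    intro t
    have := is_const_of_deriv_eq_zero (fun t => (hder t).differentiableAt)
      (fun t => (hder t).deriv) t 0
    simpa using this
  refine ⟨?_, fun t => ?_⟩
  · have : Continuous fun t => ∫ s in (0 : ℝ)..t, D' s / D s :=
      continuous_iff_continuousAt.2 fun t => (hI t).continuousAt
    simp_rw [him]
    exact continuous_const.add (Complex.continuous_im.comp this)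
  · set Z := ∫ s in (0 : ℝ)..t, D' s / D s with hZ
    have hDt : D t = D 0 * Complex.exp Z := by
      rw [← hconst t, ← hZ, mul_assoc, ← Complex.exp_add, neg_add_cancel, Complex.exp_zero,
        mul_one]
    have hn : ‖D t‖ = ‖D 0‖ * Real.exp Z.re := by
      rw [hDt, norm_mul, Complex.norm_exp]
    show D t = ‖D t‖ * Complex.exp (((φ + ∫ s in (0 : ℝ)..t, (D' s / D s).im : ℝ) : ℂ) * Complex.I)
    rw [hn, him, ← hZ]
    conv_lhs => rw [hDt, hφ]
    push_cast
    rw [mul_assoc, mul_assoc, ← Complex.exp_add, ← Complex.exp_add]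
    congr 2
    conv_lhs => rw [← Complex.re_add_im Z]
    ring

theorem exists_polar_angle (z : ℂ) : ∃ φ : ℝ, z = ‖z‖ * Complex.exp (φ * Complex.I) :=
  ⟨Complex.arg z, (Complex.norm_mul_exp_arg_mul_I z).symm⟩

theorem exists_isArgument {D D' : ℝ → ℂ} (hD : ∀ t, HasDerivAt D (D' t) t)
    (hc : Continuous D') (h0 : ∀ t, D t ≠ 0) : ∃ θ, IsArgument D θ := by
  obtain ⟨φ, hφ⟩ := exists_polar_angle (D 0)
  exact ⟨_, isArgument_integral hD hc h0 hφ⟩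

theorem IsArgument.increment_eq {D D' : ℝ → ℂ} {θ θ' : ℝ → ℝ} (h : IsArgument D θ)
    (h' : IsArgument D θ') (hD : ∀ t, HasDerivAt D (D' t) t) (h0 : ∀ t, D t ≠ 0) (s t : ℝ) :
    θ t - θ s = θ' t - θ' s := by
  have hder : ∀ t, HasDerivAt (fun t => θ t - θ' t) 0 t := fun t => by
    simpa [Pi.sub_def] using (h.hasDerivAt (hD t) (h0 t)).sub (h'.hasDerivAt (hD t) (h0 t))
  have := is_const_of_deriv_eq_zero (fun t => (hder t).differentiableAt)
    (fun t => (hder t).deriv) t s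
  linarith

/-- Multiplying a curve by a curve in the slit plane. -/
theorem IsArgument.mul_slit {D W : ℝ → ℂ} {θ : ℝ → ℝ} (h : IsArgument D θ) (hW : Continuous W)
    (hs : ∀ t, W t ∈ Complex.slitPlane) :
    IsArgument (fun t => W t * D t) fun t => θ t + Complex.arg (W t) := by
  refine ⟨h.continuous.add ?_, fun t => ?_⟩
  · exact continuous_iff_continuousAt.2 fun t =>
      (Complex.continuousAt_arg (hs t)).comp hW.continuousAt
  · conv_lhs => rw [h.polar t, ← Complex.norm_mul_exp_arg_mul_I (W t)]
    push_cast
    rw [norm_mul, add_mul, Complex.exp_add]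
    push_cast
    ring

theorem IsArgument.const_mul {D : ℝ → ℂ} {θ : ℝ → ℝ} (h : IsArgument D θ) (φ : ℝ) :
    IsArgument (fun t => Complex.exp (φ * Complex.I) * D t) fun t => θ t + φ := by
  refine ⟨h.continuous.add continuous_const, fun t => ?_⟩
  conv_lhs => rw [h.polar t]
  rw [norm_mul, Complex.norm_exp_ofReal_mul_I, one_mul]
  push_cast
  rw [add_mul, Complex.exp_add]
  ring

theorem IsArgument.pos_mul {D : ℝ → ℂ} {θ : ℝ → ℝ} (h : IsArgument D θ) {r : ℝ} (hr : 0 < r) :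
    IsArgument (fun t => (r : ℂ) * D t) θ := by
  refine ⟨h.continuous, fun t => ?_⟩
  conv_lhs => rw [h.polar t]
  rw [norm_mul, Complex.norm_real, Real.norm_of_nonneg hr.le]
  push_cast
  ring

end CR3BP

namespace CR3BP

/-! ## The linearized flow along a trajectory -/

/-- `stdJ` as a continuous linear map. -/
def stdJL : LiftedPhase →L[ℝ] LiftedPhase :=
  LinearMap.toContinuousLinearMap
    { toFun := stdJ
      map_add' := fun a b => by apply lifted_ext <;> simp <;> ring
      map_smul' := fun r a => by apply lifted_ext <;> simp }

@[simp] theorem stdJL_apply (v : LiftedPhase) : stdJL v = stdJ v := rfl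

theorem norm_stdJ (v : LiftedPhase) : ‖stdJ v‖ = ‖v‖ := by
  rw [← sq_eq_sq₀ (norm_nonneg _) (norm_nonneg _), norm_sq_lifted, norm_sq_lifted]
  simp only [stdJ_zero_apply, stdJ_one_apply, stdJ_two_apply, stdJ_three_apply]
  ring

/-- `twist` as a continuous linear map. -/
def twistL (s₁ s₂ c : ℝ) : LiftedPhase →L[ℝ] LiftedPhase :=
  LinearMap.toContinuousLinearMap
    { toFun := twist s₁ s₂ c
      map_add' := fun a b => by apply lifted_ext <;> simp <;> ring
      map_smul' := fun r a => by apply lifted_ext <;> simp <;> ring }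

/-- The Hessian of `H` as an endomorphism. -/
def hess (H : LiftedPhase → ℝ) (z : LiftedPhase) : LiftedPhase →L[ℝ] LiftedPhase :=
  fderiv ℝ (gradient H) z

section

variable {H : LiftedPhase → ℝ}

theorem contDiff_gradient (hH : ContDiff ℝ 2 H) : ContDiff ℝ 1 (gradient H) := by
  have h1 : ContDiff ℝ 1 (fderiv ℝ H) := hH.fderiv_right (by norm_num)
  exact (InnerProductSpace.toDual ℝ LiftedPhase).symm.contDiff.comp h1

theorem hasFDerivAt_gradient (hH : ContDiff ℝ 2 H) (z : LiftedPhase) :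
    HasFDerivAt (gradient H) (hess H z) z :=
  ((contDiff_gradient hH).differentiable (by norm_num) z).hasFDerivAt

theorem continuous_hess (hH : ContDiff ℝ 2 H) : Continuous (hess H) :=
  (contDiff_gradient hH).continuous_fderiv (by norm_num)

theorem fderiv_eq_inner_gradient (z v : LiftedPhase) : fderiv ℝ H z v = ⟪gradient H z, v⟫ := by
  rw [gradient, InnerProductSpace.toDual_symm_apply]

theorem hess_symm (hH : ContDiff ℝ 2 H) (z v w : LiftedPhase) :
    ⟪hess H z v, w⟫ = ⟪hess H z w, v⟫ := by
  have key : ∀ v w, fderiv ℝ (fderiv ℝ H) z v w = ⟪hess H z v, w⟫ := by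
    intro v w
    have h1 : HasFDerivAt (fderiv ℝ H) (fderiv ℝ (fderiv ℝ H) z) z :=
      ((hH.fderiv_right (m := 1) (by norm_num)).differentiable (by norm_num) z).hasFDerivAt
    have h2 : HasFDerivAt (fun x => fderiv ℝ H x w) _ z := h1.clm_apply (hasFDerivAt_const w z)
    have h3 : HasFDerivAt (fun x => ⟪gradient H x, w⟫) _ z :=
      (hasFDerivAt_gradient hH z).inner ℝ (hasFDerivAt_const w z)
    have h4 : (fun x => fderiv ℝ H x w) = fun x => ⟪gradient H x, w⟫ := by
      ext x; exact fderiv_eq_inner_gradient x w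
    rw [h4] at h2
    have := congrArg (fun L => L v) (h2.unique h3)
    simpa using this
  have hs : IsSymmSndFDerivAt ℝ H z := by
    apply hH.contDiffAt.isSymmSndFDerivAt
    simp
  rw [← key, ← key]
  exact hs v w

theorem hasFDerivAt_hamVectorField (hH : ContDiff ℝ 2 H) (z : LiftedPhase) :
    HasFDerivAt (hamVectorField H) (stdJL ∘L hess H z) z :=
  stdJL.hasFDerivAt.comp z (hasFDerivAt_gradient hH z)

theorem fderiv_hamVectorField (hH : ContDiff ℝ 2 H) (z v : LiftedPhase) :
    fderiv ℝ (hamVectorField H) z v = stdJ (hess H z v) := by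
  rw [(hasFDerivAt_hamVectorField hH z).fderiv]
  rfl

variable {γ : ℝ → LiftedPhase}

theorem isLinearizedSolution_iff (hH : ContDiff ℝ 2 H) {v : ℝ → LiftedPhase} :
    IsLinearizedSolution H γ v ↔ ∀ t, HasDerivAt v (stdJ (hess H (γ t) (v t))) t := by
  simp only [IsLinearizedSolution, fderiv_hamVectorField hH]

theorem isLinearizedSolution_velocity (hH : ContDiff ℝ 2 H)
    (hγ : ∀ t, HasDerivAt γ (hamVectorField H (γ t)) t) :
    IsLinearizedSolution H γ fun t => hamVectorField H (γ t) := fun t => by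
  have := (hasFDerivAt_hamVectorField hH (γ t)).comp_hasDerivAt t (hγ t)
  rw [(hasFDerivAt_hamVectorField hH (γ t)).fderiv]
  exact this

theorem IsLinearizedSolution.add {v w : ℝ → LiftedPhase} (hv : IsLinearizedSolution H γ v)
    (hw : IsLinearizedSolution H γ w) : IsLinearizedSolution H γ fun t => v t + w t := fun t => by
  rw [map_add]
  exact (hv t).add (hw t)

theorem IsLinearizedSolution.smul {v : ℝ → LiftedPhase} (hv : IsLinearizedSolution H γ v)
    (r : ℝ) : IsLinearizedSolution H γ fun t => r • v t := fun t => by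
  rw [map_smul]
  exact (hv t).const_smul r

theorem continuous_trajectory (hγ : ∀ t, HasDerivAt γ (hamVectorField H (γ t)) t) :
    Continuous γ := continuous_iff_continuousAt.2 fun t => (hγ t).continuousAt

theorem IsLinearizedSolution.continuous {v : ℝ → LiftedPhase} (hv : IsLinearizedSolution H γ v) :
    Continuous v := continuous_iff_continuousAt.2 fun t => (hv t).continuousAt

theorem IsLinearizedSolution.eq_of_eq (hH : ContDiff ℝ 2 H) (hγ : Continuous γ)
    {v w : ℝ → LiftedPhase} (hv : IsLinearizedSolution H γ v) (hw : IsLinearizedSolution H γ w)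
    {t₀ : ℝ} (h : v t₀ = w t₀) : v = w := by
  have hA : Continuous fun t => fderiv ℝ (hamVectorField H) (γ t) := by
    have : (fun t => fderiv ℝ (hamVectorField H) (γ t)) = fun t => stdJL ∘L hess H (γ t) := by
      ext1 t; exact (hasFDerivAt_hamVectorField hH (γ t)).fderiv
    rw [this]
    exact continuous_const.clm_comp ((continuous_hess hH).comp hγ)
  ext1 t
  obtain ⟨a, b, ht, ht₀⟩ : ∃ a b, t ∈ Set.Ioo a b ∧ t₀ ∈ Set.Ioo a b :=
    ⟨min t t₀ - 1, max t t₀ + 1, by grind, by grind⟩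
  obtain ⟨K, hK⟩ := (isCompact_Icc (a := a) (b := b)).exists_bound_of_continuousOn hA.continuousOn
  refine ODE_solution_unique_of_mem_Ioo
    (v := fun t x => fderiv ℝ (hamVectorField H) (γ t) x) (s := fun _ => Set.univ)
    (K := K.toNNReal) (fun r hr => ?_) ht₀ (fun t _ => ⟨hv t, trivial⟩)
    (fun t _ => ⟨hw t, trivial⟩) h ht
  refine ((fderiv ℝ (hamVectorField H) (γ r)).lipschitz.weaken ?_).lipschitzOnWith
  rw [← NNReal.coe_le_coe]
  exact (hK r (Set.Ioo_subset_Icc_self hr)).trans (Real.le_coe_toNNReal K)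

theorem exists_linearizedSolution (hH : ContDiff ℝ 2 H) (hγ : Continuous γ) {K : ℝ}
    (hK : ∀ t, ‖hess H (γ t)‖ ≤ K) (v₀ : LiftedPhase) :
    ∃ v, v 0 = v₀ ∧ IsLinearizedSolution H γ v := by
  have hlip : ∀ t, LipschitzWith K.toNNReal fun x => stdJ (hess H (γ t) x) := fun t => by
    refine LipschitzWith.of_dist_le_mul fun x y => ?_
    have : stdJ (hess H (γ t) x) - stdJ (hess H (γ t) y) = stdJ (hess H (γ t) (x - y)) := by
      rw [← stdJL_apply, ← stdJL_apply, ← stdJL_apply, ← map_sub, ← map_sub]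
    rw [dist_eq_norm, dist_eq_norm, this, norm_stdJ]
    exact ((hess H (γ t)).le_opNorm _).trans (by
      gcongr; exact (hK t).trans (Real.le_coe_toNNReal K))
  have hc : ∀ x, Continuous fun t => stdJ (hess H (γ t) x) := fun x => by
    have h1 : Continuous fun t => hess H (γ t) x :=
      ((continuous_hess hH).comp hγ).clm_apply continuous_const
    exact stdJL.continuous.comp h1
  obtain ⟨v, h0, hv⟩ := exists_global_solution hlip hc v₀
  exact ⟨v, h0, (isLinearizedSolution_iff hH).2 hv⟩

theorem continuous_gradient_comp (hH : ContDiff ℝ 2 H) (hγ : Continuous γ) :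
    Continuous fun t => gradient H (γ t) := (contDiff_gradient hH).continuous.comp hγ

/-- Tangency to the energy surface is preserved by the linearized flow. -/
theorem IsLinearizedSolution.inner_gradient (hH : ContDiff ℝ 2 H)
    (hγ : ∀ t, HasDerivAt γ (hamVectorField H (γ t)) t) {v : ℝ → LiftedPhase}
    (hv : IsLinearizedSolution H γ v) (h0 : ⟪gradient H (γ 0), v 0⟫ = 0) (t : ℝ) :
    ⟪gradient H (γ t), v t⟫ = 0 := by
  have hder : ∀ t, HasDerivAt (fun t => ⟪gradient H (γ t), v t⟫) 0 t := fun t => by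
    have h1 := (hasFDerivAt_gradient hH (γ t)).comp_hasDerivAt t (hγ t)
    have h2 := h1.inner ℝ ((isLinearizedSolution_iff hH).1 hv t)
    refine h2.congr_deriv ?_
    have h3 := hess_symm hH (γ t) (hamVectorField H (γ t)) (v t)
    simp only [Function.comp_apply]
    rw [h3, hamVectorField]
    simp only [inner_lifted, stdJ_zero_apply, stdJ_one_apply, stdJ_two_apply, stdJ_three_apply]
    ring
  have := is_const_of_deriv_eq_zero (fun t => (hder t).differentiableAt)
    (fun t => (hder t).deriv) t 0
  simpa [h0] using this

theorem symp_hamVectorField (z v : LiftedPhase) :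
    symp (hamVectorField H z) v = -⟪gradient H z, v⟫ := symp_stdJ_left _ _

theorem exists_smul_eq_of_cdet_eq_zero {a b : LiftedPhase} (ha : a ≠ 0) (hs : symp a b = 0)
    (h : cdet a b = 0) : ∃ r : ℝ, b = r • a := by
  refine ⟨⟪a, b⟫ / ‖a‖ ^ 2, ?_⟩
  have h1 := normSq_cdet hs
  rw [h, map_zero, real_inner_comm] at h1
  have hn : ‖a‖ ^ 2 ≠ 0 := by positivity
  rw [← sub_eq_zero, ← norm_eq_zero, ← sq_eq_zero_iff, norm_sub_sq_real, inner_smul_right,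
    norm_smul, mul_pow, Real.norm_eq_abs, sq_abs, real_inner_comm]
  field_simp
  linarith

/-- The transverse coordinate of a linearized solution never vanishes if it does not vanish at time
zero. -/
theorem IsLinearizedSolution.transverseCoord_ne_zero (hH : ContDiff ℝ 2 H)
    (hγ : ∀ t, HasDerivAt γ (hamVectorField H (γ t)) t)
    (hreg : ∀ t, gradient H (γ t) ≠ 0) {v : ℝ → LiftedPhase}
    (hv : IsLinearizedSolution H γ v) (h0 : ⟪gradient H (γ 0), v 0⟫ = 0)
    {t₀ : ℝ} (h1 : transverseCoord H (γ t₀) (v t₀) ≠ 0) (t : ℝ) :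
    transverseCoord H (γ t) (v t) ≠ 0 := by
  intro hcon
  have hX0 : hamVectorField H (γ t) ≠ 0 := by
    intro h
    apply hreg t
    rw [← norm_eq_zero, ← norm_stdJ, ← hamVectorField, h, norm_zero]
  obtain ⟨r, hr⟩ := exists_smul_eq_of_cdet_eq_zero (a := hamVectorField H (γ t)) (b := v t) hX0
    (by rw [symp_hamVectorField, hv.inner_gradient hH hγ h0, neg_zero])
    (by rw [hamVectorField, cdet_stdJ_left, ← transverseCoord_eq_cdet, hcon, mul_zero])
  have heq := hv.eq_of_eq hH (continuous_trajectory hγ)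
    ((isLinearizedSolution_velocity hH hγ).smul r) hr
  apply h1
  rw [heq, transverseCoord_eq_cdet]
  apply Complex.ext <;>
  simp [cdet, hamVectorField] <;> ring

theorem hasDerivAt_cdet {a b : ℝ → LiftedPhase} {a' b' : LiftedPhase} {t : ℝ}
    (ha : HasDerivAt a a' t) (hb : HasDerivAt b b' t) :
    HasDerivAt (fun t => cdet (a t) (b t)) (cdet a' (b t) + cdet (a t) b') t := by
  have hc : ∀ {f : ℝ → LiftedPhase} {f' : LiftedPhase}, HasDerivAt f f' t → ∀ i,
      HasDerivAt (fun t => ((f t i : ℝ) : ℂ)) ((f' i : ℝ) : ℂ) t := fun hf i =>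
    (((EuclideanSpace.proj i : LiftedPhase →L[ℝ] ℝ).hasFDerivAt.comp_hasDerivAt t hf)).ofReal_comp
  have key : ∀ a b : LiftedPhase, cdet a b = ((a 0 : ℂ) + a 2 * Complex.I) *
      ((b 1 : ℂ) + b 3 * Complex.I) - ((a 1 : ℂ) + a 3 * Complex.I) *
      ((b 0 : ℂ) + b 2 * Complex.I) := fun a b => by
    apply Complex.ext <;> simp [cdet] <;> ring
  simp only [key]
  refine ((((hc ha 0).add ((hc ha 2).mul_const Complex.I)).mul
    ((hc hb 1).add ((hc hb 3).mul_const Complex.I))).sub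
    (((hc ha 1).add ((hc ha 3).mul_const Complex.I)).mul
    ((hc hb 0).add ((hc hb 2).mul_const Complex.I)))).congr_deriv ?_
  simp only [Pi.add_apply]
  ring

/-- If the Hessian dominates a diagonal form in twisted coordinates along a piece of trajectory, then
the argument of every transverse solution grows accordingly, up to one turn. -/
theorem IsArgument.increment_ge_of_twist (hH : ContDiff ℝ 2 H)
    (hγ : ∀ t, HasDerivAt γ (hamVectorField H (γ t)) t)
    (hreg : ∀ t, gradient H (γ t) ≠ 0) {v : ℝ → LiftedPhase} {θ : ℝ → ℝ}
    (hv : IsLinearizedSolution H γ v) (h0 : ⟪gradient H (γ 0), v 0⟫ = 0)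
    (h1 : transverseCoord H (γ 0) (v 0) ≠ 0)
    (hθ : IsArgument (fun t => transverseCoord H (γ t) (v t)) θ)
    {s₁ s₂ : ℝ} (h₁ : 0 < s₁) (h₂ : 0 < s₂) (c : ℝ) {m₁ m₂ t₁ t₂ : ℝ} (ht : t₁ ≤ t₂)
    (hm : ∀ t ∈ Set.Icc t₁ t₂, ∀ z, m₁ * (twist s₁ s₂ c z 0 ^ 2 + twist s₁ s₂ c z 2 ^ 2)
      + m₂ * (twist s₁ s₂ c z 1 ^ 2 + twist s₁ s₂ c z 3 ^ 2) ≤ ⟪hess H (γ t) z, z⟫) :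
    (m₁ + m₂) * (t₂ - t₁) - 2 * Real.pi ≤ θ t₂ - θ t₁ := by
  have hX := isLinearizedSolution_velocity hH hγ
  have hsymp : ∀ t, symp (hamVectorField H (γ t)) (v t) = 0 := fun t => by
    rw [symp_hamVectorField, hv.inner_gradient hH hγ h0, neg_zero]
  have hD : ∀ t, cdet (hamVectorField H (γ t)) (v t)
      = Complex.exp ((Real.pi / 2 : ℝ) * Complex.I) * transverseCoord H (γ t) (v t) := fun t => by
    rw [hamVectorField, cdet_stdJ_left, transverseCoord_eq_cdet]
    push_cast
    rw [Complex.exp_pi_div_two_mul_I]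
  have hD0 : ∀ t, cdet (hamVectorField H (γ t)) (v t) ≠ 0 := fun t => by
    rw [hD]
    exact mul_ne_zero (Complex.exp_ne_zero _) (hv.transverseCoord_ne_zero hH hγ hreg h0 h1 t)
  have hslit : ∀ t, cdet (twist s₁ s₂ c (hamVectorField H (γ t))) (twist s₁ s₂ c (v t)) /
      cdet (hamVectorField H (γ t)) (v t) ∈ Complex.slitPlane := fun t =>
    cdet_twist_div_mem_slitPlane h₁ h₂ c (hsymp t) (hD0 t)
  have hMX : ∀ t, HasDerivAt (fun t => twist s₁ s₂ c (hamVectorField H (γ t)))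
      (twist s₁ s₂ c (stdJ (hess H (γ t) (hamVectorField H (γ t))))) t := fun t =>
    (twistL s₁ s₂ c).hasFDerivAt.comp_hasDerivAt t ((isLinearizedSolution_iff hH).1 hX t)
  have hMv : ∀ t, HasDerivAt (fun t => twist s₁ s₂ c (v t))
      (twist s₁ s₂ c (stdJ (hess H (γ t) (v t)))) t := fun t =>
    (twistL s₁ s₂ c).hasFDerivAt.comp_hasDerivAt t ((isLinearizedSolution_iff hH).1 hv t)
  have hDM := fun t => hasDerivAt_cdet (hMX t) (hMv t)
  have hDX := fun t => hasDerivAt_cdet ((isLinearizedSolution_iff hH).1 hX t)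
    ((isLinearizedSolution_iff hH).1 hv t)
  have hcont : Continuous fun t => cdet (twist s₁ s₂ c (hamVectorField H (γ t)))
      (twist s₁ s₂ c (v t)) / cdet (hamVectorField H (γ t)) (v t) :=
    continuous_iff_continuousAt.2 fun t =>
      (hDM t).continuousAt.div (hDX t).continuousAt (hD0 t)
  have harg := (hθ.const_mul (Real.pi / 2)).mul_slit hcont hslit
  simp only [← hD, div_mul_cancel₀ _ (hD0 _)] at harg
  have hinc := harg.increment_ge ht hDM (fun t h => by
    have := hslit t
    rw [h, zero_div] at this
    simp at this) (κ := m₁ + m₂) (fun t ht =>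
      rotation_rate h₁.ne' h₂.ne' c (hess H (γ t)).toLinearMap (hm t ht) (hsymp t))
  have b1 := Complex.arg_le_pi (cdet (twist s₁ s₂ c (hamVectorField H (γ t₂)))
      (twist s₁ s₂ c (v t₂)) / cdet (hamVectorField H (γ t₂)) (v t₂))
  have b2 := Complex.neg_pi_lt_arg (cdet (twist s₁ s₂ c (hamVectorField H (γ t₁)))
      (twist s₁ s₂ c (v t₁)) / cdet (hamVectorField H (γ t₁)) (v t₁))
  linarith

/-- If the Hessian is positive on the vertical directions, the argument of a transverse solution
never decreases by more than one turn. -/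
theorem IsArgument.increment_ge_of_vertical (hH : ContDiff ℝ 2 H)
    (hγ : ∀ t, HasDerivAt γ (hamVectorField H (γ t)) t)
    (hreg : ∀ t, gradient H (γ t) ≠ 0) {v : ℝ → LiftedPhase} {θ : ℝ → ℝ}
    (hv : IsLinearizedSolution H γ v) (h0 : ⟪gradient H (γ 0), v 0⟫ = 0)
    (h1 : transverseCoord H (γ 0) (v 0) ≠ 0)
    (hθ : IsArgument (fun t => transverseCoord H (γ t) (v t)) θ)
    {C t₁ t₂ : ℝ} (ht : t₁ ≤ t₂)
    (hm : ∀ t ∈ Set.Icc t₁ t₂, ∀ z : LiftedPhase,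
      -C * (z 2 ^ 2 + z 3 ^ 2) ≤ ⟪hess H (γ t) z, z⟫) :
    -(2 * Real.pi) ≤ θ t₂ - θ t₁ := by
  by_contra hcon
  push Not at hcon
  set q := -(2 * Real.pi) - (θ t₂ - θ t₁) with hq
  have hq0 : 0 < q := by linarith
  obtain ⟨ε, hε0, hε⟩ : ∃ ε > 0, 2 * ε * (t₂ - t₁) < q := by
    refine ⟨q / (4 * (t₂ - t₁ + 1)), by have := sub_nonneg.2 ht; positivity, ?_⟩
    have := sub_nonneg.2 ht
    rw [mul_div_assoc', div_mul_eq_mul_div, div_lt_iff₀ (by positivity)]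
    nlinarith
  set C' := max C 0 + 1 with hC'
  have hC0 : 0 < C' := by positivity
  have hCC : C ≤ C' := (le_max_left C 0).trans (by linarith)
  set s := Real.sqrt (ε / C') with hs
  have hs0 : 0 < s := Real.sqrt_pos.2 (by positivity)
  have hs2 : s ^ 2 = ε / C' := Real.sq_sqrt (by positivity)
  have := hθ.increment_ge_of_twist hH hγ hreg hv h0 h1 hs0 hs0 0 (m₁ := -ε) (m₂ := -ε) ht
    (fun t ht z => by
      refine le_trans ?_ (hm t ht z)
      simp only [twist_zero_apply, twist_one_apply, twist_two_apply, twist_three_apply, div_pow,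
        hs2]
      have e1 : z 2 ^ 2 / (ε / C') = C' * z 2 ^ 2 / ε := by field_simp
      have e2 : z 3 ^ 2 / (ε / C') = C' * z 3 ^ 2 / ε := by field_simp
      rw [e1, e2]
      have e3 : ε * (C' * z 2 ^ 2 / ε) = C' * z 2 ^ 2 := by field_simp
      have e4 : ε * (C' * z 3 ^ 2 / ε) = C' * z 3 ^ 2 := by field_simp
      have e5 := mul_nonneg hε0.le (sq_nonneg (s * (z 0 + 0 * z 3)))
      have e6 := mul_nonneg hε0.le (sq_nonneg (s * (z 1 + 0 * z 2)))
      have e7 := mul_nonneg (sub_nonneg.2 hCC) (add_nonneg (sq_nonneg (z 2)) (sq_nonneg (z 3)))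
      linarith)
  linarith

end

end CR3BP

namespace CR3BP

/-! ## Existence of the Conley–Zehnder index -/

/-- An order-connected nonempty set bounded below determines an index, which is bounded below. -/
theorem exists_index_of_ordConnected {I : Set ℝ} (hne : I.Nonempty) (hI : I.OrdConnected) {D : ℝ}
    (hD : ∀ d ∈ I, D ≤ d) :
    ∃ m : ℤ, ((∃ k : ℤ, m = 2 * k ∧ ∀ᶠ ε in 𝓝[>] (0 : ℝ), (k : ℝ) + ε ∈ I) ∨
      (∃ k : ℤ, m = 2 * k + 1 ∧ ∀ᶠ ε in 𝓝[>] (0 : ℝ), ∀ d ∈ I,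
        d - ε ∈ Set.Ioo (k : ℝ) (k + 1))) ∧ 2 * D - 1 ≤ m := by
  have hbdd : BddBelow I := ⟨D, hD⟩
  set a := sInf I with ha
  have hDa : D ≤ a := le_csInf hne hD
  have hak := Int.le_ceil a
  by_cases hk : ∃ b ∈ I, (⌈a⌉ : ℝ) < b
  · obtain ⟨b, hb, hkb⟩ := hk
    refine ⟨2 * ⌈a⌉, Or.inl ⟨⌈a⌉, rfl, ?_⟩, ?_⟩
    · filter_upwards [Ioo_mem_nhdsGT (sub_pos.2 hkb)] with ε hε
      obtain ⟨x, hx, hxa⟩ := exists_lt_of_csInf_lt hne (show sInf I < ⌈a⌉ + ε by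
        linarith [hε.1])
      exact hI.out hx hb ⟨hxa.le, by linarith [hε.2]⟩
    · push_cast; linarith
  · push Not at hk
    refine ⟨2 * (⌈a⌉ - 1) + 1, Or.inr ⟨⌈a⌉ - 1, rfl, ?_⟩, ?_⟩
    · have hlt : (⌈a⌉ : ℝ) - 1 < a := by have := Int.ceil_lt_add_one a; linarith
      filter_upwards [Ioo_mem_nhdsGT (sub_pos.2 hlt)] with ε hε d hd
      have h1 := csInf_le hbdd hd
      have h2 := hk d hd
      have h3 := hε.1
      have h4 := hε.2
      refine ⟨?_, ?_⟩
      · push_cast; linarith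
      · push_cast; linarith
    · push_cast; linarith

variable {H : LiftedPhase → ℝ} {γ : ℝ → LiftedPhase}

theorem hasDerivAt_transverseCoord (hH : ContDiff ℝ 2 H)
    (hγ : ∀ t, HasDerivAt γ (hamVectorField H (γ t)) t) {v : ℝ → LiftedPhase}
    (hv : IsLinearizedSolution H γ v) (t : ℝ) :
    HasDerivAt (fun t => transverseCoord H (γ t) (v t))
      (cdet (hess H (γ t) (hamVectorField H (γ t))) (v t)
        + cdet (gradient H (γ t)) (stdJ (hess H (γ t) (v t)))) t := by
  simp only [transverseCoord_eq_cdet]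
  exact hasDerivAt_cdet ((hasFDerivAt_gradient hH (γ t)).comp_hasDerivAt t (hγ t))
    ((isLinearizedSolution_iff hH).1 hv t)

theorem continuous_cdet {X : Type*} [TopologicalSpace X] {a b : X → LiftedPhase}
    (ha : Continuous a) (hb : Continuous b) : Continuous fun t => cdet (a t) (b t) := by
  have hc : ∀ {f : X → LiftedPhase}, Continuous f → ∀ i, Continuous fun t => f t i :=
    fun hf i => (EuclideanSpace.proj i : LiftedPhase →L[ℝ] ℝ).continuous.comp hf
  have h1 := hc ha
  have h2 := hc hb
  have key : ∀ a b : LiftedPhase, cdet a b = ((a 0 : ℂ) + a 2 * Complex.I) *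
      ((b 1 : ℂ) + b 3 * Complex.I) - ((a 1 : ℂ) + a 3 * Complex.I) *
      ((b 0 : ℂ) + b 2 * Complex.I) := fun a b => by
    apply Complex.ext <;> simp [cdet] <;> ring
  simp only [key]
  have := h1 0
  have := h1 1
  have := h1 2
  have := h1 3
  have := h2 0
  have := h2 1
  have := h2 2
  have := h2 3
  fun_prop

theorem continuous_deriv_transverseCoord (hH : ContDiff ℝ 2 H)
    (hγ : ∀ t, HasDerivAt γ (hamVectorField H (γ t)) t) {v : ℝ → LiftedPhase}
    (hv : IsLinearizedSolution H γ v) :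
    Continuous fun t => cdet (hess H (γ t) (hamVectorField H (γ t))) (v t)
        + cdet (gradient H (γ t)) (stdJ (hess H (γ t) (v t))) := by
  have hγc := continuous_trajectory hγ
  have hh : Continuous fun t => hess H (γ t) := (continuous_hess hH).comp hγc
  have hg := continuous_gradient_comp hH hγc
  refine (continuous_cdet (hh.clm_apply (stdJL.continuous.comp hg)) hv.continuous).add
    (continuous_cdet hg (stdJL.continuous.comp (hh.clm_apply hv.continuous)))

/-- The Conley–Zehnder index of a trajectory exists, and is bounded below by the rotation of the
transverse solutions. -/
theorem exists_isConleyZehnderIndex (hH : ContDiff ℝ 2 H)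
    (hγ : ∀ t, HasDerivAt γ (hamVectorField H (γ t)) t)
    (hreg : ∀ t, gradient H (γ t) ≠ 0) {K : ℝ} (hK : ∀ t, ‖hess H (γ t)‖ ≤ K) {T D : ℝ}
    (hD : ∀ d ∈ rotationSet H γ T, D ≤ d) :
    ∃ m : ℤ, IsConleyZehnderIndex H γ T m ∧ 2 * D - 1 ≤ m := by
  have hγc := continuous_trajectory hγ
  set g := gradient H (γ 0) with hg
  have hg0 : ‖g‖ ^ 2 ≠ 0 := by have := hreg 0; positivity
  have hgn : ‖g‖ ^ 2 = g 0 ^ 2 + g 1 ^ 2 + g 2 ^ 2 + g 3 ^ 2 := norm_sq_lifted g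
  obtain ⟨w₁, hw₁0, hw₁⟩ := exists_linearizedSolution hH hγc hK ((‖g‖ ^ 2)⁻¹ • stdK g)
  obtain ⟨w₂, hw₂0, hw₂⟩ := exists_linearizedSolution hH hγc hK ((‖g‖ ^ 2)⁻¹ • stdJ (stdK g))
  have c₁0 : transverseCoord H (γ 0) (w₁ 0) = 1 := by
    rw [hw₁0, transverseCoord_eq_cdet, cdet_smul_right, ← hg]
    have : cdet g (stdK g) = ((‖g‖ ^ 2 : ℝ) : ℂ) := by
      rw [hgn]
      apply Complex.ext
      · simp only [cdet, Complex.ofReal_re, stdK_zero_apply, stdK_one_apply, stdK_two_apply,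
          stdK_three_apply]
        ring
      · simp only [cdet, Complex.ofReal_im, stdK_zero_apply, stdK_one_apply, stdK_two_apply,
          stdK_three_apply]
        ring
    rw [this, ← Complex.ofReal_mul, inv_mul_cancel₀ hg0, Complex.ofReal_one]
  have c₂0 : transverseCoord H (γ 0) (w₂ 0) = Complex.I := by
    rw [hw₂0, transverseCoord_eq_cdet, cdet_smul_right, ← hg]
    have : cdet g (stdJ (stdK g)) = ((‖g‖ ^ 2 : ℝ) : ℂ) * Complex.I := by
      rw [hgn]
      apply Complex.ext
      · simp only [cdet, Complex.re_ofReal_mul, Complex.I_re, stdK_zero_apply, stdK_one_apply,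
          stdK_two_apply, stdK_three_apply, stdJ_zero_apply, stdJ_one_apply, stdJ_two_apply,
          stdJ_three_apply]
        ring
      · simp only [cdet, Complex.im_ofReal_mul, Complex.I_im, stdK_zero_apply, stdK_one_apply,
          stdK_two_apply, stdK_three_apply, stdJ_zero_apply, stdJ_one_apply, stdJ_two_apply,
          stdJ_three_apply]
        ring
    rw [this, ← mul_assoc, ← Complex.ofReal_mul, inv_mul_cancel₀ hg0, Complex.ofReal_one, one_mul]
  have t₁0 : ⟪g, w₁ 0⟫ = 0 := by
    rw [hw₁0, inner_smul_right, inner_lifted]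
    simp only [stdK_zero_apply, stdK_one_apply, stdK_two_apply, stdK_three_apply]
    ring
  have t₂0 : ⟪g, w₂ 0⟫ = 0 := by
    rw [hw₂0, inner_smul_right, inner_lifted]
    simp only [stdK_zero_apply, stdK_one_apply, stdK_two_apply, stdK_three_apply, stdJ_zero_apply,
      stdJ_one_apply, stdJ_two_apply, stdJ_three_apply]
    ring
  set W : ℝ → ℝ → LiftedPhase := fun φ t => Real.cos φ • w₁ t + Real.sin φ • w₂ t with hW
  have hWsol : ∀ φ, IsLinearizedSolution H γ (W φ) := fun φ => (hw₁.smul _).add (hw₂.smul _)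
  have hWtan : ∀ φ, ⟪g, W φ 0⟫ = 0 := fun φ => by
    rw [hW, inner_add_right, inner_smul_right, inner_smul_right, t₁0, t₂0]
    ring
  have hWc : ∀ φ t, transverseCoord H (γ t) (W φ t) =
      Real.cos φ * transverseCoord H (γ t) (w₁ t) + Real.sin φ * transverseCoord H (γ t) (w₂ t) := by
    intro φ t
    rw [hW]
    simp only [transverseCoord_eq_cdet, cdet_add_right, cdet_smul_right]
  have hW0 : ∀ φ, transverseCoord H (γ 0) (W φ 0) = Complex.exp (φ * Complex.I) := fun φ => by
    rw [hWc, c₁0, c₂0, Complex.exp_mul_I]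
    push_cast
    ring
  have hWne0 : ∀ φ, transverseCoord H (γ 0) (W φ 0) ≠ 0 := fun φ => by
    rw [hW0]; exact Complex.exp_ne_zero _
  have hWne : ∀ φ t, transverseCoord H (γ t) (W φ t) ≠ 0 := fun φ t =>
    (hWsol φ).transverseCoord_ne_zero hH hγ hreg (hWtan φ) (hWne0 φ) t
  set c' : (ℝ → LiftedPhase) → ℝ → ℂ := fun v t =>
    cdet (hess H (γ t) (hamVectorField H (γ t))) (v t)
        + cdet (gradient H (γ t)) (stdJ (hess H (γ t) (v t))) with hc'
  have hWd : ∀ φ t, HasDerivAt (fun t => transverseCoord H (γ t) (W φ t)) (c' (W φ) t) t :=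
    fun φ t => hasDerivAt_transverseCoord hH hγ (hWsol φ) t
  have hWd' : ∀ φ, Continuous (c' (W φ)) := fun φ =>
    continuous_deriv_transverseCoord hH hγ (hWsol φ)
  set Θ : ℝ → ℝ → ℝ := fun φ t => φ + ∫ s in (0 : ℝ)..t,
    (c' (W φ) s / transverseCoord H (γ s) (W φ s)).im with hΘ
  have hΘarg : ∀ φ, IsArgument (fun t => transverseCoord H (γ t) (W φ t)) (Θ φ) := fun φ =>
    isArgument_integral (hWd φ) (hWd' φ) (hWne φ) (by
      rw [hW0, Complex.norm_exp_ofReal_mul_I, Complex.ofReal_one, one_mul])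
  set δ : ℝ → ℝ := fun φ => (∫ s in (0 : ℝ)..T,
    (c' (W φ) s / transverseCoord H (γ s) (W φ s)).im) / (2 * Real.pi) with hδ
  have hδΘ : ∀ φ, δ φ = (Θ φ T - Θ φ 0) / (2 * Real.pi) := fun φ => by
    simp [hδ, hΘ]
  have hset : rotationSet H γ T = Set.range δ := by
    ext d
    constructor
    · rintro ⟨v, θ, hv, hv0, hvc, hθc, hθ, rfl⟩
      obtain ⟨φ, hφ⟩ := exists_polar_angle (transverseCoord H (γ 0) (v 0))
      set r := ‖transverseCoord H (γ 0) (v 0)‖ with hr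
      have hr0 : 0 < r := norm_pos_iff.2 hvc
      refine ⟨φ, ?_⟩
      have harg : IsArgument (fun t => transverseCoord H (γ t) (v t)) θ := ⟨hθc, hθ⟩
      have hprop : ∀ t, transverseCoord H (γ t) (v t) = (r : ℂ) * transverseCoord H (γ t) (W φ t) := by
        set u : ℝ → LiftedPhase := fun t => v t + (-r) • W φ t with hu
        have husol : IsLinearizedSolution H γ u := hv.add ((hWsol φ).smul _)
        have huc : ∀ t, transverseCoord H (γ t) (u t) =
            transverseCoord H (γ t) (v t) - r * transverseCoord H (γ t) (W φ t) := fun t => by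
          rw [hu]
          simp only [transverseCoord_eq_cdet, cdet_add_right, cdet_smul_right]
          push_cast
          ring
        have hu0 : ⟪gradient H (γ 0), u 0⟫ = 0 := by
          have hv0' : ⟪g, v 0⟫ = 0 := hv0
          show ⟪g, v 0 + (-r) • W φ 0⟫ = 0
          rw [inner_add_right, inner_smul_right, hWtan, hv0', mul_zero, add_zero]
        intro t
        rw [← sub_eq_zero, ← huc]
        by_contra hne
        have := husol.transverseCoord_ne_zero hH hγ hreg hu0 hne 0
        apply this
        rw [huc, hW0, ← hφ, sub_self]
      have harg2 : IsArgument (fun t => transverseCoord H (γ t) (v t)) (Θ φ) := by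
        simp_rw [hprop]
        exact (hΘarg φ).pos_mul hr0
      rw [hδΘ, harg2.increment_eq harg (fun t => hasDerivAt_transverseCoord hH hγ hv t)
        (fun t => hv.transverseCoord_ne_zero hH hγ hreg hv0 hvc t) 0 T]
    · rintro ⟨φ, rfl⟩
      exact ⟨W φ, Θ φ, hWsol φ, hWtan φ, hWne0 φ, (hΘarg φ).continuous, (hΘarg φ).polar, hδΘ φ⟩
  have hδc : Continuous δ := by
    refine Continuous.div_const ?_ _
    have hγ2 : Continuous fun p : ℝ × ℝ => γ p.2 := hγc.comp continuous_snd
    have hWj : Continuous fun p : ℝ × ℝ => W p.1 p.2 := by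
      refine ((Real.continuous_cos.comp continuous_fst).smul
        (hw₁.continuous.comp continuous_snd)).add ((Real.continuous_sin.comp continuous_fst).smul
        (hw₂.continuous.comp continuous_snd))
    have hh : Continuous fun p : ℝ × ℝ => hess H (γ p.2) := (continuous_hess hH).comp hγ2
    have hgc : Continuous fun p : ℝ × ℝ => gradient H (γ p.2) :=
      (contDiff_gradient hH).continuous.comp hγ2
    have hnum : Continuous fun p : ℝ × ℝ => c' (W p.1) p.2 :=
      (continuous_cdet (hh.clm_apply (stdJL.continuous.comp hgc)) hWj).add
        (continuous_cdet hgc (stdJL.continuous.comp (hh.clm_apply hWj)))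
    have hden : Continuous fun p : ℝ × ℝ => transverseCoord H (γ p.2) (W p.1 p.2) := by
      simp only [transverseCoord_eq_cdet]
      exact continuous_cdet hgc hWj
    have hq : Continuous fun p : ℝ × ℝ =>
        (c' (W p.1) p.2 / transverseCoord H (γ p.2) (W p.1 p.2)).im :=
      Complex.continuous_im.comp (hnum.div hden fun p => hWne p.1 p.2)
    exact intervalIntegral.continuous_parametric_intervalIntegral_of_continuous' hq 0 T
  have hne : (rotationSet H γ T).Nonempty := by rw [hset]; exact Set.range_nonempty δ
  have hord : (rotationSet H γ T).OrdConnected := by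
    rw [hset]; exact (isPreconnected_range hδc).ordConnected
  obtain ⟨m, hm, hm'⟩ := exists_index_of_ordConnected hne hord hD
  exact ⟨m, ⟨hne, hm⟩, hm'⟩

end CR3BP

namespace CR3BP

/-! ## Perturbations of a linear saddle-center

In coordinates `(c₀, c₁, u, s)` the linear system rotates `(c₀, c₁)`, expands `u` and contracts `s`. -/

/-- The linear saddle-center. -/
def linSC (ω l : ℝ) (z : LiftedPhase) : LiftedPhase := !₂[-(ω * z 1), ω * z 0, l * z 2, -(l * z 3)]

/-- The time-reversing symmetry of the linear saddle-center. -/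
def refl (z : LiftedPhase) : LiftedPhase := !₂[-z 0, z 1, z 3, z 2]

/-- The gradient of the energy `(c₀² + c₁²) / 2 - u s`. -/
def quadSC (z : LiftedPhase) : LiftedPhase := !₂[z 0, z 1, -z 3, -z 2]

section apply

variable (ω l : ℝ) (z : LiftedPhase)

@[simp] theorem linSC_zero_apply : linSC ω l z 0 = -(ω * z 1) := rfl
@[simp] theorem linSC_one_apply : linSC ω l z 1 = ω * z 0 := rfl
@[simp] theorem linSC_two_apply : linSC ω l z 2 = l * z 2 := rfl
@[simp] theorem linSC_three_apply : linSC ω l z 3 = -(l * z 3) := rfl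
@[simp] theorem refl_zero_apply : refl z 0 = -z 0 := rfl
@[simp] theorem refl_one_apply : refl z 1 = z 1 := rfl
@[simp] theorem refl_two_apply : refl z 2 = z 3 := rfl
@[simp] theorem refl_three_apply : refl z 3 = z 2 := rfl
@[simp] theorem quadSC_zero_apply : quadSC z 0 = z 0 := rfl
@[simp] theorem quadSC_one_apply : quadSC z 1 = z 1 := rfl
@[simp] theorem quadSC_two_apply : quadSC z 2 = -z 3 := rfl
@[simp] theorem quadSC_three_apply : quadSC z 3 = -z 2 := rfl

end apply

/-- `refl` as a continuous linear map. -/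
def reflL : LiftedPhase →L[ℝ] LiftedPhase :=
  LinearMap.toContinuousLinearMap
    { toFun := refl
      map_add' := fun a b => by apply lifted_ext <;> simp <;> ring
      map_smul' := fun r a => by apply lifted_ext <;> simp }

@[simp] theorem reflL_apply (v : LiftedPhase) : reflL v = refl v := rfl

theorem norm_refl (v : LiftedPhase) : ‖refl v‖ = ‖v‖ := by
  rw [← sq_eq_sq₀ (norm_nonneg _) (norm_nonneg _), norm_sq_lifted, norm_sq_lifted]
  simp only [refl_zero_apply, refl_one_apply, refl_two_apply, refl_three_apply]
  ring

theorem refl_sub (v w : LiftedPhase) : refl (v - w) = refl v - refl w := by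
  apply lifted_ext <;> simp
  ring

theorem linSC_refl (ω l : ℝ) (z : LiftedPhase) : linSC ω l (refl z) = -refl (linSC ω l z) := by
  apply lifted_ext <;> simp

/-- `d` satisfies the linear saddle-center equation up to a relative error `ε`. -/
def IsNearlyLinear (ω l ε : ℝ) (d : ℝ → LiftedPhase) : Prop :=
  ∃ d' : ℝ → LiftedPhase, ∀ t, HasDerivAt d (d' t) t ∧ ‖d' t - linSC ω l (d t)‖ ≤ ε * ‖d t‖

/-- The unstable cone is `0 < coneU`. -/
def coneU (z : LiftedPhase) : ℝ := 9 * z 2 ^ 2 - (z 0 ^ 2 + z 1 ^ 2 + z 3 ^ 2)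

/-- The center cone. -/
def InCenterCone (z : LiftedPhase) : Prop := 4 * (z 2 ^ 2 + z 3 ^ 2) ≤ z 0 ^ 2 + z 1 ^ 2

theorem hasDerivAt_coord {d : ℝ → LiftedPhase} {d' : LiftedPhase} {t : ℝ}
    (h : HasDerivAt d d' t) (i : Fin 4) : HasDerivAt (fun t => d t i) (d' i) t :=
  (EuclideanSpace.proj i : LiftedPhase →L[ℝ] ℝ).hasFDerivAt.comp_hasDerivAt t h

theorem continuous_coord (i : Fin 4) : Continuous fun z : LiftedPhase => z i :=
  (EuclideanSpace.proj i : LiftedPhase →L[ℝ] ℝ).continuous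

theorem continuous_coneU : Continuous coneU := by
  have h0 := continuous_coord 0
  have h1 := continuous_coord 1
  have h2 := continuous_coord 2
  have h3 := continuous_coord 3
  unfold coneU
  fun_prop

variable {ω l ε : ℝ} {d : ℝ → LiftedPhase}

theorem IsNearlyLinear.continuous (h : IsNearlyLinear ω l ε d) : Continuous d := by
  obtain ⟨d', hd⟩ := h
  exact continuous_iff_continuousAt.2 fun t => (hd t).1.continuousAt

theorem IsNearlyLinear.reverse (h : IsNearlyLinear ω l ε d) :
    IsNearlyLinear ω l ε fun t => refl (d (-t)) := by
  obtain ⟨d', hd⟩ := h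
  refine ⟨fun t => -refl (d' (-t)), fun t => ⟨?_, ?_⟩⟩
  · have h1 : HasDerivAt (fun t => d (-t)) (-d' (-t)) t := by
      simpa [Function.comp_def] using (hd (-t)).1.scomp t (hasDerivAt_neg t)
    have h2 := reflL.hasFDerivAt.comp_hasDerivAt t h1
    rw [map_neg] at h2
    exact h2
  · rw [linSC_refl, sub_neg_eq_add, neg_add_eq_sub, ← refl_sub, norm_refl, norm_refl,
      norm_sub_rev]
    exact (hd (-t)).2

theorem IsNearlyLinear.coneU_mono (hl : 0 < l) (hε : 18 * ε ≤ l) (h : IsNearlyLinear ω l ε d) :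
    Monotone fun t => Real.exp (-(l * t)) * coneU (d t) := by
  obtain ⟨d', hd⟩ := h
  have hder : ∀ t, HasDerivAt (fun t => Real.exp (-(l * t)) * coneU (d t))
      (Real.exp (-(l * t)) * ((18 * d t 2 * d' t 2 - (2 * d t 0 * d' t 0 + 2 * d t 1 * d' t 1
        + 2 * d t 3 * d' t 3)) - l * coneU (d t))) t := by
    intro t
    have h0 := hasDerivAt_coord (hd t).1 0
    have h1 := hasDerivAt_coord (hd t).1 1
    have h2 := hasDerivAt_coord (hd t).1 2
    have h3 := hasDerivAt_coord (hd t).1 3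
    have hexp : HasDerivAt (fun t => Real.exp (-(l * t))) (Real.exp (-(l * t)) * -l) t := by
      have := ((hasDerivAt_id t).const_mul l).neg.exp
      simpa using this
    have hQ : HasDerivAt (fun t => coneU (d t)) (9 * (2 * d t 2 * d' t 2) - (2 * d t 0 * d' t 0
        + 2 * d t 1 * d' t 1 + 2 * d t 3 * d' t 3)) t := by
      have := ((h2.fun_pow 2).const_mul 9).fun_sub
        (((h0.fun_pow 2).fun_add (h1.fun_pow 2)).fun_add (h3.fun_pow 2))
      simpa [coneU] using this
    refine (hexp.mul hQ).congr_deriv ?_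
    ring
  refine monotone_of_deriv_nonneg (fun t => (hder t).differentiableAt) fun t => ?_
  rw [(hder t).deriv]
  refine mul_nonneg (Real.exp_pos _).le ?_
  set e : LiftedPhase := d' t - linSC ω l (d t) with he
  set w : LiftedPhase := !₂[-(2 * d t 0), -(2 * d t 1), 18 * d t 2, -(2 * d t 3)] with hw
  have hwn : ‖w‖ ≤ 18 * ‖d t‖ := by
    rw [← sq_le_sq₀ (norm_nonneg _) (by positivity), mul_pow, norm_sq_lifted, norm_sq_lifted]
    simp only [hw, PiLp.toLp_apply, Matrix.cons_val]
    nlinarith [sq_nonneg (d t 0), sq_nonneg (d t 1), sq_nonneg (d t 3)]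
  have hcs := (abs_le.1 (abs_real_inner_le_norm w e)).1
  have hwe : ‖w‖ * ‖e‖ ≤ l * ‖d t‖ ^ 2 := by
    have hn := norm_nonneg (d t)
    calc ‖w‖ * ‖e‖ ≤ (18 * ‖d t‖) * (ε * ‖d t‖) := by
          gcongr
          exact (hd t).2
      _ = (18 * ε) * ‖d t‖ ^ 2 := by ring
      _ ≤ l * ‖d t‖ ^ 2 := by gcongr
  rw [norm_sq_lifted] at hwe
  rw [inner_lifted] at hcs
  simp only [he, hw, PiLp.toLp_apply, Matrix.cons_val, PiLp.sub_apply, linSC_zero_apply,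
    linSC_one_apply, linSC_two_apply, linSC_three_apply] at hcs
  unfold coneU
  nlinarith [mul_nonneg hl.le (sq_nonneg (d t 2)), mul_nonneg hl.le (sq_nonneg (d t 3))]

theorem IsNearlyLinear.coneU_pos (hl : 0 < l) (hε : 18 * ε ≤ l) (h : IsNearlyLinear ω l ε d)
    {s t : ℝ} (hst : s ≤ t) (hs : 0 < coneU (d s)) : 0 < coneU (d t) := by
  have h1 := h.coneU_mono hl hε hst
  have h2 : 0 < Real.exp (-(l * s)) * coneU (d s) := mul_pos (Real.exp_pos _) hs
  exact pos_of_mul_pos_right (h2.trans_le h1) (Real.exp_pos _).le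

theorem IsNearlyLinear.coneU_nonpos (hl : 0 < l) (hε : 18 * ε ≤ l) (h : IsNearlyLinear ω l ε d)
    {B : ℝ} (hB : ∀ t, ‖d t‖ ≤ B) (t : ℝ) : coneU (d t) ≤ 0 := by
  by_contra hpos
  push Not at hpos
  have hup : ∀ r, coneU (d r) ≤ 9 * B ^ 2 := fun r => by
    have h1 : ‖d r‖ ^ 2 ≤ B ^ 2 := by gcongr; exact hB r
    rw [norm_sq_lifted] at h1
    unfold coneU
    nlinarith [sq_nonneg (d r 0), sq_nonneg (d r 1), sq_nonneg (d r 3)]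
  have hgrow : ∀ r, t ≤ r → Real.exp (l * (r - t)) * coneU (d t) ≤ coneU (d r) := fun r hr => by
    have h1 := h.coneU_mono hl hε hr
    have h2 : Real.exp (l * (r - t)) = Real.exp (l * r) * Real.exp (-(l * t)) := by
      rw [← Real.exp_add]; congr 1; ring
    rw [h2, mul_assoc]
    calc Real.exp (l * r) * (Real.exp (-(l * t)) * coneU (d t))
        ≤ Real.exp (l * r) * (Real.exp (-(l * r)) * coneU (d r)) := by gcongr
      _ = coneU (d r) := by
        rw [← mul_assoc, ← Real.exp_add, add_neg_cancel, Real.exp_zero, one_mul]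
  have htend : Tendsto (fun r => Real.exp (l * (r - t)) * coneU (d t)) atTop atTop := by
    refine Tendsto.atTop_mul_const hpos (Real.tendsto_exp_atTop.comp ?_)
    exact (tendsto_atTop_add_const_right atTop (-t) tendsto_id).const_mul_atTop hl
  obtain ⟨r, hr1, hr2⟩ := ((htend.eventually_gt_atTop (9 * B ^ 2)).and
    (eventually_ge_atTop t)).exists
  exact absurd (hup r) (not_le.2 (hr1.trans_le (hgrow r hr2)))

theorem inCenterCone_of_coneU {z : LiftedPhase} (h1 : coneU z ≤ 0) (h2 : coneU (refl z) ≤ 0) :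
    InCenterCone z := by
  simp only [coneU, refl_zero_apply, refl_one_apply, refl_two_apply, refl_three_apply] at h1 h2
  unfold InCenterCone
  nlinarith

/-- Bounded nearly linear curves stay in the center cone. -/
theorem IsNearlyLinear.inCenterCone (hl : 0 < l) (hε : 18 * ε ≤ l) (h : IsNearlyLinear ω l ε d)
    {B : ℝ} (hB : ∀ t, ‖d t‖ ≤ B) (t : ℝ) : InCenterCone (d t) := by
  refine inCenterCone_of_coneU (h.coneU_nonpos hl hε hB t) ?_
  have := h.reverse.coneU_nonpos hl hε (B := B) (fun t => by rw [norm_refl]; exact hB _) (-t)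
  simpa using this

theorem InCenterCone.norm_sq_le {z : LiftedPhase} (h : InCenterCone z) :
    ‖z‖ ^ 2 ≤ 5 / 4 * (z 0 ^ 2 + z 1 ^ 2) := by
  rw [norm_sq_lifted]
  unfold InCenterCone at h
  linarith

theorem InCenterCone.eq_zero {z : LiftedPhase} (h : InCenterCone z) (h0 : z 0 = 0) (h1 : z 1 = 0) :
    z = 0 := by
  have := h.norm_sq_le
  rw [h0, h1] at this
  rw [← norm_eq_zero, ← sq_eq_zero_iff]
  nlinarith [sq_nonneg ‖z‖]

/-- The projection to the center plane as a complex number. -/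
def centerCoord (z : LiftedPhase) : ℂ := ⟨z 0, z 1⟩

theorem centerCoord_eq_zero_iff {z : LiftedPhase} : centerCoord z = 0 ↔ z 0 = 0 ∧ z 1 = 0 :=
  Complex.ext_iff

theorem InCenterCone.centerCoord_ne_zero {z : LiftedPhase} (h : InCenterCone z) (hz : z ≠ 0) :
    centerCoord z ≠ 0 := fun h0 =>
  hz (h.eq_zero (centerCoord_eq_zero_iff.1 h0).1 (centerCoord_eq_zero_iff.1 h0).2)

theorem hasDerivAt_centerCoord {d' : LiftedPhase} {t : ℝ} (h : HasDerivAt d d' t) :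
    HasDerivAt (fun t => centerCoord (d t)) (centerCoord d') t := by
  have key : ∀ z : LiftedPhase, centerCoord z = (z 0 : ℂ) + z 1 * Complex.I := fun z => by
    apply Complex.ext <;> simp [centerCoord]
  simp only [key]
  exact (hasDerivAt_coord h 0).ofReal_comp.add
    ((hasDerivAt_coord h 1).ofReal_comp.mul_const Complex.I)

/-- The angular velocity in the center plane is close to `ω`. -/
theorem angular_velocity_bounds (hε0 : 0 ≤ ε) (hε : 5 * ε ≤ ω) {z z' : LiftedPhase}
    (hz : InCenterCone z) (h : ‖z' - linSC ω l z‖ ≤ ε * ‖z‖) :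
    3 / 4 * ω * Complex.normSq (centerCoord z) ≤
        (centerCoord z' * (starRingEnd ℂ) (centerCoord z)).im ∧
      (centerCoord z' * (starRingEnd ℂ) (centerCoord z)).im ≤
        5 / 4 * ω * Complex.normSq (centerCoord z) := by
  set e : LiftedPhase := z' - linSC ω l z with he
  set w : LiftedPhase := !₂[-z 1, z 0, 0, 0] with hw
  have hwn : ‖w‖ ^ 2 = z 0 ^ 2 + z 1 ^ 2 := by
    rw [norm_sq_lifted]
    simp only [hw, PiLp.toLp_apply, Matrix.cons_val]
    ring
  have hcs := abs_le.1 (abs_real_inner_le_norm w e)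
  have hzn := hz.norm_sq_le
  have hwe : ‖w‖ * ‖e‖ ≤ ω / 4 * (z 0 ^ 2 + z 1 ^ 2) := by
    have h1 : ‖w‖ * ‖e‖ ≤ ‖w‖ * (ε * ‖z‖) := by gcongr
    have h2 : ‖w‖ * ‖z‖ ≤ 5 / 4 * (z 0 ^ 2 + z 1 ^ 2) := by
      nlinarith [sq_nonneg (‖w‖ - ‖z‖), hwn, sq_nonneg ‖w‖]
    have h3 : ‖w‖ * (ε * ‖z‖) ≤ ε * (5 / 4 * (z 0 ^ 2 + z 1 ^ 2)) := by
      have := mul_le_mul_of_nonneg_left h2 hε0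
      linarith
    have h4 : 0 ≤ z 0 ^ 2 + z 1 ^ 2 := by positivity
    nlinarith
  rw [inner_lifted] at hcs
  simp only [he, hw, PiLp.toLp_apply, Matrix.cons_val, PiLp.sub_apply, linSC_zero_apply,
    linSC_one_apply, linSC_two_apply, linSC_three_apply] at hcs
  have hN : Complex.normSq (centerCoord z) = z 0 ^ 2 + z 1 ^ 2 := by
    rw [Complex.normSq_apply]; simp only [centerCoord]; ring
  have hI : (centerCoord z' * (starRingEnd ℂ) (centerCoord z)).im = z' 1 * z 0 - z' 0 * z 1 := by
    rw [Complex.mul_im, Complex.conj_re, Complex.conj_im]; simp only [centerCoord]; ring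
  rw [hN, hI]
  constructor
  · linarith [hcs.1]
  · linarith [hcs.2]

end CR3BP

namespace CR3BP

/-- A reversible vector field `f` on `ℝ⁴` near a saddle-center, with a rest point `zs`, preserving the
energy `h` with gradient `g` in the ball of radius `ρ`. -/
structure IsSaddleCenterSystem (ω l ε ρ : ℝ) (f : LiftedPhase → LiftedPhase)
    (h : LiftedPhase → ℝ) (g : LiftedPhase → LiftedPhase) (zs : LiftedPhase) : Prop where
  ω_pos : 0 < ω
  l_pos : 0 < l
  ε_nonneg : 0 ≤ ε
  ε_le_l : 18 * ε ≤ l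
  ε_le_ω : 5 * ε ≤ ω
  ε_le_one : 10 * ε ≤ 1
  ρ_pos : 0 < ρ
  nearlyLinear : ∀ z z', ‖f z - f z' - linSC ω l (z - z')‖ ≤ ε * ‖z - z'‖
  reversible : ∀ z, f (refl z) = -refl (f z)
  refl_rest : refl zs = zs
  rest : f zs = 0
  norm_rest : ‖zs‖ ≤ ρ / 2
  hasGradient : ∀ z, ‖z‖ ≤ ρ → HasGradientAt h (g z) z
  conserved : ∀ z, ‖z‖ ≤ ρ → ⟪g z, f z⟫ = 0
  nearlyQuadratic : ∀ z z', ‖z‖ ≤ ρ → ‖z'‖ ≤ ρ →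
    ‖g z - g z' - quadSC (z - z')‖ ≤ ε * ‖z - z'‖
  gradient_rest : g zs = 0

/-- `γ` is a trajectory of `f`. -/
def IsTrajectory (f : LiftedPhase → LiftedPhase) (γ : ℝ → LiftedPhase) : Prop :=
  ∀ t, HasDerivAt γ (f (γ t)) t

theorem IsTrajectory.shift {f : LiftedPhase → LiftedPhase} {γ : ℝ → LiftedPhase}
    (h : IsTrajectory f γ) (s : ℝ) : IsTrajectory f fun t => γ (t + s) := fun t =>
  (h (t + s)).comp_add_const t s

theorem IsTrajectory.continuous {f : LiftedPhase → LiftedPhase} {γ : ℝ → LiftedPhase}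
    (h : IsTrajectory f γ) : Continuous γ :=
  continuous_iff_continuousAt.2 fun t => (h t).continuousAt

namespace IsSaddleCenterSystem

variable {ω l ε ρ : ℝ} {f : LiftedPhase → LiftedPhase} {h : LiftedPhase → ℝ}
  {g : LiftedPhase → LiftedPhase} {zs : LiftedPhase}

theorem norm_linSC_le (hω : 0 ≤ ω) (hl : 0 ≤ l) (z : LiftedPhase) :
    ‖linSC ω l z‖ ≤ (ω + l) * ‖z‖ := by
  rw [← sq_le_sq₀ (norm_nonneg _) (by positivity), mul_pow, norm_sq_lifted, norm_sq_lifted]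
  simp only [linSC_zero_apply, linSC_one_apply, linSC_two_apply, linSC_three_apply]
  have h1 : 0 ≤ ω * l := mul_nonneg hω hl
  nlinarith [mul_nonneg (sq_nonneg l) (add_nonneg (sq_nonneg (z 0)) (sq_nonneg (z 1))),
    mul_nonneg (sq_nonneg ω) (add_nonneg (sq_nonneg (z 2)) (sq_nonneg (z 3))),
    mul_nonneg h1 (add_nonneg (add_nonneg (sq_nonneg (z 0)) (sq_nonneg (z 1)))
      (add_nonneg (sq_nonneg (z 2)) (sq_nonneg (z 3))))]

theorem lipschitz (S : IsSaddleCenterSystem ω l ε ρ f h g zs) :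
    LipschitzWith (ω + l + ε).toNNReal f := by
  have := S.ω_pos
  have := S.l_pos
  have := S.ε_nonneg
  refine LipschitzWith.of_dist_le_mul fun z z' => ?_
  rw [dist_eq_norm, dist_eq_norm, Real.coe_toNNReal _ (by positivity)]
  have h1 := norm_linSC_le (ω := ω) (l := l) (by positivity) (by positivity) (z - z')
  have h2 := S.nearlyLinear z z'
  have h3 : ‖f z - f z'‖ ≤ ‖f z - f z' - linSC ω l (z - z')‖ + ‖linSC ω l (z - z')‖ := by
    simpa using norm_add_le (f z - f z' - linSC ω l (z - z')) (linSC ω l (z - z'))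
  linarith

theorem unique (S : IsSaddleCenterSystem ω l ε ρ f h g zs) {γ₁ γ₂ : ℝ → LiftedPhase}
    (h₁ : IsTrajectory f γ₁) (h₂ : IsTrajectory f γ₂) {t₀ : ℝ} (heq : γ₁ t₀ = γ₂ t₀) : γ₁ = γ₂ :=
  global_solution_unique (f := fun _ => f) (fun _ => S.lipschitz) h₁ h₂ heq

theorem sub_isNearlyLinear (S : IsSaddleCenterSystem ω l ε ρ f h g zs) {γ₁ γ₂ : ℝ → LiftedPhase}
    (h₁ : IsTrajectory f γ₁) (h₂ : IsTrajectory f γ₂) :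
    IsNearlyLinear ω l ε fun t => γ₁ t - γ₂ t :=
  ⟨fun t => f (γ₁ t) - f (γ₂ t), fun t => ⟨(h₁ t).sub (h₂ t), S.nearlyLinear _ _⟩⟩

theorem isTrajectory_rest (S : IsSaddleCenterSystem ω l ε ρ f h g zs) :
    IsTrajectory f fun _ => zs := fun t => by
  rw [S.rest]; exact hasDerivAt_const t zs

theorem norm_rest_le (S : IsSaddleCenterSystem ω l ε ρ f h g zs) : ‖zs‖ ≤ ρ :=
  S.norm_rest.trans (by linarith [S.ρ_pos])

theorem inCenterCone_sub (S : IsSaddleCenterSystem ω l ε ρ f h g zs) {γ₁ γ₂ : ℝ → LiftedPhase}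
    (h₁ : IsTrajectory f γ₁) (h₂ : IsTrajectory f γ₂) (b₁ : ∀ t, ‖γ₁ t‖ ≤ ρ)
    (b₂ : ∀ t, ‖γ₂ t‖ ≤ ρ) (t : ℝ) : InCenterCone (γ₁ t - γ₂ t) :=
  (S.sub_isNearlyLinear h₁ h₂).inCenterCone S.l_pos S.ε_le_l (B := ρ + ρ)
    (fun t => (norm_sub_le _ _).trans (add_le_add (b₁ t) (b₂ t))) t

theorem inCenterCone_sub_rest (S : IsSaddleCenterSystem ω l ε ρ f h g zs) {γ : ℝ → LiftedPhase}
    (hγ : IsTrajectory f γ) (b : ∀ t, ‖γ t‖ ≤ ρ) (t : ℝ) : InCenterCone (γ t - zs) :=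
  S.inCenterCone_sub hγ S.isTrajectory_rest b (fun _ => S.norm_rest_le) t

theorem hasDerivAt_energy (S : IsSaddleCenterSystem ω l ε ρ f h g zs) {γ : ℝ → LiftedPhase}
    {γ' : LiftedPhase} {t : ℝ} (hγ : HasDerivAt γ γ' t) (hb : ‖γ t‖ ≤ ρ) :
    HasDerivAt (fun t => h (γ t)) ⟪g (γ t), γ'⟫ t := by
  have := (S.hasGradient _ hb).hasFDerivAt.comp_hasDerivAt t hγ
  simpa [Function.comp_def] using this

theorem energy_const (S : IsSaddleCenterSystem ω l ε ρ f h g zs) {γ : ℝ → LiftedPhase}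
    (hγ : IsTrajectory f γ) {a b : ℝ} (hab : a ≤ b) (hb : ∀ t ∈ Set.Icc a b, ‖γ t‖ ≤ ρ) :
    h (γ b) = h (γ a) := by
  have hd : ∀ t ∈ Set.Icc a b, HasDerivAt (fun t => h (γ t)) 0 t := fun t ht => by
    have := S.hasDerivAt_energy (hγ t) (hb t ht)
    rwa [S.conserved _ (hb t ht)] at this
  refine constant_of_has_deriv_right_zero (f := fun t => h (γ t))
    (HasDerivAt.continuousOn hd) (fun t ht => ?_) b ⟨hab, le_rfl⟩
  exact (hd t (Set.Ico_subset_Icc_self ht)).hasDerivWithinAt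

theorem energy_eq (S : IsSaddleCenterSystem ω l ε ρ f h g zs) {γ : ℝ → LiftedPhase}
    (hγ : IsTrajectory f γ) (hb : ∀ t, ‖γ t‖ ≤ ρ) (s t : ℝ) : h (γ s) = h (γ t) := by
  rcases le_total s t with hst | hst
  · exact (S.energy_const hγ hst fun t _ => hb t).symm
  · exact S.energy_const hγ hst fun t _ => hb t

/-- The gradient of the energy near the rest point. -/
theorem inner_gradient_ge (S : IsSaddleCenterSystem ω l ε ρ f h g zs) {d w : LiftedPhase}
    (hd : ‖zs + d‖ ≤ ρ) : ⟪quadSC d, w⟫ - ε * (‖d‖ * ‖w‖) ≤ ⟪g (zs + d), w⟫ ∧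
      ⟪g (zs + d), w⟫ ≤ ⟪quadSC d, w⟫ + ε * (‖d‖ * ‖w‖) := by
  have h1 := S.nearlyQuadratic (zs + d) zs hd S.norm_rest_le
  rw [S.gradient_rest, add_sub_cancel_left, sub_zero] at h1
  have h2 := abs_le.1 (abs_real_inner_le_norm (g (zs + d) - quadSC d) w)
  rw [inner_sub_left] at h2
  have h3 : ‖g (zs + d) - quadSC d‖ * ‖w‖ ≤ ε * (‖d‖ * ‖w‖) := by
    rw [← mul_assoc]; gcongr
  constructor <;> linarith [h2.1, h2.2]

theorem cross_le_of_sq_le {x y x' y' p q R : ℝ} (hp : 0 ≤ p) (hq : 0 ≤ q) (hR : 0 ≤ R)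
    (h : 4 * (x ^ 2 + y ^ 2) ≤ p ^ 2 * R) (h' : 4 * (x' ^ 2 + y' ^ 2) ≤ q ^ 2 * R) :
    4 * (x * x' + y * y') ≤ p * q * R := by
  refine (abs_le_of_sq_le_sq' ?_ (by positivity)).2
  have e2 := mul_le_mul h h' (by positivity) (by positivity)
  have e1 := sq_nonneg (x * y' - y * x')
  linarith

theorem norm_mul_le_of_sq_le {x y p q R : ℝ} (hp : 0 ≤ p) (hq : 0 ≤ q) (hR : 0 ≤ R)
    (h : x ^ 2 ≤ 5 / 4 * (p ^ 2 * R)) (h' : y ^ 2 ≤ 5 / 4 * (q ^ 2 * R)) :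
    x * y ≤ 5 / 4 * (p * q * R) := by
  refine (abs_le_of_sq_le_sq' ?_ (by positivity)).2
  have := mul_le_mul h h' (by positivity) (by positivity)
  linarith

theorem cone_convex {x y x' y' q R τ : ℝ} (hq : 0 ≤ q) (hR : 0 ≤ R) (h0 : 0 ≤ τ) (h1 : τ ≤ 1)
    (h : 4 * (x ^ 2 + y ^ 2) ≤ R) (h' : 4 * (x' ^ 2 + y' ^ 2) ≤ q ^ 2 * R) :
    4 * (((1 - τ) * x' + τ * x) ^ 2 + ((1 - τ) * y' + τ * y) ^ 2) ≤ (q + τ * (1 - q)) ^ 2 * R := by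
  have h3 := cross_le_of_sq_le (x := x) (y := y) (p := 1) zero_le_one hq hR (by linarith) h'
  have k1 := mul_le_mul_of_nonneg_left h (sq_nonneg τ)
  have k2 := mul_le_mul_of_nonneg_left h' (sq_nonneg (1 - τ))
  have k3 := mul_le_mul_of_nonneg_left h3 (mul_nonneg h0 (sub_nonneg.2 h1))
  linarith

/-- On a ray of the center plane, the energy of points in the center cone is strictly monotone. -/
theorem eq_of_ray (S : IsSaddleCenterSystem ω l ε ρ f h g zs) {d₁ d₂ : LiftedPhase}
    (b₁ : ‖zs + d₁‖ ≤ ρ) (b₂ : ‖zs + d₂‖ ≤ ρ) (c₁ : InCenterCone d₁) (c₂ : InCenterCone d₂)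
    (c₁₂ : InCenterCone (d₁ - d₂)) {q : ℝ} (hq0 : 0 ≤ q) (hq1 : q ≤ 1) (e0 : d₂ 0 = q * d₁ 0)
    (e1 : d₂ 1 = q * d₁ 1) (hE : h (zs + d₁) = h (zs + d₂)) : d₁ = d₂ := by
  by_contra hne
  set R := d₁ 0 ^ 2 + d₁ 1 ^ 2 with hR
  have hw0 : (d₁ - d₂) 0 = (1 - q) * d₁ 0 := by rw [PiLp.sub_apply, e0]; ring
  have hw1 : (d₁ - d₂) 1 = (1 - q) * d₁ 1 := by rw [PiLp.sub_apply, e1]; ring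
  have hpos : 0 < (1 - q) ^ 2 * R := by
    rcases (mul_nonneg (sq_nonneg (1 - q)) (show 0 ≤ R by positivity)).eq_or_lt with h0 | h0
    · exfalso
      apply hne
      rw [← sub_eq_zero]
      have e : ((d₁ - d₂) 0) ^ 2 + ((d₁ - d₂) 1) ^ 2 = 0 := by
        rw [hw0, hw1]; linarith
      refine c₁₂.eq_zero ?_ ?_
      · nlinarith [sq_nonneg ((d₁ - d₂) 0), sq_nonneg ((d₁ - d₂) 1)]
      · nlinarith [sq_nonneg ((d₁ - d₂) 0), sq_nonneg ((d₁ - d₂) 1)]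
    · exact h0
  have hR0 : 0 < R := by
    by_contra hcon
    push Not at hcon
    have := mul_nonpos_of_nonneg_of_nonpos (sq_nonneg (1 - q)) hcon
    linarith
  have hq1' : q < 1 := lt_of_le_of_ne hq1 fun h1 => by rw [h1] at hpos; simp at hpos
  -- the segment from `d₂` to `d₁`
  set σ : ℝ → LiftedPhase := fun τ => d₂ + τ • (d₁ - d₂) with hσ
  have hσb : ∀ τ ∈ Set.Icc (0 : ℝ) 1, ‖zs + σ τ‖ ≤ ρ := fun τ hτ => by
    have : zs + σ τ = (1 - τ) • (zs + d₂) + τ • (zs + d₁) := by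
      apply lifted_ext <;> simp [hσ] <;> ring
    rw [this]
    refine (norm_add_le _ _).trans ?_
    rw [norm_smul, norm_smul, Real.norm_of_nonneg hτ.1, Real.norm_of_nonneg (by linarith [hτ.2])]
    nlinarith [hτ.1, hτ.2]
  have hσd : ∀ τ, HasDerivAt (fun τ => zs + σ τ) (d₁ - d₂) τ := fun τ => by
    have h1 : HasDerivAt (fun τ : ℝ => τ • (d₁ - d₂)) (d₁ - d₂) τ := by
      simpa using (hasDerivAt_id τ).smul_const (d₁ - d₂)
    exact (h1.const_add d₂).const_add zs
  obtain ⟨τ, hτ, hslope⟩ := exists_hasDerivAt_eq_slope (fun τ => h (zs + σ τ))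
    (fun τ => ⟪g (zs + σ τ), d₁ - d₂⟫) zero_lt_one
    (HasDerivAt.continuousOn fun τ hτ => S.hasDerivAt_energy (hσd τ) (hσb τ hτ))
    (fun τ hτ => S.hasDerivAt_energy (hσd τ) (hσb τ (Set.Ioo_subset_Icc_self hτ)))
  have hs1 : σ 1 = d₁ := by simp [hσ]
  have hs0 : σ 0 = d₂ := by simp [hσ]
  rw [hs1, hs0, hE, sub_self, zero_div] at hslope
  have hτb := hσb τ (Set.Ioo_subset_Icc_self hτ)
  have hge := (S.inner_gradient_ge (w := d₁ - d₂) hτb).1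
  rw [hslope] at hge
  -- estimates along the segment
  set a := q + τ * (1 - q) with ha
  have ha0 : 0 < a := by have := mul_pos hτ.1 (sub_pos.2 hq1'); linarith
  have s0 : σ τ 0 = a * d₁ 0 := by
    simp only [hσ, PiLp.add_apply, PiLp.smul_apply, smul_eq_mul]; rw [hw0, e0]; ring
  have s1 : σ τ 1 = a * d₁ 1 := by
    simp only [hσ, PiLp.add_apply, PiLp.smul_apply, smul_eq_mul]; rw [hw1, e1]; ring
  have s2 : σ τ 2 = (1 - τ) * d₂ 2 + τ * d₁ 2 := by
    simp only [hσ, PiLp.add_apply, PiLp.smul_apply, smul_eq_mul, PiLp.sub_apply]; ring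
  have s3 : σ τ 3 = (1 - τ) * d₂ 3 + τ * d₁ 3 := by
    simp only [hσ, PiLp.add_apply, PiLp.smul_apply, smul_eq_mul, PiLp.sub_apply]; ring
  have hσcone : InCenterCone (σ τ) := by
    unfold InCenterCone at c₁ c₂ ⊢
    rw [s0, s1, s2, s3]
    rw [e0, e1] at c₂
    have hB : 4 * (d₂ 2 ^ 2 + d₂ 3 ^ 2) ≤ q ^ 2 * R := by rw [hR]; linarith
    have := cone_convex hq0 hR0.le hτ.1.le hτ.2.le c₁ hB
    rw [hR] at this
    linarith
  have hn1 := hσcone.norm_sq_le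
  have hn2 := c₁₂.norm_sq_le
  rw [s0, s1] at hn1
  rw [hw0, hw1] at hn2
  have hnorm : ‖σ τ‖ * ‖d₁ - d₂‖ ≤ 5 / 4 * (a * (1 - q) * R) := by
    exact norm_mul_le_of_sq_le ha0.le (sub_pos.2 hq1').le hR0.le (by rw [hR]; linarith)
      (by rw [hR]; linarith)
  have hcross : -(σ τ 3 * (d₁ - d₂) 2) - σ τ 2 * (d₁ - d₂) 3 ≥ -(1 / 4 * (a * (1 - q) * R)) := by
    have hq' : 0 < 1 - q := by linarith
    unfold InCenterCone at hσcone c₁₂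
    rw [s0, s1] at hσcone
    rw [hw0, hw1] at c₁₂
    have := cross_le_of_sq_le (x := σ τ 3) (y := σ τ 2) (x' := (d₁ - d₂) 2) (y' := (d₁ - d₂) 3)
      ha0.le hq'.le hR0.le (by rw [hR]; linarith) (by rw [hR]; linarith)
    linarith
  have hin : ⟪quadSC (σ τ), d₁ - d₂⟫ = a * (1 - q) * R
      + (-(σ τ 3 * (d₁ - d₂) 2) - σ τ 2 * (d₁ - d₂) 3) := by
    rw [inner_lifted, quadSC_zero_apply, quadSC_one_apply, quadSC_two_apply, quadSC_three_apply,
      hw0, hw1, s0, s1, hR]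
    ring
  rw [hin] at hge
  have hX : 0 < a * (1 - q) * R := mul_pos (mul_pos ha0 (sub_pos.2 hq1')) hR0
  have hε := S.ε_le_one
  have hε0 := S.ε_nonneg
  have k := mul_le_mul_of_nonneg_left hnorm hε0
  have k' := mul_le_mul_of_nonneg_right hε hX.le
  linarith

/-- Quadratic bounds of the energy in the center cone. -/
theorem energy_bounds (S : IsSaddleCenterSystem ω l ε ρ f h g zs) {d : LiftedPhase}
    (b : ‖zs + d‖ ≤ ρ) (c : InCenterCone d) :
    (d 0 ^ 2 + d 1 ^ 2) / 4 ≤ h (zs + d) - h zs ∧ h (zs + d) - h zs ≤ d 0 ^ 2 + d 1 ^ 2 := by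
  set R := d 0 ^ 2 + d 1 ^ 2 with hR
  have hR0 : 0 ≤ R := by positivity
  have hb : ∀ τ ∈ Set.Icc (0 : ℝ) 1, ‖zs + τ • d‖ ≤ ρ := fun τ hτ => by
    have : zs + τ • d = (1 - τ) • zs + τ • (zs + d) := by
      apply lifted_ext <;> simp <;> ring
    rw [this]
    refine (norm_add_le _ _).trans ?_
    rw [norm_smul, norm_smul, Real.norm_of_nonneg hτ.1, Real.norm_of_nonneg (by linarith [hτ.2])]
    have := S.norm_rest_le
    nlinarith [hτ.1, hτ.2]
  have hd : ∀ τ, HasDerivAt (fun τ : ℝ => zs + τ • d) d τ := fun τ => by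
    have h1 : HasDerivAt (fun τ : ℝ => τ • d) d τ := by
      simpa using (hasDerivAt_id τ).smul_const d
    exact h1.const_add zs
  have hcross : |d 2 * d 3 + d 3 * d 2| ≤ R / 4 := by
    have c' : 4 * (d 2 ^ 2 + d 3 ^ 2) ≤ R := c
    rw [abs_le]
    constructor <;> nlinarith [sq_nonneg (d 2 - d 3), sq_nonneg (d 2 + d 3)]
  have hnorm : ‖d‖ ^ 2 ≤ 5 / 4 * R := c.norm_sq_le
  have hder : ∀ τ ∈ Set.Icc (0 : ℝ) 1,
      τ * (R / 2) ≤ ⟪g (zs + τ • d), d⟫ ∧ ⟪g (zs + τ • d), d⟫ ≤ τ * (2 * R) := fun τ hτ => by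
    have h1 := S.inner_gradient_ge (d := τ • d) (w := d) (hb τ hτ)
    have h2 : ⟪quadSC (τ • d), d⟫ = τ * (R - (d 2 * d 3 + d 3 * d 2)) := by
      rw [inner_lifted, quadSC_zero_apply, quadSC_one_apply, quadSC_two_apply, quadSC_three_apply,
        hR]
      simp only [PiLp.smul_apply, smul_eq_mul]
      ring
    have h3 : ε * (‖τ • d‖ * ‖d‖) ≤ τ * (R / 8) := by
      rw [norm_smul, Real.norm_of_nonneg hτ.1]
      have hε := S.ε_le_one
      have e1 : ε * ‖d‖ ^ 2 ≤ R / 8 := by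
        calc ε * ‖d‖ ^ 2 ≤ ε * (5 / 4 * R) := by gcongr; exact S.ε_nonneg
          _ ≤ R / 8 := by nlinarith
      calc ε * (τ * ‖d‖ * ‖d‖) = τ * (ε * ‖d‖ ^ 2) := by ring
        _ ≤ τ * (R / 8) := by gcongr; exact hτ.1
    rw [h2] at h1
    have h4 := abs_le.1 hcross
    have k1 := mul_le_mul_of_nonneg_left h4.1 hτ.1
    have k2 := mul_le_mul_of_nonneg_left h4.2 hτ.1
    constructor
    · nlinarith [h1.1, mul_nonneg hτ.1 hR0]
    · nlinarith [h1.2, mul_nonneg hτ.1 hR0]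
  have hE : ∀ τ ∈ Set.Icc (0 : ℝ) 1, HasDerivAt (fun τ : ℝ => h (zs + τ • d))
      ⟪g (zs + τ • d), d⟫ τ := fun τ hτ => S.hasDerivAt_energy (hd τ) (hb τ hτ)
  have hq : ∀ (k τ : ℝ), HasDerivAt (fun τ : ℝ => k * τ ^ 2) (k * (2 * τ)) τ := fun k τ => by
    simpa using ((hasDerivAt_id τ).fun_pow 2).const_mul k
  have hcont : ContinuousOn (fun τ : ℝ => h (zs + τ • d)) (Set.Icc 0 1) :=
    HasDerivAt.continuousOn hE
  have m1 : MonotoneOn (fun τ : ℝ => h (zs + τ • d) - R / 4 * τ ^ 2) (Set.Icc 0 1) := by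
    refine monotoneOn_of_hasDerivWithinAt_nonneg (convex_Icc 0 1)
      (hcont.sub (by fun_prop)) (fun τ hτ =>
        ((hE τ (interior_subset hτ)).sub (hq (R / 4) τ)).hasDerivWithinAt) fun τ hτ => ?_
    have := (hder τ (interior_subset hτ)).1
    linarith
  have m2 : AntitoneOn (fun τ : ℝ => h (zs + τ • d) - R * τ ^ 2) (Set.Icc 0 1) := by
    refine antitoneOn_of_hasDerivWithinAt_nonpos (convex_Icc 0 1)
      (hcont.sub (by fun_prop)) (fun τ hτ =>
        ((hE τ (interior_subset hτ)).sub (hq R τ)).hasDerivWithinAt) fun τ hτ => ?_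
    have := (hder τ (interior_subset hτ)).2
    linarith
  have i0 : (0 : ℝ) ∈ Set.Icc (0 : ℝ) 1 := ⟨le_rfl, zero_le_one⟩
  have i1 : (1 : ℝ) ∈ Set.Icc (0 : ℝ) 1 := ⟨zero_le_one, le_rfl⟩
  have n1 := m1 i0 i1 zero_le_one
  have n2 := m2 i0 i1 zero_le_one
  simp only [zero_smul, add_zero, one_smul] at n1 n2
  constructor <;> linarith

end IsSaddleCenterSystem

end CR3BP

namespace CR3BP

theorem centerCoord_eq_smul {d₁ d₂ : LiftedPhase} {r₁ r₂ : ℝ} {w : ℂ} (hr₁ : 0 < r₁)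
    (h₁ : centerCoord d₁ = r₁ * w) (h₂ : centerCoord d₂ = r₂ * w) :
    d₂ 0 = r₂ / r₁ * d₁ 0 ∧ d₂ 1 = r₂ / r₁ * d₁ 1 := by
  have e1 := congrArg Complex.re h₁
  have e2 := congrArg Complex.im h₁
  have e3 := congrArg Complex.re h₂
  have e4 := congrArg Complex.im h₂
  rw [Complex.re_ofReal_mul] at e1 e3
  rw [Complex.im_ofReal_mul] at e2 e4
  simp only [centerCoord] at e1 e2 e3 e4
  rw [e1, e2, e3, e4]
  constructor <;> field_simp

theorem continuous_centerCoord : Continuous centerCoord := by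
  have key : centerCoord = fun z : LiftedPhase => (z 0 : ℂ) + z 1 * Complex.I := by
    funext z
    apply Complex.ext <;> simp [centerCoord]
  rw [key]
  exact (Complex.continuous_ofReal.comp (continuous_coord 0)).add
    ((Complex.continuous_ofReal.comp (continuous_coord 1)).mul continuous_const)

namespace IsSaddleCenterSystem

variable {ω l ε ρ : ℝ} {f : LiftedPhase → LiftedPhase} {h : LiftedPhase → ℝ}
  {g : LiftedPhase → LiftedPhase} {zs : LiftedPhase}

/-- Trajectories in the ball with the same energy meet a ray of the center plane in the same
point. -/
theorem eq_of_same_ray (S : IsSaddleCenterSystem ω l ε ρ f h g zs) {γ₁ γ₂ : ℝ → LiftedPhase}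
    (h₁ : IsTrajectory f γ₁) (h₂ : IsTrajectory f γ₂) (b₁ : ∀ t, ‖γ₁ t‖ ≤ ρ)
    (b₂ : ∀ t, ‖γ₂ t‖ ≤ ρ) (hE : h (γ₁ 0) = h (γ₂ 0)) {s t r₁ r₂ : ℝ} {w : ℂ} (hr₁ : 0 < r₁)
    (hr₂ : 0 < r₂) (e₁ : centerCoord (γ₁ s - zs) = r₁ * w)
    (e₂ : centerCoord (γ₂ t - zs) = r₂ * w) : γ₁ s = γ₂ t := by
  have hE' : h (γ₁ s) = h (γ₂ t) := by
    rw [S.energy_eq h₁ b₁ s 0, S.energy_eq h₂ b₂ t 0, hE]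
  have c₁ := S.inCenterCone_sub_rest h₁ b₁ s
  have c₂ := S.inCenterCone_sub_rest h₂ b₂ t
  have c₁₂ := S.inCenterCone_sub (h₁.shift s) (h₂.shift t) (fun r => b₁ _) (fun r => b₂ _) 0
  have c₂₁ := S.inCenterCone_sub (h₂.shift t) (h₁.shift s) (fun r => b₂ _) (fun r => b₁ _) 0
  rw [zero_add, zero_add] at c₁₂ c₂₁
  rcases le_total r₂ r₁ with hle | hle
  · obtain ⟨q0, q1⟩ := centerCoord_eq_smul hr₁ e₁ e₂
    have := S.eq_of_ray (d₁ := γ₁ s - zs) (d₂ := γ₂ t - zs) (by simpa using b₁ s)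
      (by simpa using b₂ t) c₁ c₂ (by simpa using c₁₂) (by positivity)
      ((div_le_one hr₁).2 hle) q0 q1 (by simpa using hE')
    simpa using this
  · obtain ⟨q0, q1⟩ := centerCoord_eq_smul hr₂ e₂ e₁
    have := S.eq_of_ray (d₁ := γ₂ t - zs) (d₂ := γ₁ s - zs) (by simpa using b₂ t)
      (by simpa using b₁ s) c₂ c₁ (by simpa using c₂₁) (by positivity)
      ((div_le_one hr₂).2 hle) q0 q1 (by simpa using hE'.symm)
    simpa using this.symm

/-- The center coordinate of a trajectory in the ball turns monotonically. -/
theorem exists_center_argument (S : IsSaddleCenterSystem ω l ε ρ f h g zs) {γ : ℝ → LiftedPhase}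
    (hγ : IsTrajectory f γ) (b : ∀ t, ‖γ t‖ ≤ ρ) (hne : γ 0 ≠ zs) :
    (∀ t, HasDerivAt (fun t => centerCoord (γ t - zs)) (centerCoord (f (γ t))) t) ∧
    (∀ t, centerCoord (γ t - zs) ≠ 0) ∧
    ∃ θ, IsArgument (fun t => centerCoord (γ t - zs)) θ ∧
      ∀ s t, s ≤ t → 3 / 4 * ω * (t - s) ≤ θ t - θ s ∧ θ t - θ s ≤ 5 / 4 * ω * (t - s) := by
  have hd : ∀ t, HasDerivAt (fun t => centerCoord (γ t - zs)) (centerCoord (f (γ t))) t :=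
    fun t => hasDerivAt_centerCoord ((hγ t).sub_const zs)
  have hcone := S.inCenterCone_sub_rest hγ b
  have h0 : ∀ t, centerCoord (γ t - zs) ≠ 0 := fun t => by
    refine (hcone t).centerCoord_ne_zero fun heq => hne ?_
    rw [sub_eq_zero] at heq
    rw [S.unique hγ S.isTrajectory_rest heq]
  have hc : Continuous fun t => centerCoord (f (γ t)) :=
    continuous_centerCoord.comp (S.lipschitz.continuous.comp hγ.continuous)
  obtain ⟨θ, hθ⟩ := exists_isArgument hd hc h0
  have hb : ∀ t, _ := fun t => angular_velocity_bounds (ω := ω) (l := l) S.ε_nonneg S.ε_le_ω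
    (hcone t) (z' := f (γ t)) (by
      have := S.nearlyLinear (γ t) zs
      rwa [S.rest, sub_zero] at this)
  exact ⟨hd, h0, θ, hθ, fun s t hst =>
    ⟨hθ.increment_ge hst hd h0 fun r _ => (hb r).1,
      hθ.increment_le hst hd h0 fun r _ => (hb r).2⟩⟩

theorem exists_argument_eq {ω : ℝ} (hω : 0 < ω) {θ : ℝ → ℝ} (hc : Continuous θ)
    (h : ∀ s t, s ≤ t → 3 / 4 * ω * (t - s) ≤ θ t - θ s) {α : ℝ} (hα : θ 0 ≤ α) :
    ∃ t ∈ Set.Icc 0 (4 * (α - θ 0) / (3 * ω)), θ t = α := by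
  have hT : 0 ≤ 4 * (α - θ 0) / (3 * ω) := div_nonneg (by linarith) (by positivity)
  have h1 := h 0 _ hT
  have h2 : 3 / 4 * ω * (4 * (α - θ 0) / (3 * ω) - 0) = α - θ 0 := by field_simp; ring
  rw [h2] at h1
  exact intermediate_value_Icc hT hc.continuousOn ⟨hα, by linarith⟩

/-- A trajectory in the ball, other than the rest point, is periodic, with minimal period close to
the period of the linear center. -/
theorem exists_period (S : IsSaddleCenterSystem ω l ε ρ f h g zs) {γ : ℝ → LiftedPhase}
    (hγ : IsTrajectory f γ) (b : ∀ t, ‖γ t‖ ≤ ρ) (hne : γ 0 ≠ zs) :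
    ∃ P ∈ Set.Icc (8 * Real.pi / (5 * ω)) (8 * Real.pi / (3 * ω)), (∀ t, γ (t + P) = γ t) ∧
      ∀ T, 0 < T → γ T = γ 0 → ∃ k : ℕ, 1 ≤ k ∧ T = k * P := by
  have hω := S.ω_pos
  obtain ⟨hd, h0, θ, hθ, hinc⟩ := S.exists_center_argument hγ b hne
  have hpi := Real.pi_pos
  obtain ⟨P, hP, hPθ⟩ := exists_argument_eq hω hθ.continuous (fun s t hst => (hinc s t hst).1)
    (α := θ 0 + 2 * Real.pi) (by linarith)
  have hPbound : P ≤ 8 * Real.pi / (3 * ω) := by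
    refine hP.2.trans_eq ?_
    congr 1
    ring
  have hPlow : 8 * Real.pi / (5 * ω) ≤ P := by
    have := (hinc 0 P hP.1).2
    rw [hPθ] at this
    rw [div_le_iff₀ (by positivity)]
    linarith
  have hPpos : 0 < P := lt_of_lt_of_le (by positivity) hPlow
  have hexp : Complex.exp ((θ P : ℝ) * Complex.I) = Complex.exp (θ 0 * Complex.I) := by
    rw [hPθ]
    push_cast
    rw [add_mul, Complex.exp_add, Complex.exp_two_pi_mul_I, mul_one]
  have hper0 : γ P = γ 0 := by
    refine S.eq_of_same_ray hγ hγ b b rfl (norm_pos_iff.2 (h0 P)) (norm_pos_iff.2 (h0 0))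
      (w := Complex.exp (θ 0 * Complex.I)) ?_ (hθ.polar 0)
    rw [← hexp]; exact hθ.polar P
  have hper : ∀ t, γ (t + P) = γ t := by
    have := S.unique (hγ.shift P) hγ (t₀ := 0) (by rw [zero_add, hper0])
    exact fun t => congrFun this t
  refine ⟨P, ⟨hPlow, hPbound⟩, hper, fun T hT hTγ => ?_⟩
  have hstep : ∀ t, θ (t + P) = θ t + 2 * Real.pi := by
    have harg : IsArgument (fun t => centerCoord (γ t - zs)) fun t => θ (t + P) := by
      refine ⟨hθ.continuous.comp (continuous_add_const P), fun t => ?_⟩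
      have := hθ.polar (t + P)
      rwa [hper] at this
    intro t
    have := harg.increment_eq hθ hd h0 0 t
    rw [zero_add, hPθ] at this
    linarith
  have hmul : ∀ k : ℕ, θ (k * P) = θ 0 + 2 * Real.pi * k := by
    intro k
    induction k with
    | zero => simp
    | succ k ih =>
      have : ((k + 1 : ℕ) : ℝ) * P = k * P + P := by push_cast; ring
      rw [this, hstep, ih]
      push_cast
      ring
  have hexpT : Complex.exp ((θ T : ℝ) * Complex.I) = Complex.exp (θ 0 * Complex.I) := by
    have e1 := hθ.polar T
    have e2 := hθ.polar 0
    simp only [hTγ] at e1 e2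
    rw [e2] at e1
    have hn : ((‖centerCoord (γ 0 - zs)‖ : ℝ) : ℂ) ≠ 0 := by
      exact_mod_cast norm_ne_zero_iff.2 (h0 0)
    simp only [norm_mul, Complex.norm_exp_ofReal_mul_I, mul_one, Complex.norm_real, norm_norm] at e1
    exact (mul_left_cancel₀ hn e1).symm
  obtain ⟨n, hn⟩ := Complex.exp_eq_exp_iff_exists_int.1 hexpT
  have hn' : θ T = θ 0 + 2 * Real.pi * n := by
    have h1 : ((θ T : ℝ) : ℂ) * Complex.I = ((θ 0 + 2 * Real.pi * n : ℝ) : ℂ) * Complex.I := by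
      rw [hn]; push_cast; ring
    exact_mod_cast mul_right_cancel₀ Complex.I_ne_zero h1
  have hmono : StrictMono θ := fun s t hst => by
    have := (hinc s t hst.le).1
    have : 0 < 3 / 4 * ω * (t - s) := mul_pos (by positivity) (sub_pos.2 hst)
    linarith
  have hnpos : 0 < n := by
    have h1 := hmono hT
    rw [hn'] at h1
    have h2 : (0 : ℝ) < 2 * Real.pi * n := by linarith
    have : (0 : ℝ) < n := by
      by_contra hcon
      push Not at hcon
      have := mul_nonpos_of_nonneg_of_nonpos (by positivity : 0 ≤ 2 * Real.pi) hcon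
      linarith
    exact_mod_cast this
  refine ⟨n.toNat, by omega, hmono.injective ?_⟩
  rw [hmul, hn']
  have : ((n.toNat : ℕ) : ℝ) = (n : ℝ) := by
    exact_mod_cast congrArg (fun k : ℤ => (k : ℝ)) (Int.toNat_of_nonneg hnpos.le)
  rw [this]

/-- Two trajectories in the ball with the same energy, other than the rest point, agree up to a
shift of time. -/
theorem exists_shift (S : IsSaddleCenterSystem ω l ε ρ f h g zs) {γ₁ γ₂ : ℝ → LiftedPhase}
    (h₁ : IsTrajectory f γ₁) (h₂ : IsTrajectory f γ₂) (b₁ : ∀ t, ‖γ₁ t‖ ≤ ρ)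
    (b₂ : ∀ t, ‖γ₂ t‖ ≤ ρ) (n₁ : γ₁ 0 ≠ zs) (n₂ : γ₂ 0 ≠ zs) (hE : h (γ₁ 0) = h (γ₂ 0)) :
    ∃ s, ∀ t, γ₁ t = γ₂ (t + s) := by
  obtain ⟨-, z₁, θ₁, a₁, -⟩ := S.exists_center_argument h₁ b₁ n₁
  obtain ⟨-, z₂, θ₂, a₂, i₂⟩ := S.exists_center_argument h₂ b₂ n₂
  obtain ⟨n, hn⟩ := exists_nat_ge ((θ₂ 0 - θ₁ 0) / (2 * Real.pi))
  rw [div_le_iff₀ (by positivity)] at hn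
  obtain ⟨s, -, hs⟩ := exists_argument_eq S.ω_pos a₂.continuous (fun s t hst => (i₂ s t hst).1)
    (α := θ₁ 0 + n * (2 * Real.pi)) (by linarith)
  have hexp : Complex.exp ((θ₂ s : ℝ) * Complex.I) = Complex.exp (θ₁ 0 * Complex.I) := by
    rw [hs, Complex.exp_eq_exp_iff_exists_int]
    exact ⟨n, by push_cast; ring⟩
  have heq : γ₁ 0 = γ₂ s := by
    refine S.eq_of_same_ray h₁ h₂ b₁ b₂ hE (norm_pos_iff.2 (z₁ 0)) (norm_pos_iff.2 (z₂ s))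
      (w := Complex.exp (θ₁ 0 * Complex.I)) (a₁.polar 0) ?_
    rw [← hexp]; exact a₂.polar s
  have := S.unique h₁ (h₂.shift s) (t₀ := 0) (by rw [zero_add, heq])
  exact ⟨s, fun t => congrFun this t⟩

/-- The point of the symmetry plane at height `r` and hyperbolic coordinates `ξ`. -/
def symPoint (zs : LiftedPhase) (r ξ : ℝ) : LiftedPhase := zs + !₂[0, r, ξ, ξ]

theorem symPoint_sub (zs : LiftedPhase) (r ξ : ℝ) : symPoint zs r ξ - zs = !₂[0, r, ξ, ξ] := by
  rw [symPoint, add_sub_cancel_left]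

theorem refl_symPoint (S : IsSaddleCenterSystem ω l ε ρ f h g zs) (r ξ : ℝ) :
    refl (symPoint zs r ξ) = symPoint zs r ξ := by
  have h1 : refl (symPoint zs r ξ) = refl zs + refl !₂[0, r, ξ, ξ] := by
    rw [symPoint, ← reflL_apply, map_add]; rfl
  rw [h1, S.refl_rest, symPoint]
  congr 1
  apply lifted_ext <;> simp

theorem continuous_symPoint (zs : LiftedPhase) :
    Continuous fun p : ℝ × ℝ => symPoint zs p.1 p.2 := by
  refine continuous_const.add ?_
  refine (PiLp.continuous_toLp 2 _).comp (continuous_pi fun i => ?_)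
  fin_cases i <;> simp <;> fun_prop

theorem exists_trajectory (S : IsSaddleCenterSystem ω l ε ρ f h g zs) (z : LiftedPhase) :
    ∃ γ, γ 0 = z ∧ IsTrajectory f γ :=
  exists_global_solution (f := fun _ => f) (fun _ => S.lipschitz) (fun _ => continuous_const) z

/-- On the segment of symmetric points at height `r` there is a point whose trajectory never enters
the unstable cone. -/
theorem exists_symPoint_coneU_nonpos (S : IsSaddleCenterSystem ω l ε ρ f h g zs) {r : ℝ}
    (hr : 0 ≤ r) : ∃ ξ, ∀ γ, IsTrajectory f γ → γ 0 = symPoint zs r ξ →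
      ∀ t, 0 ≤ t → coneU (γ t - zs) ≤ 0 := by
  rcases hr.eq_or_lt with rfl | hr0
  · refine ⟨0, fun γ hγ hγ0 t _ => ?_⟩
    have : γ 0 = zs := by
      rw [hγ0, symPoint]
      apply lifted_ext <;> simp
    rw [S.unique hγ S.isTrajectory_rest this, sub_self]
    simp [coneU]
  by_contra hcon
  push Not at hcon
  choose Γ hΓ0 hΓ using fun ξ => S.exists_trajectory (symPoint zs r ξ)
  have hdep : ∀ t, Continuous fun ξ => Γ ξ t := by
    intro t
    rw [continuous_iff_continuousAt]
    intro ξ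
    have hle : ∀ η, dist (Γ η t) (Γ ξ t) ≤
        dist (symPoint zs r η) (symPoint zs r ξ) * Real.exp ((ω + l + ε).toNNReal * |t|) := by
      intro η
      have := dist_trajectories_le S.lipschitz (g := f) (η := 0) (fun x => by simp) (hΓ η) (hΓ ξ) t
      rwa [hΓ0, hΓ0, gronwallBound_ε0] at this
    rw [ContinuousAt, tendsto_iff_dist_tendsto_zero]
    refine squeeze_zero (fun _ => dist_nonneg) hle ?_
    have hc : Continuous fun η => symPoint zs r η :=
      (continuous_symPoint zs).comp (Continuous.prodMk_right r)
    have := (tendsto_iff_dist_tendsto_zero.1 (hc.tendsto ξ)).mul_const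
      (Real.exp ((ω + l + ε).toNNReal * |t|))
    rwa [zero_mul] at this
  set B : ℝ → Set ℝ := fun σ => {ξ | ∃ t, 0 ≤ t ∧ 0 < coneU (Γ ξ t - zs) ∧
    0 < σ * (Γ ξ t - zs) 2} with hB
  have hBo : ∀ σ, IsOpen (B σ) := fun σ => by
    have : B σ = ⋃ t : Set.Ici (0 : ℝ), {ξ | 0 < coneU (Γ ξ t - zs)} ∩
        {ξ | 0 < σ * (Γ ξ t - zs) 2} := by
      ext ξ
      simp only [hB, Set.mem_ofPred_eq, Set.mem_iUnion, Set.mem_inter_iff, Subtype.exists,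
        Set.mem_Ici, exists_prop]
    rw [this]
    refine isOpen_iUnion fun t => ?_
    have hc : Continuous fun ξ => Γ ξ t - zs := (hdep t).sub continuous_const
    exact (isOpen_lt continuous_const (continuous_coneU.comp hc)).inter
      (isOpen_lt continuous_const (continuous_const.mul ((continuous_coord 2).comp hc)))
  have hu : ∀ z : LiftedPhase, 0 < coneU z → z 2 ≠ 0 := fun z hz h0 => by
    unfold coneU at hz
    rw [h0] at hz
    nlinarith [sq_nonneg (z 0), sq_nonneg (z 1), sq_nonneg (z 3)]
  have hcover : Set.Icc (-r) r ⊆ B 1 ∪ B (-1) := fun ξ _ => by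
    obtain ⟨γ, hγ, hγ0, t, ht, hpos⟩ := hcon ξ
    have : γ = Γ ξ := S.unique hγ (hΓ ξ) (t₀ := 0) (by rw [hγ0, hΓ0])
    rw [this] at hpos
    rcases lt_or_gt_of_ne (hu _ hpos) with hlt | hgt
    · exact Or.inr ⟨t, ht, hpos, by linarith⟩
    · exact Or.inl ⟨t, ht, hpos, by linarith⟩
  have hend : ∀ σ : ℝ, σ ^ 2 = 1 → σ * r ∈ B σ := fun σ hσ => by
    refine ⟨0, le_rfl, ?_, ?_⟩
    · rw [hΓ0, symPoint_sub]
      simp [coneU, mul_pow, hσ]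
      nlinarith [pow_pos hr0 2]
    · rw [hΓ0, symPoint_sub]
      simp only [Matrix.cons_val]
      rw [← mul_assoc, ← sq, hσ, one_mul]
      exact hr0
  have hpre := isPreconnected_Icc (a := -r) (b := r) (B 1) (B (-1)) (hBo 1) (hBo (-1)) hcover
    ⟨r, ⟨by linarith, le_rfl⟩, by simpa using hend 1 (by norm_num)⟩
    ⟨-r, ⟨le_rfl, by linarith⟩, by simpa using hend (-1) (by norm_num)⟩
  obtain ⟨ξ, -, ⟨t₁, ht₁, p₁, u₁⟩, t₂, ht₂, p₂, u₂⟩ := hpre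
  have hNL := S.sub_isNearlyLinear (hΓ ξ) S.isTrajectory_rest
  have hcu : Continuous fun t => (Γ ξ t - zs) 2 := (continuous_coord 2).comp hNL.continuous
  have hne : ∀ t ∈ Set.uIcc t₁ t₂, (Γ ξ t - zs) 2 ≠ 0 := fun t ht => by
    apply hu
    rcases le_total t₁ t₂ with hle | hle
    · rw [Set.uIcc_of_le hle] at ht
      exact hNL.coneU_pos S.l_pos S.ε_le_l ht.1 p₁
    · rw [Set.uIcc_of_ge hle] at ht
      exact hNL.coneU_pos S.l_pos S.ε_le_l ht.1 p₂
  obtain ⟨t, ht, h0⟩ := intermediate_value_uIcc (a := t₁) (b := t₂) hcu.continuousOn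
    (show (0 : ℝ) ∈ _ from Set.mem_uIcc.2 (Or.inr ⟨by linarith, by linarith⟩))
  exact hne t ht h0

/-- At every small height there is a symmetric point whose trajectory stays in the ball. -/
theorem exists_symPoint_bounded (S : IsSaddleCenterSystem ω l ε ρ f h g zs) {r : ℝ}
    (hr : 0 ≤ r) (hrρ : 7 * r ≤ ρ) : ∃ ξ, ∀ γ, IsTrajectory f γ → γ 0 = symPoint zs r ξ →
      ∀ t, ‖γ t‖ ≤ ρ := by
  obtain ⟨ξ, hξ⟩ := S.exists_symPoint_coneU_nonpos hr
  refine ⟨ξ, fun γ hγ hγ0 => ?_⟩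
  have hsym : ∀ t, refl (γ (-t)) = γ t := by
    have h1 : IsTrajectory f fun t => refl (γ (-t)) := fun t => by
      have h1 : HasDerivAt (fun t => γ (-t)) (-f (γ (-t))) t := by
        simpa [Function.comp_def] using (hγ (-t)).scomp t (hasDerivAt_neg t)
      have h2 := reflL.hasFDerivAt.comp_hasDerivAt t h1
      rw [map_neg, reflL_apply, ← S.reversible] at h2
      exact h2
    have := S.unique h1 hγ (t₀ := 0) (by
      simp only [neg_zero]
      rw [hγ0, S.refl_symPoint])
    exact fun t => congrFun this t
  have hsub : ∀ t, refl (γ t - zs) = γ (-t) - zs := fun t => by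
    rw [refl_sub, S.refl_rest, ← hsym (-t), neg_neg]
  have hNL := S.sub_isNearlyLinear hγ S.isTrajectory_rest
  -- the trajectory stays in the center cone in forward time
  have hfwd : ∀ t, 0 ≤ t → InCenterCone (γ t - zs) := fun t ht => by
    refine inCenterCone_of_coneU (hξ γ hγ hγ0 t ht) ?_
    have hm := hNL.reverse.coneU_mono S.l_pos S.ε_le_l (show -t ≤ 0 by linarith)
    simp only [neg_neg, neg_zero, mul_zero, Real.exp_zero, one_mul] at hm
    have h0 : coneU (refl (γ 0 - zs)) ≤ 0 := by
      rw [hsub, neg_zero]; exact hξ γ hγ hγ0 0 le_rfl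
    have h1 := hm.trans h0
    by_contra hcon
    push Not at hcon
    exact absurd h1 (not_le.2 (mul_pos (Real.exp_pos _) hcon))
  have hr1 : r ^ 2 = (γ 0 - zs) 0 ^ 2 + (γ 0 - zs) 1 ^ 2 := by
    rw [hγ0, symPoint_sub]; simp
  have hb0 : ‖γ 0 - zs‖ ≤ 3 * r := by
    rw [← sq_le_sq₀ (norm_nonneg _) (by positivity)]
    have := (hfwd 0 le_rfl).norm_sq_le
    nlinarith [sq_nonneg r]
  have hnz := S.norm_rest
  have hρ := S.ρ_pos
  have hball : ∀ t, ‖γ t - zs‖ ≤ 3 * r → ‖γ t‖ < ρ := fun t ht => by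
    have : ‖γ t‖ ≤ ‖γ t - zs‖ + ‖zs‖ := by simpa using norm_add_le (γ t - zs) zs
    rcases hr.eq_or_lt with h0 | h0
    · rw [← h0] at ht; linarith
    · linarith
  have hstay : ∀ t, 0 ≤ t → (∀ s ∈ Set.Icc 0 t, ‖γ s‖ ≤ ρ) → ‖γ t - zs‖ ≤ 3 * r := by
    intro t ht hs
    have hE := S.energy_const hγ ht hs
    have e1 := (S.energy_bounds (d := γ t - zs) (by simpa using hs t ⟨ht, le_rfl⟩) (hfwd t ht)).1
    have e2 := (S.energy_bounds (d := γ 0 - zs) (by simpa using hs 0 ⟨le_rfl, ht⟩)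
      (hfwd 0 le_rfl)).2
    rw [add_sub_cancel] at e1 e2
    rw [← hr1] at e2
    rw [← sq_le_sq₀ (norm_nonneg _) (by positivity)]
    have := (hfwd t ht).norm_sq_le
    nlinarith [sq_nonneg r]
  have hpos : ∀ t, 0 ≤ t → ‖γ t‖ ≤ ρ := by
    intro T hT
    have hc : Continuous fun t => ‖γ t‖ := hγ.continuous.norm
    set A : Set ℝ := {t | ∀ s ∈ Set.Icc 0 t, ‖γ s‖ ≤ ρ} with hA
    have hclosed : IsClosed (A ∩ Set.Icc 0 T) := by
      refine isClosed_of_closure_subset fun t ht => ?_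
      have htT : t ∈ Set.Icc 0 T := isClosed_Icc.closure_subset_iff.2 Set.inter_subset_right ht
      refine ⟨fun s hs => ?_, htT⟩
      rcases hs.2.eq_or_lt with rfl | hlt
      · refine isClosed_le hc continuous_const |>.closure_subset_iff.2 ?_ ht
        exact fun u hu => hu.1 u ⟨hu.2.1, le_rfl⟩
      · obtain ⟨u, hu1, hu2⟩ := mem_closure_iff_nhds.1 ht _ (Ioi_mem_nhds hlt)
        exact hu2.1 s ⟨hs.1, (Set.mem_Ioi.1 hu1).le⟩
    have hsubset := hclosed.Icc_subset_of_forall_mem_nhdsWithin (a := 0) (b := T)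
      (fun s hs => by
        have : s = 0 := le_antisymm hs.2 hs.1
        rw [this]; exact (hball 0 hb0).le) (fun t ht => by
        have h1 := hball t (hstay t ht.2.1 ht.1)
        have h2 : ∀ᶠ u in 𝓝 t, ‖γ u‖ < ρ := hc.continuousAt.eventually_lt continuousAt_const h1
        obtain ⟨η, hη, hball'⟩ := Metric.eventually_nhds_iff.1 h2
        filter_upwards [Ioo_mem_nhdsGT (show t < t + η by linarith)] with u hu s hs
        rcases le_total s t with hst | hst
        · exact ht.1 s ⟨hs.1, hst⟩
        · refine (hball' ?_).le
          rw [Real.dist_eq, abs_of_nonneg (by linarith)]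
          linarith [hs.2, hu.2])
    exact hsubset ⟨hT, le_rfl⟩ T ⟨hT, le_rfl⟩
  intro t
  rcases le_total 0 t with ht | ht
  · exact hpos t ht
  · rw [← hsym t, norm_refl]
    exact hpos (-t) (by linarith)

/-- The zero energy level contains a symmetric trajectory in the ball, provided that the energy of
the rest point is negative and small. -/
theorem exists_zero_energy_trajectory (S : IsSaddleCenterSystem ω l ε ρ f h g zs)
    (h1 : h zs < 0) (h2 : -(ρ ^ 2 / 196) ≤ h zs) :
    ∃ γ r ξ, IsTrajectory f γ ∧ (∀ t, ‖γ t‖ ≤ ρ) ∧ h (γ 0) = 0 ∧ 0 < r ∧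
      γ 0 = symPoint zs r ξ := by
  have hρ := S.ρ_pos
  have hex : ∀ r : Set.Icc (0 : ℝ) (ρ / 7), ∃ ξ γ, IsTrajectory f γ ∧
      γ 0 = symPoint zs r ξ ∧ ∀ t, ‖γ t‖ ≤ ρ := fun r => by
    obtain ⟨ξ, hξ⟩ := S.exists_symPoint_bounded r.2.1 (by linarith [r.2.2])
    obtain ⟨γ, hγ0, hγ⟩ := S.exists_trajectory (symPoint zs r ξ)
    exact ⟨ξ, γ, hγ, hγ0, hξ γ hγ hγ0⟩
  choose ξ γ hγ hγ0 hb using hex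
  have hlip : ∀ r r', |ξ r - ξ r'| ≤ |(r : ℝ) - r'| := fun r r' => by
    have := S.inCenterCone_sub (hγ r) (hγ r') (hb r) (hb r') 0
    have e : γ r 0 - γ r' 0 = !₂[0, (r : ℝ) - r', ξ r - ξ r', ξ r - ξ r'] := by
      rw [hγ0, hγ0, symPoint, symPoint]
      apply lifted_ext <;> simp
    rw [e] at this
    unfold InCenterCone at this
    simp only [Matrix.cons_val] at this
    refine sq_le_sq.1 ?_
    nlinarith [sq_nonneg (ξ r - ξ r')]
  have hξc : Continuous ξ := by
    refine continuous_iff_continuousAt.2 fun r => ?_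
    rw [ContinuousAt, tendsto_iff_dist_tendsto_zero]
    refine squeeze_zero (fun _ => dist_nonneg) (fun r' => ?_)
      (tendsto_iff_dist_tendsto_zero.1 (continuous_subtype_val.tendsto r))
    exact hlip r' r
  have hEc : Continuous fun r => h (γ r 0) := by
    have hc : Continuous fun r : Set.Icc (0 : ℝ) (ρ / 7) => γ r 0 := by
      simp only [hγ0]
      exact (continuous_symPoint zs).comp (continuous_subtype_val.prodMk hξc)
    refine continuous_iff_continuousAt.2 fun r => ?_
    exact ContinuousAt.comp (f := fun r => γ r 0) (S.hasGradient _ (hb r 0)).continuousAt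
      hc.continuousAt
  have hbd := fun r => S.energy_bounds (d := γ r 0 - zs) (by simpa using hb r 0)
    (S.inCenterCone_sub_rest (hγ r) (hb r) 0)
  have hr2 : ∀ r, (γ r 0 - zs) 0 ^ 2 + (γ r 0 - zs) 1 ^ 2 = (r : ℝ) ^ 2 := fun r => by
    rw [hγ0, symPoint_sub]; simp
  simp only [add_sub_cancel, hr2] at hbd
  have i0 : (0 : ℝ) ∈ Set.Icc (0 : ℝ) (ρ / 7) := ⟨le_rfl, by positivity⟩
  have i1 : ρ / 7 ∈ Set.Icc (0 : ℝ) (ρ / 7) := ⟨by positivity, le_rfl⟩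
  have v0 : h (γ ⟨0, i0⟩ 0) ≤ 0 := by
    have := (hbd ⟨0, i0⟩).2
    simp only at this
    linarith
  have v1 : 0 ≤ h (γ ⟨ρ / 7, i1⟩ 0) := by
    have := (hbd ⟨ρ / 7, i1⟩).1
    simp only at this
    linarith
  have : PreconnectedSpace (Set.Icc (0 : ℝ) (ρ / 7)) :=
    Subtype.preconnectedSpace isPreconnected_Icc
  obtain ⟨r, hr⟩ := mem_range_of_exists_le_of_exists_ge hEc ⟨_, v0⟩ ⟨_, v1⟩
  refine ⟨γ r, r, ξ r, hγ r, hb r, hr, ?_, hγ0 r⟩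
  refine lt_of_le_of_ne r.2.1 fun h0 => ?_
  have := (hbd r).2
  have hr' : h (γ r 0) = 0 := hr
  rw [← h0, hr'] at this
  linarith

end IsSaddleCenterSystem

end CR3BP

namespace CR3BP

theorem tendsto_of_isCompact {α β : Type*} [TopologicalSpace β] {K : Set β} (hK : IsCompact K)
    {F : Filter α} {p : α → β} {a : β} (hp : ∀ᶠ x in F, p x ∈ K)
    (hu : ∀ U : Ultrafilter α, ↑U ≤ F → ∀ y ∈ K, Tendsto p U (𝓝 y) → y = a) :
    Tendsto p F (𝓝 a) := by
  rw [tendsto_iff_ultrafilter]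
  intro U hU
  have hUK : K ∈ U.map p := hU hp
  obtain ⟨y, hy, hle⟩ := hK.ultrafilter_le_nhds' _ hUK
  rw [← hu U hU y hy hle]
  exact hle

namespace IsSaddleCenterSystem

variable {ω l ε ρ : ℝ}

theorem le_norm_linSC {m : ℝ} (hm : 0 ≤ m) (h1 : m ≤ ω) (h2 : m ≤ l) (z : LiftedPhase) :
    m * ‖z‖ ≤ ‖linSC ω l z‖ := by
  rw [← sq_le_sq₀ (by positivity) (norm_nonneg _), mul_pow, norm_sq_lifted, norm_sq_lifted]
  simp only [linSC_zero_apply, linSC_one_apply, linSC_two_apply, linSC_three_apply]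
  have e1 : m ^ 2 ≤ ω ^ 2 := by gcongr
  have e2 : m ^ 2 ≤ l ^ 2 := by gcongr
  nlinarith [mul_nonneg (sub_nonneg.2 e1) (add_nonneg (sq_nonneg (z 0)) (sq_nonneg (z 1))),
    mul_nonneg (sub_nonneg.2 e2) (add_nonneg (sq_nonneg (z 2)) (sq_nonneg (z 3)))]

/-- The rest point depends on the vector field in a Lipschitz way. -/
theorem norm_rest_sub_le {f f' : LiftedPhase → LiftedPhase} {h h' : LiftedPhase → ℝ}
    {g g' : LiftedPhase → LiftedPhase} {zs zs' : LiftedPhase}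
    (S : IsSaddleCenterSystem ω l ε ρ f h g zs) (S' : IsSaddleCenterSystem ω l ε ρ f' h' g' zs')
    {c : ℝ} (hc : ∀ z, ‖f z - f' z‖ ≤ c) : min (ω / 2) (l / 2) * ‖zs' - zs‖ ≤ c := by
  have hω := S.ω_pos
  have hl := S.l_pos
  set m := min (ω / 2) (l / 2) with hm
  have hm0 : 0 < m := lt_min (by positivity) (by positivity)
  have m1 : m ≤ ω / 2 := min_le_left _ _
  have m2 : m ≤ l / 2 := min_le_right _ _
  have h1 := S.nearlyLinear zs' zs
  have h2 := hc zs'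
  rw [S'.rest, sub_zero] at h2
  rw [S.rest, sub_zero] at h1
  have h3 := le_norm_linSC (ω := ω) (l := l) (m := 2 * m) (by positivity) (by linarith)
    (by linarith) (zs' - zs)
  have h4 := norm_sub_norm_le (linSC ω l (zs' - zs)) (f zs')
  rw [norm_sub_rev] at h4
  have h5 : ε ≤ m := le_min (by linarith [S.ε_le_ω, S.ε_nonneg])
    (by linarith [S.ε_le_l, S.ε_nonneg])
  have h6 := mul_le_mul_of_nonneg_right h5 (norm_nonneg (zs' - zs))
  linarith

end IsSaddleCenterSystem

/-- A saddle-center system whose vector field depends on a parameter in a Lipschitz way. -/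
structure IsSaddleCenterFamily (ω l ε ρ L : ℝ) (I : Set ℝ) (f : ℝ → LiftedPhase → LiftedPhase)
    (h : ℝ → LiftedPhase → ℝ) (g : ℝ → LiftedPhase → LiftedPhase) (zs : ℝ → LiftedPhase) :
    Prop where
  system : ∀ e ∈ I, IsSaddleCenterSystem ω l ε ρ (f e) (h e) (g e) (zs e)
  lipschitz_param : ∀ e ∈ I, ∀ e' ∈ I, ∀ z, ‖f e z - f e' z‖ ≤ L * |e - e'|
  continuousOn_energy : ContinuousOn (Function.uncurry h) (I ×ˢ Metric.closedBall 0 ρ)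
  energy_neg : ∀ e ∈ I, h e (zs e) < 0
  energy_ge : ∀ e ∈ I, -(ρ ^ 2 / 196) ≤ h e (zs e)

namespace IsSaddleCenterFamily

variable {ω l ε ρ L : ℝ} {I : Set ℝ} {f : ℝ → LiftedPhase → LiftedPhase}
  {h : ℝ → LiftedPhase → ℝ} {g : ℝ → LiftedPhase → LiftedPhase} {zs : ℝ → LiftedPhase}

theorem continuousOn_rest (S : IsSaddleCenterFamily ω l ε ρ L I f h g zs) :
    ContinuousOn zs I := by
  intro e he
  have hω := (S.system e he).ω_pos
  have hl := (S.system e he).l_pos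
  have hm0 : 0 < min (ω / 2) (l / 2) := lt_min (by positivity) (by positivity)
  have key : ∀ e' ∈ I, ‖zs e' - zs e‖ ≤ L * |e - e'| / min (ω / 2) (l / 2) := fun e' he' => by
    rw [le_div_iff₀' hm0]
    exact (S.system e he).norm_rest_sub_le (S.system e' he') (S.lipschitz_param e he e' he')
  rw [ContinuousWithinAt, tendsto_iff_norm_sub_tendsto_zero]
  refine squeeze_zero' (Eventually.of_forall fun _ => norm_nonneg _)
    (eventually_mem_nhdsWithin.mono key) ?_
  have : Continuous fun e' => L * |e - e'| / min (ω / 2) (l / 2) := by fun_prop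
  have := this.tendsto e
  simp only [sub_self, abs_zero, mul_zero, zero_div] at this
  exact this.mono_left nhdsWithin_le_nhds

/-- Gronwall's estimate for trajectories at different parameters. -/
theorem dist_le (S : IsSaddleCenterFamily ω l ε ρ L I f h g zs) {e e' : ℝ} (he : e ∈ I)
    (he' : e' ∈ I) {γ γ' : ℝ → LiftedPhase} (hγ : IsTrajectory (f e) γ)
    (hγ' : IsTrajectory (f e') γ') (t : ℝ) :
    dist (γ' t) (γ t) ≤ dist (γ' 0) (γ 0) * Real.exp ((ω + l + ε) * |t|) +
      L * |e - e'| / (ω + l + ε) * (Real.exp ((ω + l + ε) * |t|) - 1) := by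
  have Se := S.system e he
  have hω := Se.ω_pos
  have hl := Se.l_pos
  have hε := Se.ε_nonneg
  have hpos : 0 < ω + l + ε := by positivity
  have := dist_trajectories_le Se.lipschitz (g := f e') (η := L * |e - e'|)
    (fun z => by rw [norm_sub_rev]; exact S.lipschitz_param e he e' he' z) hγ hγ' t
  rw [Real.coe_toNNReal _ hpos.le, gronwallBound_of_K_ne_0 hpos.ne', dist_comm,
    dist_comm (γ 0)] at this
  exact this

theorem tendsto_trajectory (S : IsSaddleCenterFamily ω l ε ρ L I f h g zs) {e₀ : ℝ} (he₀ : e₀ ∈ I)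
    {α : Type*} {F : Filter α} {e t : α → ℝ} {t₀ : ℝ} {Γ : α → ℝ → LiftedPhase}
    {γ₀ : ℝ → LiftedPhase} (hI : ∀ᶠ a in F, e a ∈ I) (he : Tendsto e F (𝓝 e₀))
    (ht : Tendsto t F (𝓝 t₀))
    (hΓ : ∀ᶠ a in F, IsTrajectory (f (e a)) (Γ a)) (h₀ : IsTrajectory (f e₀) γ₀)
    (h0 : Tendsto (fun a => Γ a 0) F (𝓝 (γ₀ 0))) :
    Tendsto (fun a => Γ a (t a)) F (𝓝 (γ₀ t₀)) := by
  rw [tendsto_iff_dist_tendsto_zero]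
  have hb : ∀ᶠ a in F, dist (Γ a (t a)) (γ₀ t₀) ≤
      (dist (Γ a 0) (γ₀ 0) * Real.exp ((ω + l + ε) * |t a|) +
      L * |e₀ - e a| / (ω + l + ε) * (Real.exp ((ω + l + ε) * |t a|) - 1)) +
      dist (γ₀ (t a)) (γ₀ t₀) := by
    filter_upwards [hI, hΓ] with a ha hΓa
    exact (dist_triangle _ (γ₀ (t a)) _).trans
      (add_le_add_left (S.dist_le he₀ ha h₀ hΓa (t a)) _)
  refine squeeze_zero' (Eventually.of_forall fun _ => dist_nonneg) hb ?_
  have l1 := tendsto_iff_dist_tendsto_zero.1 h0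
  have l2 : Tendsto (fun a => Real.exp ((ω + l + ε) * |t a|)) F
      (𝓝 (Real.exp ((ω + l + ε) * |t₀|))) :=
    (Real.continuous_exp.tendsto _).comp (ht.abs.const_mul _)
  have l3 : Tendsto (fun a => L * |e₀ - e a| / (ω + l + ε)) F (𝓝 0) := by
    have := (((tendsto_const_nhds (x := e₀)).sub he).abs.const_mul L).div_const (ω + l + ε)
    simpa using this
  have l4 := tendsto_iff_dist_tendsto_zero.1 ((h₀.continuous.tendsto t₀).comp ht)
  have := ((l1.mul l2).add (l3.mul (l2.sub_const 1))).add l4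
  simpa using this

/-- The symmetric zero energy trajectories and their periods depend continuously on the
parameter. -/
theorem exists_family (S : IsSaddleCenterFamily ω l ε ρ L I f h g zs) :
    ∃ (G : ℝ → ℝ → LiftedPhase) (P : ℝ → ℝ),
      ContinuousOn (Function.uncurry G) (I ×ˢ Set.univ) ∧ ContinuousOn P I ∧
      ∀ e ∈ I, IsTrajectory (f e) (G e) ∧ (∀ t, ‖G e t‖ ≤ ρ) ∧ h e (G e 0) = 0 ∧ G e 0 ≠ zs e ∧
        0 < P e ∧ (∀ t, G e (t + P e) = G e t) ∧
        ∀ T, 0 < T → G e T = G e 0 → ∃ k : ℕ, 1 ≤ k ∧ T = k * P e := by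
  classical
  have hex : ∀ e, ∃ γ : ℝ → LiftedPhase, e ∈ I → ∃ r ξ, IsTrajectory (f e) γ ∧ (∀ t, ‖γ t‖ ≤ ρ) ∧
      h e (γ 0) = 0 ∧ 0 < r ∧ γ 0 = IsSaddleCenterSystem.symPoint (zs e) r ξ := by
    intro e
    by_cases he : e ∈ I
    · obtain ⟨γ, hγ⟩ := (S.system e he).exists_zero_energy_trajectory (S.energy_neg e he)
        (S.energy_ge e he)
      exact ⟨γ, fun _ => hγ⟩
    · exact ⟨0, fun h => absurd h he⟩
  choose G hG using hex
  choose! r ξ hG hGρ hG0 hr hGs using hG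
  have hne : ∀ e ∈ I, G e 0 ≠ zs e := fun e he heq => by
    have h1 := hG0 e he
    have h2 := S.energy_neg e he
    rw [heq] at h1
    linarith
  have hper : ∀ e, ∃ P : ℝ, e ∈ I → P ∈ Set.Icc (8 * Real.pi / (5 * ω)) (8 * Real.pi / (3 * ω)) ∧
      (∀ t, G e (t + P) = G e t) ∧
      ∀ T, 0 < T → G e T = G e 0 → ∃ k : ℕ, 1 ≤ k ∧ T = k * P := by
    intro e
    by_cases he : e ∈ I
    · obtain ⟨P, h1, h2, h3⟩ := (S.system e he).exists_period (hG e he) (hGρ e he) (hne e he)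
      exact ⟨P, fun _ => ⟨h1, h2, h3⟩⟩
    · exact ⟨0, fun h => absurd h he⟩
  choose P hP using hper
  choose! hPI hPp hPm using hP
  have hpos : ∀ e ∈ I, 0 < P e := fun e he => by
    have := (S.system e he).ω_pos
    exact lt_of_lt_of_le (by positivity) (hPI e he).1
  have hstart : ContinuousOn (fun e => G e 0) I := by
    intro e₀ he₀
    have S₀ := S.system e₀ he₀
    refine tendsto_of_isCompact (isCompact_closedBall (0 : LiftedPhase) ρ)
      (eventually_mem_nhdsWithin.mono fun e he => by simpa using hGρ e he 0) ?_
    intro U hU y hy hlim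
    obtain ⟨γ, hγ0, hγ⟩ := S₀.exists_trajectory y
    have hUI : ∀ᶠ e in (U : Filter ℝ), e ∈ I := hU eventually_mem_nhdsWithin
    have hUe : Tendsto id (U : Filter ℝ) (𝓝 e₀) := hU.trans nhdsWithin_le_nhds
    have hbd : ∀ t, ‖γ t‖ ≤ ρ := fun t => by
      have := S.tendsto_trajectory he₀ (e := id) (t := fun _ => t) (Γ := G) hUI hUe
        tendsto_const_nhds (hUI.mono hG) hγ (by rwa [hγ0])
      exact le_of_tendsto this.norm (hUI.mono fun e he => hGρ e he t)
    have hE : h e₀ (γ 0) = 0 := by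
      have h1 : Tendsto (fun e => ((e, G e 0) : ℝ × LiftedPhase)) U
          (𝓝[I ×ˢ Metric.closedBall 0 ρ] (e₀, y)) := by
        refine tendsto_nhdsWithin_iff.2 ⟨hUe.prodMk_nhds hlim, hUI.mono fun e he => ⟨he, ?_⟩⟩
        simpa using hGρ e he 0
      have h2 := (S.continuousOn_energy (e₀, y) ⟨he₀, hy⟩).tendsto.comp h1
      have h3 : Tendsto (fun _ : ℝ => (0 : ℝ)) U (𝓝 (h e₀ y)) :=
        h2.congr' (hUI.mono fun e he => hG0 e he)
      rw [hγ0]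
      exact (tendsto_nhds_unique h3 tendsto_const_nhds)
    have hd : Tendsto (fun e => G e 0 - zs e) U (𝓝 (γ 0 - zs e₀)) := by
      rw [hγ0]
      exact hlim.sub ((S.continuousOn_rest e₀ he₀).tendsto.mono_left hU)
    have hdr : ∀ᶠ e in (U : Filter ℝ), G e 0 - zs e = !₂[0, r e, ξ e, ξ e] :=
      hUI.mono fun e he => by rw [hGs e he, IsSaddleCenterSystem.symPoint_sub]
    have c0 : (γ 0 - zs e₀) 0 = 0 := by
      have h1 := (continuous_coord 0).tendsto _ |>.comp hd
      refine tendsto_nhds_unique h1 (tendsto_const_nhds.congr' (hdr.mono fun e he => ?_))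
      simp [he]
    have c1 : 0 ≤ (γ 0 - zs e₀) 1 := by
      have h1 := (continuous_coord 1).tendsto _ |>.comp hd
      refine ge_of_tendsto h1 ((hdr.and hUI).mono fun e he => ?_)
      simp only [Function.comp_def, he.1]
      exact (hr e he.2).le
    have c1' : (γ 0 - zs e₀) 1 ≠ 0 := fun c1' => by
      have h1 := S₀.inCenterCone_sub_rest hγ hbd 0
      have h2 := h1.norm_sq_le
      rw [c0, c1'] at h2
      have h3 : γ 0 - zs e₀ = 0 := by
        rw [← norm_eq_zero]
        nlinarith [norm_nonneg (γ 0 - zs e₀)]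
      rw [sub_eq_zero] at h3
      have h4 := S.energy_neg e₀ he₀
      rw [← h3, hE] at h4
      exact lt_irrefl _ h4
    rw [← hγ0]
    refine S₀.eq_of_same_ray hγ (hG e₀ he₀) hbd (hGρ e₀ he₀) (by rw [hE, hG0 e₀ he₀])
      (s := 0) (t := 0) (lt_of_le_of_ne c1 (Ne.symm c1')) (hr e₀ he₀) (w := Complex.I) ?_ ?_
    · apply Complex.ext
      · simp [centerCoord] at c0 ⊢; exact c0
      · simp [centerCoord]
    · rw [hGs e₀ he₀, IsSaddleCenterSystem.symPoint_sub]
      apply Complex.ext <;> simp [centerCoord]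
  have hjoint : ContinuousOn (Function.uncurry G) (I ×ˢ Set.univ) := by
    rintro ⟨e₀, t₀⟩ ⟨he₀, -⟩
    have hI : ∀ᶠ a : ℝ × ℝ in 𝓝[I ×ˢ Set.univ] (e₀, t₀), a.1 ∈ I :=
      eventually_mem_nhdsWithin.mono fun a ha => ha.1
    have h1 : Tendsto Prod.fst (𝓝[I ×ˢ Set.univ] (e₀, t₀)) (𝓝 e₀) :=
      (continuous_fst.tendsto (e₀, t₀)).mono_left nhdsWithin_le_nhds
    refine S.tendsto_trajectory he₀ (e := Prod.fst) (t := Prod.snd) (Γ := fun a => G a.1) hI h1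
      ((continuous_snd.tendsto (e₀, t₀)).mono_left nhdsWithin_le_nhds) (hI.mono fun a ha => hG _ ha)
      (hG e₀ he₀) ?_
    exact (hstart e₀ he₀).tendsto.comp (tendsto_nhdsWithin_iff.2 ⟨h1, hI⟩)
  refine ⟨G, P, hjoint, ?_, fun e he => ⟨hG e he, hGρ e he, hG0 e he, hne e he, hpos e he,
    hPp e he, hPm e he⟩⟩
  intro e₀ he₀
  have S₀ := S.system e₀ he₀
  have hω := S₀.ω_pos
  have hpi := Real.pi_pos
  refine tendsto_of_isCompact isCompact_Icc (eventually_mem_nhdsWithin.mono hPI) ?_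
  intro U hU y hy hlim
  have hUI : ∀ᶠ e in (U : Filter ℝ), e ∈ I := hU eventually_mem_nhdsWithin
  have hUe : Tendsto id (U : Filter ℝ) (𝓝 e₀) := hU.trans nhdsWithin_le_nhds
  have hs : Tendsto (fun e => G e 0) (U : Filter ℝ) (𝓝 (G e₀ 0)) :=
    (hstart e₀ he₀).tendsto.mono_left hU
  have h1 := S.tendsto_trajectory he₀ (e := id) (t := P) (Γ := G) hUI hUe hlim (hUI.mono hG)
    (hG e₀ he₀) hs
  have h2 : G e₀ y = G e₀ 0 := by
    refine tendsto_nhds_unique h1 (hs.congr' (hUI.mono fun e he => ?_))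
    have := hPp e he 0
    rw [zero_add] at this
    exact this.symm
  obtain ⟨k, hk, hkP⟩ := hPm e₀ he₀ y (lt_of_lt_of_le (by positivity) hy.1) h2
  have hk2 : k < 2 := by
    by_contra hcon
    have h3 : (2 : ℝ) ≤ k := by exact_mod_cast not_lt.1 hcon
    have h4 := (hPI e₀ he₀).1
    have h5 := mul_le_mul h3 h4 (by positivity) (by positivity)
    rw [← hkP] at h5
    have h6 := h5.trans hy.2
    have h7 : 8 * Real.pi / (3 * ω) < 2 * (8 * Real.pi / (5 * ω)) := by
      rw [← mul_div_assoc, div_lt_div_iff₀ (by positivity) (by positivity)]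
      nlinarith [mul_pos hpi hω]
    linarith
  have : k = 1 := by omega
  rw [hkP, this]; simp

end IsSaddleCenterFamily

end CR3BP

namespace CR3BP

/-! ## Derivatives of the regularized Hamiltonian -/

/-- The partial derivative of the potential, as a polynomial in `C = cosh x₁` and `k = cos x₂`, with
respect to `C`. -/
def potentialC (μ E C k : ℝ) : ℝ :=
  -(E * C) / 2 - 1 / 2 - (2 * C ^ 3 - C) / 16
    - (1 - 2 * μ) * (k * (C ^ 2 - k ^ 2) + 2 * C * (1 / 2 - μ + C * k)) / 16

/-- The partial derivative of the potential, as a polynomial in `C = cosh x₁` and `k = cos x₂`, with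
respect to `k`. -/
def potentialK (μ E C k : ℝ) : ℝ :=
  E * k / 2 - (k - 2 * k ^ 3) / 16
    + (1 - 2 * μ) * (1 / 2 - (C * (C ^ 2 - k ^ 2) - 2 * k * (1 / 2 - μ + C * k)) / 16)

theorem regPotential_eq (μ E x₁ x₂ : ℝ) : regPotential μ E x₁ x₂ =
    -(E * Real.cosh x₁ ^ 2) / 4 - Real.cosh x₁ / 2 - (Real.cosh x₁ ^ 4 - Real.cosh x₁ ^ 2) / 32
    + E * Real.cos x₂ ^ 2 / 4 - (Real.cos x₂ ^ 2 - Real.cos x₂ ^ 4) / 32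
    + (1 - 2 * μ) * (Real.cos x₂ / 2
      - (1 / 2 - μ + Real.cosh x₁ * Real.cos x₂) * (Real.cosh x₁ ^ 2 - Real.cos x₂ ^ 2) / 16) := by
  unfold regPotential
  rw [Real.sinh_two_mul, Real.sin_two_mul, mul_pow, mul_pow, mul_pow, mul_pow, Real.sinh_sq,
    Real.sin_sq]
  ring

theorem hasDerivAt_regPotential (μ E : ℝ) {x₁ x₂ : ℝ → ℝ} {a b t : ℝ} (h₁ : HasDerivAt x₁ a t)
    (h₂ : HasDerivAt x₂ b t) : HasDerivAt (fun t => regPotential μ E (x₁ t) (x₂ t))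
      (potentialC μ E (Real.cosh (x₁ t)) (Real.cos (x₂ t)) * Real.sinh (x₁ t) * a
        - potentialK μ E (Real.cosh (x₁ t)) (Real.cos (x₂ t)) * Real.sin (x₂ t) * b) t := by
  simp only [regPotential_eq]
  have hC := h₁.cosh
  have hk := h₂.cos
  have key := ((((((hC.fun_pow 2).const_mul E).neg.div_const 4).sub (hC.div_const 2)).sub
    (((hC.fun_pow 4).sub (hC.fun_pow 2)).div_const 32)).add
    (((hk.fun_pow 2).const_mul E).div_const 4)).sub
    (((hk.fun_pow 2).sub (hk.fun_pow 4)).div_const 32) |>.add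
    (((hk.div_const 2).sub ((((hC.mul hk).const_add (1 / 2 - μ)).mul
      ((hC.fun_pow 2).sub (hk.fun_pow 2))).div_const 16)).const_mul (1 - 2 * μ))
  refine key.congr_deriv ?_
  simp only [potentialC, potentialK, Pi.sub_apply, Pi.mul_apply, Nat.cast_ofNat]
  ring

/-- The gradient of the regularized Hamiltonian. -/
def regGradient (μ E : ℝ) (z : LiftedPhase) : LiftedPhase :=
  !₂[z 0 + Real.sin (2 * z 3) / 8, z 1 + Real.sinh (2 * z 2) / 8,
    (z 1 + Real.sinh (2 * z 2) / 8) * (Real.cosh (2 * z 2) / 4)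
      + potentialC μ E (Real.cosh (z 2)) (Real.cos (z 3)) * Real.sinh (z 2),
    (z 0 + Real.sin (2 * z 3) / 8) * (Real.cos (2 * z 3) / 4)
      - potentialK μ E (Real.cosh (z 2)) (Real.cos (z 3)) * Real.sin (z 3)]

theorem hasDerivAt_regHamiltonian (μ E : ℝ) {z : ℝ → LiftedPhase} {z' : LiftedPhase} {t : ℝ}
    (hz : HasDerivAt z z' t) :
    HasDerivAt (fun t => regHamiltonian μ E (z t)) ⟪regGradient μ E (z t), z'⟫ t := by
  have h0 := hasDerivAt_coord hz 0
  have h1 := hasDerivAt_coord hz 1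
  have h2 := hasDerivAt_coord hz 2
  have h3 := hasDerivAt_coord hz 3
  have e0 := h0.add ((h3.const_mul 2).sin.div_const 8)
  have e1 := h1.add ((h2.const_mul 2).sinh.div_const 8)
  have key := (((e0.fun_pow 2).add (e1.fun_pow 2)).div_const 2).add
    (hasDerivAt_regPotential μ E h2 h3)
  refine key.congr_deriv ?_
  rw [inner_lifted]
  simp only [regGradient, Matrix.cons_val, Pi.add_apply, Nat.cast_ofNat]
  ring

theorem contDiff_coord {n : WithTop ℕ∞} (i : Fin 4) :
    ContDiff ℝ n fun z : LiftedPhase => z i :=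
  (EuclideanSpace.proj i : LiftedPhase →L[ℝ] ℝ).contDiff

theorem contDiff_regHamiltonian (μ E : ℝ) {n : WithTop ℕ∞} :
    ContDiff ℝ n (regHamiltonian μ E) := by
  have h0 := contDiff_coord (n := n) 0
  have h1 := contDiff_coord (n := n) 1
  have h2 := contDiff_coord (n := n) 2
  have h3 := contDiff_coord (n := n) 3
  unfold regHamiltonian regPotential
  fun_prop

/-- The gradient depends smoothly on the parameters. -/
theorem contDiff_regGradient {n : WithTop ℕ∞} :
    ContDiff ℝ n fun p : (ℝ × ℝ) × LiftedPhase => regGradient p.1.1 p.1.2 p.2 := by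
  have h0 := (contDiff_coord (n := n) 0).comp (contDiff_snd (E := ℝ × ℝ) (𝕜 := ℝ))
  have h1 := (contDiff_coord (n := n) 1).comp (contDiff_snd (E := ℝ × ℝ) (𝕜 := ℝ))
  have h2 := (contDiff_coord (n := n) 2).comp (contDiff_snd (E := ℝ × ℝ) (𝕜 := ℝ))
  have h3 := (contDiff_coord (n := n) 3).comp (contDiff_snd (E := ℝ × ℝ) (𝕜 := ℝ))
  simp only [Function.comp_def] at h0 h1 h2 h3
  refine contDiff_euclidean.2 fun i => ?_
  fin_cases i <;> simp [regGradient, potentialC, potentialK] <;> fun_prop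

theorem gradient_regHamiltonian (μ E : ℝ) (z : LiftedPhase) :
    gradient (regHamiltonian μ E) z = regGradient μ E z := by
  refine ext_inner_right ℝ fun v => ?_
  have hl : HasDerivAt (fun t : ℝ => z + t • v) v 0 := by
    simpa using ((hasDerivAt_id (0 : ℝ)).smul_const v).const_add z
  have h1 := hasDerivAt_regHamiltonian μ E hl
  have hd : DifferentiableAt ℝ (regHamiltonian μ E) (z + (0 : ℝ) • v) :=
    (contDiff_regHamiltonian μ E (n := 1)).differentiable one_ne_zero _
  have h2 := hd.hasFDerivAt.comp_hasDerivAt (0 : ℝ) hl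
  have h3 := h2.unique h1
  rw [zero_smul, add_zero] at h3
  rw [← h3, gradient, InnerProductSpace.toDual_symm_apply]

theorem contDiff_uncurry_regGradient (μ E : ℝ) {n : WithTop ℕ∞} :
    ContDiff ℝ n (regGradient μ E) :=
  ContDiff.comp (g := fun p : (ℝ × ℝ) × LiftedPhase => regGradient p.1.1 p.1.2 p.2)
    (f := fun z => ((μ, E), z)) contDiff_regGradient (contDiff_const.prodMk contDiff_id)

theorem hess_regHamiltonian (μ E : ℝ) (z : LiftedPhase) :
    hess (regHamiltonian μ E) z = fderiv ℝ (regGradient μ E) z := by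
  unfold hess
  rw [show gradient (regHamiltonian μ E) = regGradient μ E from
    funext (gradient_regHamiltonian μ E)]

/-- The Hessian depends continuously on the parameters. -/
theorem continuous_hess_regHamiltonian :
    Continuous fun p : (ℝ × ℝ) × LiftedPhase => hess (regHamiltonian p.1.1 p.1.2) p.2 := by
  simp only [hess_regHamiltonian]
  have h1 : ContDiff ℝ 1 (Function.uncurry fun (q : (ℝ × ℝ) × LiftedPhase) (z : LiftedPhase) =>
      regGradient q.1.1 q.1.2 z) :=
    ContDiff.comp (g := fun p : (ℝ × ℝ) × LiftedPhase => regGradient p.1.1 p.1.2 p.2)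
      (f := fun p : ((ℝ × ℝ) × LiftedPhase) × LiftedPhase => (p.1.1, p.2)) contDiff_regGradient
      ((contDiff_fst.comp contDiff_fst).prodMk contDiff_snd)
  exact (ContDiff.fderiv (m := 1) (n := 0) h1 contDiff_snd (by norm_num)).continuous

theorem hess_apply_eq {μ E : ℝ} {z v : LiftedPhase} {i : Fin 4} {d : ℝ}
    (h : HasDerivAt (fun t : ℝ => regGradient μ E (z + t • v) i) d 0) :
    hess (regHamiltonian μ E) z v i = d := by
  have hl : HasDerivAt (fun t : ℝ => z + t • v) v 0 := by
    simpa using ((hasDerivAt_id (0 : ℝ)).smul_const v).const_add z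
  have hd : DifferentiableAt ℝ (regGradient μ E) (z + (0 : ℝ) • v) :=
    (contDiff_uncurry_regGradient μ E (n := 1)).differentiable one_ne_zero _
  have h2 := hasDerivAt_coord (hd.hasFDerivAt.comp_hasDerivAt (0 : ℝ) hl) i
  rw [hess_regHamiltonian, ← h2.unique h, zero_smul, add_zero]

theorem hasDerivAt_line (z v : LiftedPhase) (i : Fin 4) :
    HasDerivAt (fun t : ℝ => (z + t • v) i) (v i) 0 := by
  have hl : HasDerivAt (fun t : ℝ => z + t • v) v 0 := by
    simpa using ((hasDerivAt_id (0 : ℝ)).smul_const v).const_add z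
  exact hasDerivAt_coord hl i

theorem hess_apply_zero (μ E : ℝ) (z v : LiftedPhase) :
    hess (regHamiltonian μ E) z v 0 = v 0 + Real.cos (2 * z 3) / 4 * v 3 := by
  refine hess_apply_eq ?_
  have key := (hasDerivAt_line z v 0).add
    (((hasDerivAt_line z v 3).const_mul 2).sin.div_const 8)
  refine key.congr_deriv ?_
  rw [zero_smul, add_zero]
  ring

theorem hess_apply_one (μ E : ℝ) (z v : LiftedPhase) :
    hess (regHamiltonian μ E) z v 1 = v 1 + Real.cosh (2 * z 2) / 4 * v 2 := by
  refine hess_apply_eq ?_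
  have key := (hasDerivAt_line z v 1).add
    (((hasDerivAt_line z v 2).const_mul 2).sinh.div_const 8)
  refine key.congr_deriv ?_
  rw [zero_smul, add_zero]
  ring

/-- The second derivative of the potential along the axis `x₁ = 0`. -/
def potentialKK (μ E k : ℝ) : ℝ :=
  E / 2 - (1 - 6 * k ^ 2) / 16 + (1 - 2 * μ) * (6 * k + (1 - 2 * μ)) / 16

theorem hess_apply_two {μ E : ℝ} {z : LiftedPhase} (v : LiftedPhase) (h1 : z 1 = 0) (h2 : z 2 = 0) :
    hess (regHamiltonian μ E) z v 2 =
      v 1 / 4 + (1 / 16 + potentialC μ E 1 (Real.cos (z 3))) * v 2 := by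
  refine hess_apply_eq ?_
  have e2 := hasDerivAt_line z v 2
  have hd : DifferentiableAt ℝ (fun t : ℝ => potentialC μ E (Real.cosh ((z + t • v) 2))
      (Real.cos ((z + t • v) 3))) 0 := by
    have e2' := e2.cosh.differentiableAt
    have e3' := (hasDerivAt_line z v 3).cos.differentiableAt
    unfold potentialC
    fun_prop
  have key := (((hasDerivAt_line z v 1).add ((e2.const_mul 2).sinh.div_const 8)).mul
    ((e2.const_mul 2).cosh.div_const 4)).add (hd.hasDerivAt.mul e2.sinh)
  refine key.congr_deriv ?_
  simp only [zero_smul, add_zero, h1, h2, mul_zero, Real.sinh_zero, Real.cosh_zero, zero_div,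
    Pi.add_apply]
  ring

theorem hess_apply_three {μ E : ℝ} {z : LiftedPhase} (v : LiftedPhase) (h2 : z 2 = 0)
    (h0 : z 0 + Real.sin (2 * z 3) / 8 = 0) (hk : potentialK μ E 1 (Real.cos (z 3)) = 0) :
    hess (regHamiltonian μ E) z v 3 =
      Real.cos (2 * z 3) / 4 * (v 0 + Real.cos (2 * z 3) / 4 * v 3)
        + potentialKK μ E (Real.cos (z 3)) * Real.sin (z 3) ^ 2 * v 3 := by
  refine hess_apply_eq ?_
  have e0 := hasDerivAt_line z v 0
  have e2 := hasDerivAt_line z v 2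
  have e3 := hasDerivAt_line z v 3
  have hC := e2.cosh
  have hc := e3.cos
  have hK := (((hc.const_mul E).div_const 2).sub ((hc.sub ((hc.fun_pow 3).const_mul 2)).div_const
    16)).add (((((hC.mul ((hC.fun_pow 2).sub (hc.fun_pow 2))).sub ((hc.const_mul 2).mul
      ((hC.mul hc).const_add (1 / 2 - μ)))).div_const 16).const_sub (1 / 2)).const_mul (1 - 2 * μ))
  have key := ((e0.add ((e3.const_mul 2).sin.div_const 8)).mul
    ((e3.const_mul 2).cos.div_const 4)).sub (hK.mul e3.sin)
  refine key.congr_deriv ?_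
  simp only [potentialK, one_pow, one_mul] at hk
  simp only [zero_smul, add_zero, h2, Real.sinh_zero, Real.cosh_zero,
    Pi.add_apply, Pi.sub_apply, Pi.mul_apply, h0, potentialKK, Nat.cast_ofNat]
  linear_combination (-(Real.cos (z 3)) * v 3) * hk

end CR3BP

namespace CR3BP

/-! ## The first Lagrange point -/

section

variable {μ : ℝ}

theorem firstLagrangeRadius_mem (h0 : 0 < μ) (h1 : μ < 1) :
    firstLagrangeRadius μ ∈ Set.Ioo (0 : ℝ) 1 :=
  ⟨(firstLagrangeRadius_spec h0 h1).1, (firstLagrangeRadius_spec h0 h1).2.1⟩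

theorem isFirstLagrangeRadius_polynomial {r : ℝ} (hr0 : 0 < r) (hr1 : r < 1) :
    ((1 - μ) / (1 - r) ^ 2 - μ / r ^ 2 = 1 - μ - r ↔
      (1 - μ) * r ^ 2 - μ * (1 - r) ^ 2 - (1 - μ - r) * (r ^ 2 * (1 - r) ^ 2) = 0) := by
  have e1 : r ≠ 0 := hr0.ne'
  have e2 : (1 - r) ≠ 0 := by linarith
  rw [div_sub_div _ _ (pow_ne_zero 2 e2) (pow_ne_zero 2 e1),
    div_eq_iff (mul_ne_zero (pow_ne_zero 2 e2) (pow_ne_zero 2 e1))]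
  constructor <;> intro h <;> linarith

theorem firstLagrangeRadius_polynomial (h0 : 0 < μ) (h1 : μ < 1) :
    (1 - μ) * firstLagrangeRadius μ ^ 2 - μ * (1 - firstLagrangeRadius μ) ^ 2
      - (1 - μ - firstLagrangeRadius μ) *
        (firstLagrangeRadius μ ^ 2 * (1 - firstLagrangeRadius μ) ^ 2) = 0 := by
  obtain ⟨hr0, hr1, hr⟩ := firstLagrangeRadius_spec h0 h1
  exact (isFirstLagrangeRadius_polynomial hr0 hr1).1 hr

theorem firstLagrangeValue_eq (h0 : 0 < μ) (h1 : μ < 1) :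
    firstLagrangeValue μ = -(μ / firstLagrangeRadius μ) - (1 - μ) / (1 - firstLagrangeRadius μ)
      - (1 - μ - firstLagrangeRadius μ) ^ 2 / 2 := by
  obtain ⟨hr0, hr1⟩ := firstLagrangeRadius_mem h0 h1
  unfold firstLagrangeValue rotHamiltonian firstLagrangePosition
  set r := firstLagrangeRadius μ with hr
  have n1 : ‖-Complex.I * ((1 - μ - r : ℝ) : ℂ) + Complex.I * ((1 - μ - r : ℝ) : ℂ)‖ = 0 := by
    rw [neg_mul, neg_add_cancel, norm_zero]
  have n2 : ‖((1 - μ - r : ℝ) : ℂ) - (1 - μ)‖ = r := by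
    rw [show ((1 - μ - r : ℝ) : ℂ) - (1 - μ) = ((-r : ℝ) : ℂ) by push_cast; ring,
      Complex.norm_real, norm_neg, Real.norm_of_nonneg hr0.le]
  have n3 : ‖((1 - μ - r : ℝ) : ℂ) + μ‖ = 1 - r := by
    rw [show ((1 - μ - r : ℝ) : ℂ) + μ = ((1 - r : ℝ) : ℂ) by push_cast; ring,
      Complex.norm_real, Real.norm_of_nonneg (by linarith)]
  have n4 : ‖((1 - μ - r : ℝ) : ℂ)‖ ^ 2 = (1 - μ - r) ^ 2 := by
    rw [Complex.norm_real, Real.norm_eq_abs, sq_abs]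
  rw [n1, n2, n3, n4]
  ring

/-- The curvature `μ / r³ + (1 - μ) / (1 - r)³` of the attraction at the first Lagrange point. -/
def lagrangeCurvature (μ : ℝ) : ℝ :=
  μ / firstLagrangeRadius μ ^ 3 + (1 - μ) / (1 - firstLagrangeRadius μ) ^ 3

theorem one_lt_lagrangeCurvature (h0 : 0 < μ) (h1 : μ < 1) : 1 < lagrangeCurvature μ := by
  obtain ⟨hr0, hr1⟩ := firstLagrangeRadius_mem h0 h1
  unfold lagrangeCurvature
  set r := firstLagrangeRadius μ
  have i1 : μ < μ / r ^ 3 := by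
    rw [lt_div_iff₀ (by positivity)]
    have : r ^ 3 < 1 := pow_lt_one₀ hr0.le hr1 (by norm_num)
    nlinarith
  have i2 : 1 - μ < (1 - μ) / (1 - r) ^ 3 := by
    rw [lt_div_iff₀ (pow_pos (by linarith) 3)]
    have : (1 - r) ^ 3 < 1 := pow_lt_one₀ (by linarith) (by linarith) (by norm_num)
    nlinarith
  linarith

/-- The defect of the equation of the first Lagrange point. -/
def lagrangeDefect (μ : ℝ) : ℝ :=
  (1 - μ) / (1 - firstLagrangeRadius μ) ^ 2 - μ / firstLagrangeRadius μ ^ 2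
    - (1 - μ - firstLagrangeRadius μ)

theorem lagrangeDefect_eq (h0 : 0 < μ) (h1 : μ < 1) : lagrangeDefect μ = 0 :=
  sub_eq_zero.2 (firstLagrangeRadius_spec h0 h1).2.2

theorem potentialK_lagrange (h0 : 0 < μ) (h1 : μ < 1) :
    potentialK μ (firstLagrangeValue μ) 1 (1 - 2 * firstLagrangeRadius μ) = 0 := by
  obtain ⟨hr0, hr1⟩ := firstLagrangeRadius_mem h0 h1
  have key : potentialK μ (firstLagrangeValue μ) 1 (1 - 2 * firstLagrangeRadius μ) =
      firstLagrangeRadius μ * (1 - firstLagrangeRadius μ) / 2 * lagrangeDefect μ := by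
    rw [firstLagrangeValue_eq h0 h1]
    unfold potentialK lagrangeDefect
    set r := firstLagrangeRadius μ
    have e2 : 1 - r ≠ 0 := by linarith
    field_simp
    ring
  rw [key, lagrangeDefect_eq h0 h1, mul_zero]

theorem potentialC_lagrange (h0 : 0 < μ) (h1 : μ < 1) :
    potentialC μ (firstLagrangeValue μ) 1 (1 - 2 * firstLagrangeRadius μ) =
      (firstLagrangeRadius μ * (1 - firstLagrangeRadius μ)) ^ 2 * (lagrangeCurvature μ - 1) := by
  obtain ⟨hr0, hr1⟩ := firstLagrangeRadius_mem h0 h1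
  have key : potentialC μ (firstLagrangeValue μ) 1 (1 - 2 * firstLagrangeRadius μ) =
      (firstLagrangeRadius μ * (1 - firstLagrangeRadius μ)) ^ 2 * (lagrangeCurvature μ - 1) +
      firstLagrangeRadius μ * (1 - firstLagrangeRadius μ) * (1 - 2 * firstLagrangeRadius μ) / 2 *
        lagrangeDefect μ := by
    rw [firstLagrangeValue_eq h0 h1]
    unfold lagrangeCurvature potentialC lagrangeDefect
    set r := firstLagrangeRadius μ
    have e2 : 1 - r ≠ 0 := by linarith
    field_simp
    ring
  rw [key, lagrangeDefect_eq h0 h1, mul_zero, add_zero]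

theorem potentialKK_lagrange (h0 : 0 < μ) (h1 : μ < 1) :
    potentialKK μ (firstLagrangeValue μ) (1 - 2 * firstLagrangeRadius μ) *
      (4 * (firstLagrangeRadius μ * (1 - firstLagrangeRadius μ))) =
      -((firstLagrangeRadius μ * (1 - firstLagrangeRadius μ)) ^ 2 *
        (2 * lagrangeCurvature μ + 1)) := by
  obtain ⟨hr0, hr1⟩ := firstLagrangeRadius_mem h0 h1
  have key : potentialKK μ (firstLagrangeValue μ) (1 - 2 * firstLagrangeRadius μ) *
      (4 * (firstLagrangeRadius μ * (1 - firstLagrangeRadius μ))) =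
      -((firstLagrangeRadius μ * (1 - firstLagrangeRadius μ)) ^ 2 *
        (2 * lagrangeCurvature μ + 1)) -
      2 * (firstLagrangeRadius μ * (1 - firstLagrangeRadius μ)) *
        (1 - 2 * firstLagrangeRadius μ) * lagrangeDefect μ := by
    rw [firstLagrangeValue_eq h0 h1]
    unfold lagrangeCurvature potentialKK lagrangeDefect
    set r := firstLagrangeRadius μ
    have e2 : 1 - r ≠ 0 := by linarith
    field_simp
    ring
  rw [key, lagrangeDefect_eq h0 h1, mul_zero, sub_zero]

theorem tendsto_firstLagrangeRadius (h0 : 0 < μ) (h1 : μ < 1) :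
    Tendsto firstLagrangeRadius (𝓝 μ) (𝓝 (firstLagrangeRadius μ)) := by
  have hnear : ∀ᶠ m in 𝓝 μ, 0 < m ∧ m < 1 := Ioo_mem_nhds h0 h1
  refine tendsto_of_isCompact (isCompact_Icc (a := (0 : ℝ)) (b := 1))
    (hnear.mono fun m hm => Set.Ioo_subset_Icc_self (firstLagrangeRadius_mem hm.1 hm.2)) ?_
  intro U hU y hy hlim
  have hUm : Tendsto id (U : Filter ℝ) (𝓝 μ) := hU
  have hUn : ∀ᶠ m in (U : Filter ℝ), 0 < m ∧ m < 1 := hU hnear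
  have hpair := hUm.prodMk_nhds hlim
  have hc : Continuous fun p : ℝ × ℝ =>
      (1 - p.1) * p.2 ^ 2 - p.1 * (1 - p.2) ^ 2 - (1 - p.1 - p.2) * (p.2 ^ 2 * (1 - p.2) ^ 2) := by
    fun_prop
  have hp : (1 - μ) * y ^ 2 - μ * (1 - y) ^ 2 - (1 - μ - y) * (y ^ 2 * (1 - y) ^ 2) = 0 := by
    refine tendsto_nhds_unique ((hc.tendsto (μ, y)).comp hpair)
      (tendsto_const_nhds.congr' (hUn.mono fun m hm => ?_))
    exact (firstLagrangeRadius_polynomial hm.1 hm.2).symm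
  have hy0 : 0 < y := lt_of_le_of_ne hy.1 fun h => by
    rw [← h] at hp
    norm_num at hp
    linarith
  have hy1 : y < 1 := lt_of_le_of_ne hy.2 fun h => by
    rw [h] at hp
    norm_num at hp
    linarith
  exact (existsUnique_firstLagrangeRadius h0 h1).unique
    ⟨hy0, hy1, (isFirstLagrangeRadius_polynomial hy0 hy1).2 hp⟩ (firstLagrangeRadius_spec h0 h1)

theorem tendsto_firstLagrangeValue (h0 : 0 < μ) (h1 : μ < 1) :
    Tendsto firstLagrangeValue (𝓝 μ) (𝓝 (firstLagrangeValue μ)) := by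
  have hnear : ∀ᶠ m in 𝓝 μ, 0 < m ∧ m < 1 := Ioo_mem_nhds h0 h1
  obtain ⟨hr0, hr1⟩ := firstLagrangeRadius_mem h0 h1
  have hr := tendsto_firstLagrangeRadius h0 h1
  have hid : Tendsto (fun m : ℝ => m) (𝓝 μ) (𝓝 μ) := tendsto_id
  rw [firstLagrangeValue_eq h0 h1]
  refine Tendsto.congr' (hnear.mono fun m hm => (firstLagrangeValue_eq hm.1 hm.2).symm) ?_
  exact (((hid.div hr hr0.ne').neg.sub ((hid.const_sub 1).div (hr.const_sub 1)
    (by linarith))).sub ((((hid.const_sub 1).sub hr).pow 2).div_const 2))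

/-! ## The saddle-center -/

theorem saddleCenter_zero_apply (μ σ : ℝ) : saddleCenter μ σ 0 =
    -(Real.sin (2 * (σ * Real.arccos (1 - 2 * firstLagrangeRadius μ))) / 8) := rfl

theorem saddleCenter_one_apply (μ σ : ℝ) : saddleCenter μ σ 1 = 0 := rfl

theorem saddleCenter_two_apply (μ σ : ℝ) : saddleCenter μ σ 2 = 0 := rfl

theorem saddleCenter_three_apply (μ σ : ℝ) :
    saddleCenter μ σ 3 = σ * Real.arccos (1 - 2 * firstLagrangeRadius μ) := rfl

theorem tendsto_saddleCenter (h0 : 0 < μ) (h1 : μ < 1) (σ : ℝ) :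
    Tendsto (fun m => saddleCenter m σ) (𝓝 μ) (𝓝 (saddleCenter μ σ)) := by
  have hr := tendsto_firstLagrangeRadius h0 h1
  have hc : Continuous fun r : ℝ => (!₂[-(Real.sin (2 * (σ * Real.arccos (1 - 2 * r))) / 8), 0, 0,
      σ * Real.arccos (1 - 2 * r)] : LiftedPhase) := by
    have ha := Real.continuous_arccos
    refine (PiLp.continuous_toLp 2 _).comp (continuous_pi fun i => ?_)
    fin_cases i <;> simp <;> fun_prop
  exact (hc.tendsto _).comp hr

theorem cos_saddleCenter (h0 : 0 < μ) (h1 : μ < 1) {σ : ℝ} (hσ : σ = 1 ∨ σ = -1) :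
    Real.cos (saddleCenter μ σ 3) = 1 - 2 * firstLagrangeRadius μ := by
  obtain ⟨hr0, hr1⟩ := firstLagrangeRadius_mem h0 h1
  rw [saddleCenter_three_apply]
  rcases hσ with rfl | rfl
  · rw [one_mul, Real.cos_arccos (by linarith) (by linarith)]
  · rw [neg_one_mul, Real.cos_neg, Real.cos_arccos (by linarith) (by linarith)]

theorem sin_sq_saddleCenter (h0 : 0 < μ) (h1 : μ < 1) {σ : ℝ} (hσ : σ = 1 ∨ σ = -1) :
    Real.sin (saddleCenter μ σ 3) ^ 2 =
      4 * (firstLagrangeRadius μ * (1 - firstLagrangeRadius μ)) := by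
  rw [Real.sin_sq, cos_saddleCenter h0 h1 hσ]
  ring

theorem saddleCenter_zero_add (μ σ : ℝ) :
    saddleCenter μ σ 0 + Real.sin (2 * saddleCenter μ σ 3) / 8 = 0 := by
  rw [saddleCenter_zero_apply, saddleCenter_three_apply, neg_add_cancel]

theorem gradient_saddleCenter (h0 : 0 < μ) (h1 : μ < 1) {σ : ℝ} (hσ : σ = 1 ∨ σ = -1) :
    gradient (regHamiltonian μ (firstLagrangeValue μ)) (saddleCenter μ σ) = 0 := by
  rw [gradient_regHamiltonian]
  have hk := potentialK_lagrange h0 h1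
  rw [← cos_saddleCenter h0 h1 hσ] at hk
  apply lifted_ext <;>
    simp [regGradient, saddleCenter_zero_add, saddleCenter_one_apply, saddleCenter_two_apply, hk]

/-- At a point of the symmetry plane the Hamiltonian depends on the energy through the potential. -/
theorem regHamiltonian_saddleCenter (h0 : 0 < μ) (h1 : μ < 1) (E : ℝ) {σ : ℝ}
    (hσ : σ = 1 ∨ σ = -1) : regHamiltonian μ E (saddleCenter μ σ) =
      firstLagrangeRadius μ * (1 - firstLagrangeRadius μ) * (firstLagrangeValue μ - E) := by
  obtain ⟨hr0, hr1⟩ := firstLagrangeRadius_mem h0 h1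
  have hc := cos_saddleCenter h0 h1 hσ
  unfold regHamiltonian
  rw [saddleCenter_zero_add, regPotential_eq, hc, saddleCenter_one_apply, saddleCenter_two_apply,
    firstLagrangeValue_eq h0 h1, Real.cosh_zero, mul_zero, Real.sinh_zero]
  set r := firstLagrangeRadius μ
  have e2 : 1 - r ≠ 0 := by linarith
  field_simp
  ring

/-- The transverse curvature of the potential at the saddle-center. -/
def curvatureB (μ : ℝ) : ℝ :=
  (firstLagrangeRadius μ * (1 - firstLagrangeRadius μ)) ^ 2 * (lagrangeCurvature μ - 1)

/-- The opposite of the curvature of the potential at the saddle-center along the axis `x₁ = 0`. -/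
def curvatureV (μ : ℝ) : ℝ :=
  (firstLagrangeRadius μ * (1 - firstLagrangeRadius μ)) ^ 2 * (2 * lagrangeCurvature μ + 1)

/-- The gyroscopic coefficient at the saddle-center. -/
def gyration (μ : ℝ) : ℝ := 2 * (firstLagrangeRadius μ * (1 - firstLagrangeRadius μ))

theorem radius_mul_pos (h0 : 0 < μ) (h1 : μ < 1) :
    0 < firstLagrangeRadius μ * (1 - firstLagrangeRadius μ) := by
  obtain ⟨hr0, hr1⟩ := firstLagrangeRadius_mem h0 h1
  exact mul_pos hr0 (by linarith)

theorem curvatureB_pos (h0 : 0 < μ) (h1 : μ < 1) : 0 < curvatureB μ :=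
  mul_pos (pow_pos (radius_mul_pos h0 h1) 2) (by linarith [one_lt_lagrangeCurvature h0 h1])

theorem curvatureV_pos (h0 : 0 < μ) (h1 : μ < 1) : 0 < curvatureV μ :=
  mul_pos (pow_pos (radius_mul_pos h0 h1) 2) (by linarith [one_lt_lagrangeCurvature h0 h1])

theorem gyration_pos (h0 : 0 < μ) (h1 : μ < 1) : 0 < gyration μ :=
  mul_pos two_pos (radius_mul_pos h0 h1)

/-- The Hessian at a saddle-center with curvatures `b`, `-v` and gyration `g`. -/
def saddleHess (b v g : ℝ) (z : LiftedPhase) : LiftedPhase :=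
  !₂[z 0 + (1 / 4 - g) * z 3, z 1 + z 2 / 4, z 1 / 4 + (1 / 16 + b) * z 2,
    (1 / 4 - g) * (z 0 + (1 / 4 - g) * z 3) - v * z 3]

theorem hess_saddleCenter (h0 : 0 < μ) (h1 : μ < 1) {σ : ℝ} (hσ : σ = 1 ∨ σ = -1)
    (z : LiftedPhase) :
    hess (regHamiltonian μ (firstLagrangeValue μ)) (saddleCenter μ σ) z =
      saddleHess (curvatureB μ) (curvatureV μ) (gyration μ) z := by
  have hc := cos_saddleCenter h0 h1 hσ
  have hk := potentialK_lagrange h0 h1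
  rw [← hc] at hk
  have h2 : Real.cos (2 * saddleCenter μ σ 3) / 4 = 1 / 4 - gyration μ := by
    rw [Real.cos_two_mul, hc, gyration]; ring
  apply lifted_ext
  · rw [hess_apply_zero, h2]; rfl
  · rw [hess_apply_one, saddleCenter_two_apply, mul_zero, Real.cosh_zero]
    simp [saddleHess]; ring
  · rw [hess_apply_two _ (saddleCenter_one_apply μ σ) (saddleCenter_two_apply μ σ), hc,
      potentialC_lagrange h0 h1]
    rfl
  · rw [hess_apply_three _ (saddleCenter_two_apply μ σ) (saddleCenter_zero_add μ σ) hk, h2, hc,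
      sin_sq_saddleCenter h0 h1 hσ, potentialKK_lagrange h0 h1]
    simp [saddleHess, curvatureV]; ring

end

end CR3BP

namespace CR3BP

/-! ## The linear normal form at the saddle-center -/

/-- The time-reversing symmetry of the regularized problem. -/
def reversor (z : LiftedPhase) : LiftedPhase := !₂[z 0, -z 1, -z 2, z 3]

/-- A basis of eigenvectors at the saddle-center. -/
def eigenMap (g ω l κ k m : ℝ) : LiftedPhase →ₗ[ℝ] LiftedPhase where
  toFun w := !₂[-(ω * w 1) - l * k * m * (w 2 + w 3) - (1 / 4 - g) * (κ * w 1 + m * (w 2 + w 3)),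
    ω * κ * w 0 + l * m * (w 2 - w 3) - (w 0 - m * k * (w 2 - w 3)) / 4,
    w 0 - m * k * (w 2 - w 3), κ * w 1 + m * (w 2 + w 3)]
  map_add' v w := by apply lifted_ext <;> simp <;> ring
  map_smul' r w := by apply lifted_ext <;> simp <;> ring

theorem eigenMap_apply (g ω l κ k m : ℝ) (w : LiftedPhase) : eigenMap g ω l κ k m w =
    !₂[-(ω * w 1) - l * k * m * (w 2 + w 3) - (1 / 4 - g) * (κ * w 1 + m * (w 2 + w 3)),
    ω * κ * w 0 + l * m * (w 2 - w 3) - (w 0 - m * k * (w 2 - w 3)) / 4,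
    w 0 - m * k * (w 2 - w 3), κ * w 1 + m * (w 2 + w 3)] := rfl

theorem eigenMap_refl (g ω l κ k m : ℝ) (w : LiftedPhase) :
    eigenMap g ω l κ k m (refl w) = reversor (eigenMap g ω l κ k m w) := by
  rw [eigenMap_apply, eigenMap_apply]
  apply lifted_ext <;> simp only [reversor, Matrix.cons_val, refl_zero_apply, refl_one_apply,
    refl_two_apply, refl_three_apply] <;> ring

section

variable {b v g ω l κ k m : ℝ}

theorem stdJ_saddleHess_eigenMap (e₁ : ω ^ 2 - b = g * ω * κ) (e₂ : κ * (ω ^ 2 + v) = g * ω)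
    (e₃ : v - l ^ 2 = g * l * k) (e₄ : k * (l ^ 2 + b) = g * l) (w : LiftedPhase) :
    stdJ (saddleHess b v g (eigenMap g ω l κ k m w)) = eigenMap g ω l κ k m (linSC ω l w) := by
  rw [eigenMap_apply, eigenMap_apply]
  apply lifted_ext
  · simp [saddleHess]
    linear_combination w 0 * e₁ + m * (w 2 - w 3) * e₄
  · simp [saddleHess]
    linear_combination w 1 * e₂ + m * (w 2 + w 3) * e₃
  · simp [saddleHess]; ring
  · simp [saddleHess]; ring

theorem inner_saddleHess_eigenMap {a : ℝ} (e₁ : a = b + ω ^ 2 * κ ^ 2)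
    (e₂ : a = ω ^ 2 - v * κ ^ 2) (e₃ : ω * κ * l = b * k) (e₄ : ω * l * k = v * κ)
    (e₅ : 2 * m ^ 2 * (l ^ 2 + b * k ^ 2) = a) (e₆ : 2 * m ^ 2 * (v - l ^ 2 * k ^ 2) = a)
    (w w' : LiftedPhase) :
    ⟪saddleHess b v g (eigenMap g ω l κ k m w), eigenMap g ω l κ k m w'⟫ =
      a * ⟪quadSC w, w'⟫ := by
  rw [eigenMap_apply, eigenMap_apply, inner_lifted, inner_lifted]
  simp only [saddleHess, Matrix.cons_val, quadSC_zero_apply, quadSC_one_apply, quadSC_two_apply,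
    quadSC_three_apply]
  linear_combination (-(w 0 * w' 0)) * e₁ - w 1 * w' 1 * e₂
    + m * (w 0 * (w' 2 - w' 3) + w' 0 * (w 2 - w 3)) * e₃
    + m * (w 1 * (w' 2 + w' 3) + w' 1 * (w 2 + w 3)) * e₄
    + (w 2 - w 3) * (w' 2 - w' 3) / 2 * e₅ - (w 2 + w 3) * (w' 2 + w' 3) / 2 * e₆

theorem exists_eigenvalues (hb : 0 < b) (hv : 0 < v) (hg : 0 < g) : ∃ ω l κ k : ℝ, 0 < ω ∧ 0 < l ∧
    0 < κ ∧ 0 < k ∧ ω ^ 2 - b = g * ω * κ ∧ κ * (ω ^ 2 + v) = g * ω ∧ v - l ^ 2 = g * l * k ∧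
    k * (l ^ 2 + b) = g * l ∧ ω * κ * l = b * k ∧ ω * l * k = v * κ := by
  set B := b - v + g ^ 2 with hB
  have hbv := mul_pos hb hv
  set D := Real.sqrt (B ^ 2 + 4 * (b * v)) with hD
  have hD2 : D ^ 2 = B ^ 2 + 4 * (b * v) := Real.sq_sqrt (by positivity)
  have hBD : -B < D := by
    refine lt_of_abs_lt ?_
    rw [← sq_lt_sq₀ (abs_nonneg _) (Real.sqrt_nonneg _), sq_abs, hD2]
    nlinarith
  set ω := Real.sqrt ((B + D) / 2) with hω
  have hω0 : 0 < ω := Real.sqrt_pos.2 (by linarith)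
  have hω2 : ω ^ 2 = (B + D) / 2 := Real.sq_sqrt (by linarith)
  have hX : (ω ^ 2 - b) * (ω ^ 2 + v) = g ^ 2 * ω ^ 2 := by
    rw [hω2]
    linear_combination hD2 / 4 + (B + D) / 2 * hB
  obtain ⟨l, hl0, hl2⟩ : ∃ l, 0 < l ∧ l ^ 2 * ω ^ 2 = b * v := by
    refine ⟨Real.sqrt (b * v) / ω, div_pos (Real.sqrt_pos.2 hbv) hω0, ?_⟩
    rw [div_pow, div_mul_cancel₀ _ (by positivity), Real.sq_sqrt hbv.le]
  have hY : (v - l ^ 2) * (l ^ 2 + b) = g ^ 2 * l ^ 2 := by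
    have h4 : ω ^ 4 ≠ 0 := by positivity
    apply mul_left_cancel₀ h4
    linear_combination (b * v) * hX + ((v - b - g ^ 2) * ω ^ 2 - l ^ 2 * ω ^ 2 - b * v) * hl2
  have p1 : 0 < ω ^ 2 + v := by positivity
  have p2 : 0 < l ^ 2 + b := by positivity
  obtain ⟨κ, hκ0, hκ⟩ : ∃ κ, 0 < κ ∧ κ * (ω ^ 2 + v) = g * ω :=
    ⟨g * ω / (ω ^ 2 + v), by positivity, div_mul_cancel₀ _ p1.ne'⟩
  obtain ⟨k, hk0, hk⟩ : ∃ k, 0 < k ∧ k * (l ^ 2 + b) = g * l :=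
    ⟨g * l / (l ^ 2 + b), by positivity, div_mul_cancel₀ _ p2.ne'⟩
  refine ⟨ω, l, κ, k, hω0, hl0, hκ0, hk0, ?_, hκ, ?_, hk, ?_, ?_⟩
  · apply mul_right_cancel₀ p1.ne'
    linear_combination hX - g * ω * hκ
  · apply mul_right_cancel₀ p2.ne'
    linear_combination hY - g * l * hk
  · apply mul_right_cancel₀ (mul_pos p1 p2).ne'
    linear_combination ω * l * (l ^ 2 + b) * hκ - b * (ω ^ 2 + v) * hk + g * l * hl2
  · apply mul_right_cancel₀ (mul_pos p1 p2).ne'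
    linear_combination ω * l * (ω ^ 2 + v) * hk - v * (l ^ 2 + b) * hκ + g * ω * hl2

/-- The normal form of the quadratic part at the saddle-center. -/
theorem exists_normalForm (hb : 0 < b) (hv : 0 < v) (hg : 0 < g) :
    ∃ (ω l a : ℝ) (Θ : LiftedPhase ≃L[ℝ] LiftedPhase), 0 < ω ∧ 0 < l ∧ 0 < a ∧
      (∀ w, stdJ (saddleHess b v g (Θ w)) = Θ (linSC ω l w)) ∧
      (∀ w w', ⟪saddleHess b v g (Θ w), Θ w'⟫ = a * ⟪quadSC w, w'⟫) ∧
      ∀ w, Θ (refl w) = reversor (Θ w) := by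
  obtain ⟨ω, l, κ, k, hω, hl, hκ, hk, e₁, e₂, e₃, e₄, e₅, e₆⟩ := exists_eigenvalues hb hv hg
  set a := b + ω ^ 2 * κ ^ 2 with ha
  have ha0 : 0 < a := by positivity
  have hp : 0 < l ^ 2 + b * k ^ 2 := by positivity
  set m := Real.sqrt (a / (2 * (l ^ 2 + b * k ^ 2))) with hm
  have hm2 : m ^ 2 = a / (2 * (l ^ 2 + b * k ^ 2)) := Real.sq_sqrt (by positivity)
  have f₅ : 2 * m ^ 2 * (l ^ 2 + b * k ^ 2) = a := by
    rw [hm2]; field_simp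
  have f₆ : 2 * m ^ 2 * (v - l ^ 2 * k ^ 2) = a := by
    rw [← f₅]
    linear_combination (2 * m ^ 2) * (e₃ - k * e₄)
  have f₂ : a = ω ^ 2 - v * κ ^ 2 := by
    linear_combination ha - e₁ + κ * e₂
  have hin := inner_saddleHess_eigenMap (g := g) (m := m) ha f₂ e₅ e₆ f₅ f₆
  have hinj : Function.Injective (eigenMap g ω l κ k m) := by
    rw [injective_iff_map_eq_zero]
    intro w hw
    have := hin w (quadSC w)
    rw [hw] at this
    have h0 : saddleHess b v g 0 = 0 := by apply lifted_ext <;> simp [saddleHess]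
    rw [h0, inner_zero_left] at this
    exact norm_eq_zero.1 (by
      have h1 : ⟪quadSC w, quadSC w⟫ = ‖w‖ ^ 2 := by
        rw [inner_lifted, norm_sq_lifted]; simp; ring
      rw [h1] at this
      have := (mul_eq_zero.1 this.symm).resolve_left ha0.ne'
      exact pow_eq_zero_iff two_ne_zero |>.1 this)
  set Θ := (LinearEquiv.ofInjectiveEndo (eigenMap g ω l κ k m) hinj).toContinuousLinearEquiv
  have hΘ : ∀ w, Θ w = eigenMap g ω l κ k m w := fun w => rfl
  refine ⟨ω, l, a, Θ, hω, hl, ha0, fun w => ?_, fun w w' => ?_, fun w => ?_⟩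
  · rw [hΘ, hΘ, stdJ_saddleHess_eigenMap e₁ e₂ e₃ e₄]
  · rw [hΘ, hΘ, hin]
  · rw [hΘ, hΘ, eigenMap_refl]

end

end CR3BP

namespace CR3BP

/-! ## Clamping to a cube -/

/-- The projection to the cube `[-ρ, ρ]⁴`. -/
def clamp (ρ : ℝ) (w : LiftedPhase) : LiftedPhase :=
  WithLp.toLp 2 fun i => max (-ρ) (min ρ (w i))

theorem clamp_apply (ρ : ℝ) (w : LiftedPhase) (i : Fin 4) :
    clamp ρ w i = max (-ρ) (min ρ (w i)) := rfl

theorem abs_coord_le_norm (w : LiftedPhase) (i : Fin 4) : |w i| ≤ ‖w‖ := by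
  rw [← Real.norm_eq_abs]
  exact PiLp.norm_apply_le w i

theorem clamp_eq {ρ : ℝ} {w : LiftedPhase} (h : ‖w‖ ≤ ρ) : clamp ρ w = w := by
  ext i
  have := abs_le.1 ((abs_coord_le_norm w i).trans h)
  rw [clamp_apply, min_eq_right this.2, max_eq_right this.1]

theorem norm_clamp_sub_le (ρ : ℝ) (w w' : LiftedPhase) :
    ‖clamp ρ w - clamp ρ w'‖ ≤ ‖w - w'‖ := by
  have key : ∀ i, (clamp ρ w i - clamp ρ w' i) ^ 2 ≤ (w i - w' i) ^ 2 := fun i => by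
    rw [clamp_apply, clamp_apply, sq_le_sq]
    rcases le_total (w i) (w' i) with h | h
    · have h1 : min ρ (w i) ≤ min ρ (w' i) := min_le_min_left _ h
      rw [abs_sub_comm, abs_sub_comm (w i), abs_of_nonneg (sub_nonneg.2 (max_le_max_left _ h1)),
        abs_of_nonneg (sub_nonneg.2 h)]
      simp only [max_def, min_def]
      split_ifs <;> linarith
    · have h1 : min ρ (w' i) ≤ min ρ (w i) := min_le_min_left _ h
      rw [abs_of_nonneg (sub_nonneg.2 (max_le_max_left _ h1)), abs_of_nonneg (sub_nonneg.2 h)]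
      simp only [max_def, min_def]
      split_ifs <;> linarith
  rw [← sq_le_sq₀ (norm_nonneg _) (norm_nonneg _), norm_sq_lifted, norm_sq_lifted]
  simp only [PiLp.sub_apply]
  linarith [key 0, key 1, key 2, key 3]

theorem norm_clamp_le {ρ : ℝ} (hρ : 0 ≤ ρ) (w : LiftedPhase) : ‖clamp ρ w‖ ≤ 2 * ρ := by
  have key : ∀ i, (clamp ρ w i) ^ 2 ≤ ρ ^ 2 := fun i => by
    rw [clamp_apply, sq_le_sq, abs_of_nonneg hρ, abs_le]
    exact ⟨le_max_left _ _, max_le (by linarith) (min_le_left _ _)⟩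
  rw [← sq_le_sq₀ (norm_nonneg _) (by positivity), norm_sq_lifted]
  linarith [key 0, key 1, key 2, key 3]

theorem clamp_refl {ρ : ℝ} (hρ : 0 ≤ ρ) (w : LiftedPhase) :
    clamp ρ (refl w) = refl (clamp ρ w) := by
  apply lifted_ext
  · rw [clamp_apply, refl_zero_apply, refl_zero_apply, clamp_apply]
    rcases le_total ρ (w 0) with h | h <;> rcases le_total (-ρ) (w 0) with h' | h' <;>
      simp [max_def, min_def] <;> split_ifs <;> linarith
  all_goals simp [clamp_apply]

/-! ## Charts at a saddle-center -/

theorem linSC_add (ω l : ℝ) (z w : LiftedPhase) :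
    linSC ω l (z + w) = linSC ω l z + linSC ω l w := by
  apply lifted_ext <;> simp <;> ring

/-- `linSC` as a continuous linear map. -/
def linSCL (ω l : ℝ) : LiftedPhase →L[ℝ] LiftedPhase :=
  LinearMap.toContinuousLinearMap
    { toFun := linSC ω l
      map_add' := linSC_add ω l
      map_smul' := fun r a => by apply lifted_ext <;> simp <;> ring }

@[simp] theorem linSCL_apply (ω l : ℝ) (v : LiftedPhase) : linSCL ω l v = linSC ω l v := rfl

/-- `quadSC` as a continuous linear map. -/
def quadSCL : LiftedPhase →L[ℝ] LiftedPhase :=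
  LinearMap.toContinuousLinearMap
    { toFun := quadSC
      map_add' := fun a b => by apply lifted_ext <;> simp <;> ring
      map_smul' := fun r a => by apply lifted_ext <;> simp }

@[simp] theorem quadSCL_apply (v : LiftedPhase) : quadSCL v = quadSC v := rfl

/-- `reversor` as a continuous linear map. -/
def reversorL : LiftedPhase →L[ℝ] LiftedPhase :=
  LinearMap.toContinuousLinearMap
    { toFun := reversor
      map_add' := fun a b => by apply lifted_ext <;> simp [reversor] <;> ring
      map_smul' := fun r a => by apply lifted_ext <;> simp [reversor] }

@[simp] theorem reversorL_apply (v : LiftedPhase) : reversorL v = reversor v := rfl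

theorem inner_reversor (v w : LiftedPhase) : ⟪reversor v, w⟫ = ⟪v, reversor w⟫ := by
  rw [inner_lifted, inner_lifted]
  simp [reversor]

theorem reversor_reversor (v : LiftedPhase) : reversor (reversor v) = v := by
  apply lifted_ext <;> simp [reversor]

theorem stdJ_reversor (v : LiftedPhase) : stdJ (reversor v) = -reversor (stdJ v) := by
  apply lifted_ext <;> simp [reversor]

theorem gradient_reversor {H : LiftedPhase → ℝ} (hH : Differentiable ℝ H)
    (hR : ∀ z, H (reversor z) = H z) (z : LiftedPhase) :
    gradient H (reversor z) = reversor (gradient H z) := by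
  have h1 : HasFDerivAt (fun z => H (reversor z))
      ((fderiv ℝ H (reversor z)).comp reversorL) z :=
    ((hH (reversor z)).hasFDerivAt).comp z (reversorL.hasFDerivAt (x := z))
  simp only [hR] at h1
  have h2 := h1.fderiv
  refine ext_inner_right ℝ fun v => ?_
  rw [inner_reversor, ← fderiv_eq_inner_gradient, ← fderiv_eq_inner_gradient, h2]
  simp [reversor_reversor]

theorem hamVectorField_reversor {H : LiftedPhase → ℝ} (hH : Differentiable ℝ H)
    (hR : ∀ z, H (reversor z) = H z) (z : LiftedPhase) :
    hamVectorField H (reversor z) = -reversor (hamVectorField H z) := by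
  rw [hamVectorField, gradient_reversor hH hR, stdJ_reversor, hamVectorField]

/-- `w ↦ z₀ + Θ w` brings the quadratic Hamiltonian with Hessian `A` at `z₀` to the normal form. -/
structure IsNormalChart (ω l a : ℝ) (A : LiftedPhase →L[ℝ] LiftedPhase)
    (Θ : LiftedPhase ≃L[ℝ] LiftedPhase) (z₀ : LiftedPhase) : Prop where
  ω_pos : 0 < ω
  l_pos : 0 < l
  a_pos : 0 < a
  flow : ∀ w, stdJ (A (Θ w)) = Θ (linSC ω l w)
  quadratic : ∀ w w', ⟪A (Θ w), Θ w'⟫ = a * ⟪quadSC w, w'⟫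
  map_refl : ∀ w, Θ (refl w) = reversor (Θ w)
  reversor_base : reversor z₀ = z₀

section

variable (ω l a : ℝ) (Θ : LiftedPhase ≃L[ℝ] LiftedPhase) (z₀ : LiftedPhase) (H : LiftedPhase → ℝ)

/-- The Hamiltonian vector field in a chart. -/
def localField (w : LiftedPhase) : LiftedPhase := Θ.symm (hamVectorField H (z₀ + Θ w))

/-- A global extension of the Hamiltonian vector field in a chart. -/
def clampedField (ρ : ℝ) (w : LiftedPhase) : LiftedPhase :=
  linSC ω l w + (localField Θ z₀ H (clamp ρ w) - linSC ω l (clamp ρ w))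

/-- The normalized energy in a chart. -/
def localEnergy (w : LiftedPhase) : ℝ := a⁻¹ * H (z₀ + Θ w)

/-- The gradient of the normalized energy in a chart. -/
def localGradient (w : LiftedPhase) : LiftedPhase :=
  a⁻¹ • (ContinuousLinearMap.adjoint (Θ : LiftedPhase →L[ℝ] LiftedPhase)) (gradient H (z₀ + Θ w))

end

section

variable {ω l a ρ : ℝ} {A : LiftedPhase →L[ℝ] LiftedPhase}
  {Θ : LiftedPhase ≃L[ℝ] LiftedPhase} {z₀ : LiftedPhase} {H : LiftedPhase → ℝ}

theorem clampedField_eq {w : LiftedPhase} (hw : ‖w‖ ≤ ρ) :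
    clampedField ω l Θ z₀ H ρ w = localField Θ z₀ H w := by
  rw [clampedField, clamp_eq hw, add_sub_cancel]

theorem hasFDerivAt_chart (w : LiftedPhase) :
    HasFDerivAt (fun w => z₀ + Θ w) (Θ : LiftedPhase →L[ℝ] LiftedPhase) w :=
  (Θ : LiftedPhase →L[ℝ] LiftedPhase).hasFDerivAt.const_add z₀

theorem hasGradientAt_localEnergy (hH : Differentiable ℝ H) (w : LiftedPhase) :
    HasGradientAt (localEnergy a Θ z₀ H) (localGradient a Θ z₀ H w) w := by
  rw [hasGradientAt_iff_hasFDerivAt]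
  have h1 := (HasFDerivAt.comp w (g := H) (f := fun w => z₀ + Θ w) (hH (z₀ + Θ w)).hasFDerivAt
    (hasFDerivAt_chart w)).const_mul a⁻¹
  refine h1.congr_fderiv ?_
  ext v
  change a⁻¹ * fderiv ℝ H (z₀ + Θ w) (Θ v) = ⟪localGradient a Θ z₀ H w, v⟫
  rw [localGradient, inner_smul_left, ContinuousLinearMap.adjoint_inner_left,
    fderiv_eq_inner_gradient]
  rfl

namespace IsNormalChart

theorem norm_localField_sub_le (N : IsNormalChart ω l a A Θ z₀) (hH : ContDiff ℝ 2 H) {η R : ℝ}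
    (hη : ∀ w, ‖w‖ ≤ R → ‖hess H (z₀ + Θ w) - A‖ ≤ η) {w w' : LiftedPhase} (hw : ‖w‖ ≤ R)
    (hw' : ‖w'‖ ≤ R) :
    ‖localField Θ z₀ H w - localField Θ z₀ H w' - linSC ω l (w - w')‖ ≤
      ‖(Θ.symm : LiftedPhase →L[ℝ] LiftedPhase)‖ * η * ‖(Θ : LiftedPhase →L[ℝ] LiftedPhase)‖ *
        ‖w - w'‖ := by
  have hη0 : 0 ≤ η := (norm_nonneg _).trans (hη w hw)
  have hd : ∀ x, HasFDerivAt (localField Θ z₀ H)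
      ((Θ.symm : LiftedPhase →L[ℝ] LiftedPhase).comp
        ((stdJL.comp (hess H (z₀ + Θ x))).comp (Θ : LiftedPhase →L[ℝ] LiftedPhase))) x := fun x =>
    (Θ.symm : LiftedPhase →L[ℝ] LiftedPhase).hasFDerivAt.comp x
      (HasFDerivAt.comp x (g := hamVectorField H) (f := fun w => z₀ + Θ w)
        (hasFDerivAt_hamVectorField hH (z₀ + Θ x)) (hasFDerivAt_chart x))
  have hb : ∀ x ∈ Metric.closedBall (0 : LiftedPhase) R,
      ‖(Θ.symm : LiftedPhase →L[ℝ] LiftedPhase).comp ((stdJL.comp (hess H (z₀ + Θ x))).comp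
        (Θ : LiftedPhase →L[ℝ] LiftedPhase)) - linSCL ω l‖ ≤
      ‖(Θ.symm : LiftedPhase →L[ℝ] LiftedPhase)‖ * η *
        ‖(Θ : LiftedPhase →L[ℝ] LiftedPhase)‖ := fun x hx => by
    refine ContinuousLinearMap.opNorm_le_bound _ (by positivity) fun v => ?_
    have e : ((Θ.symm : LiftedPhase →L[ℝ] LiftedPhase).comp ((stdJL.comp (hess H (z₀ + Θ x))).comp
        (Θ : LiftedPhase →L[ℝ] LiftedPhase)) - linSCL ω l) v =
        (Θ.symm : LiftedPhase →L[ℝ] LiftedPhase) (stdJL ((hess H (z₀ + Θ x) - A)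
          ((Θ : LiftedPhase →L[ℝ] LiftedPhase) v))) := by
      have : linSC ω l v = Θ.symm (stdJL (A (Θ v))) := by
        rw [stdJL_apply, N.flow, Θ.symm_apply_apply]
      simp only [sub_apply, ContinuousLinearMap.comp_apply, map_sub,
        linSCL_apply, this, ContinuousLinearEquiv.coe_coe]
    rw [e]
    refine (ContinuousLinearMap.le_opNorm _ _).trans ?_
    rw [stdJL_apply, norm_stdJ, mul_assoc, mul_assoc]
    gcongr
    refine (ContinuousLinearMap.le_opNorm _ _).trans ?_
    gcongr
    · exact hη x (by simpa using hx)
    · exact ContinuousLinearMap.le_opNorm _ _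
  have key := (convex_closedBall (0 : LiftedPhase) R).norm_image_sub_le_of_norm_hasFDerivWithin_le'
    (fun x _ => (hd x).hasFDerivWithinAt) hb (mem_closedBall_zero_iff.2 hw')
    (mem_closedBall_zero_iff.2 hw)
  rwa [linSCL_apply] at key

theorem norm_localGradient_sub_le (N : IsNormalChart ω l a A Θ z₀) (hH : ContDiff ℝ 2 H) {η R : ℝ}
    (hη : ∀ w, ‖w‖ ≤ R → ‖hess H (z₀ + Θ w) - A‖ ≤ η) {w w' : LiftedPhase} (hw : ‖w‖ ≤ R)
    (hw' : ‖w'‖ ≤ R) :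
    ‖localGradient a Θ z₀ H w - localGradient a Θ z₀ H w' - quadSC (w - w')‖ ≤
      a⁻¹ * ‖(Θ : LiftedPhase →L[ℝ] LiftedPhase)‖ * η * ‖(Θ : LiftedPhase →L[ℝ] LiftedPhase)‖ *
        ‖w - w'‖ := by
  have hη0 : 0 ≤ η := (norm_nonneg _).trans (hη w hw)
  have ha := N.a_pos
  set Ad := ContinuousLinearMap.adjoint (Θ : LiftedPhase →L[ℝ] LiftedPhase) with hAd
  have hd : ∀ x, HasFDerivAt (localGradient a Θ z₀ H)
      (a⁻¹ • Ad.comp ((hess H (z₀ + Θ x)).comp (Θ : LiftedPhase →L[ℝ] LiftedPhase))) x := fun x =>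
    (HasFDerivAt.comp x (g := Ad) (f := fun w => gradient H (z₀ + Θ w)) Ad.hasFDerivAt
      (HasFDerivAt.comp x (g := gradient H) (f := fun w => z₀ + Θ w)
        (hasFDerivAt_gradient hH (z₀ + Θ x)) (hasFDerivAt_chart x))).const_smul a⁻¹
  have hb : ∀ x ∈ Metric.closedBall (0 : LiftedPhase) R,
      ‖a⁻¹ • Ad.comp ((hess H (z₀ + Θ x)).comp (Θ : LiftedPhase →L[ℝ] LiftedPhase)) - quadSCL‖ ≤
      a⁻¹ * ‖(Θ : LiftedPhase →L[ℝ] LiftedPhase)‖ * η *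
        ‖(Θ : LiftedPhase →L[ℝ] LiftedPhase)‖ := fun x hx => by
    refine ContinuousLinearMap.opNorm_le_bound _ (by positivity) fun v => ?_
    have e : (a⁻¹ • Ad.comp ((hess H (z₀ + Θ x)).comp (Θ : LiftedPhase →L[ℝ] LiftedPhase))
        - quadSCL) v = a⁻¹ • Ad ((hess H (z₀ + Θ x) - A)
          ((Θ : LiftedPhase →L[ℝ] LiftedPhase) v)) := by
      have : quadSC v = a⁻¹ • Ad (A (Θ v)) := by
        refine ext_inner_right ℝ fun u => ?_
        rw [inner_smul_left, hAd, ContinuousLinearMap.adjoint_inner_left]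
        have := N.quadratic v u
        simp only [ContinuousLinearEquiv.coe_coe, RCLike.conj_to_real]
        rw [this, inv_mul_cancel_left₀ ha.ne']
      simp [this, smul_sub]
    rw [e, norm_smul, Real.norm_of_nonneg (by positivity), mul_assoc, mul_assoc, mul_assoc]
    gcongr
    refine (ContinuousLinearMap.le_opNorm _ _).trans ?_
    rw [hAd, LinearIsometryEquiv.norm_map]
    gcongr
    refine (ContinuousLinearMap.le_opNorm _ _).trans ?_
    gcongr
    · exact hη x (by simpa using hx)
    · exact ContinuousLinearMap.le_opNorm _ _
  have key := (convex_closedBall (0 : LiftedPhase) R).norm_image_sub_le_of_norm_hasFDerivWithin_le'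
    (fun x _ => (hd x).hasFDerivWithinAt) hb (mem_closedBall_zero_iff.2 hw')
    (mem_closedBall_zero_iff.2 hw)
  rwa [quadSCL_apply] at key

theorem clampedField_refl (N : IsNormalChart ω l a A Θ z₀) (hH : Differentiable ℝ H)
    (hR : ∀ z, H (reversor z) = H z) (hρ : 0 ≤ ρ) (w : LiftedPhase) :
    clampedField ω l Θ z₀ H ρ (refl w) = -refl (clampedField ω l Θ z₀ H ρ w) := by
  have h1 : ∀ w, localField Θ z₀ H (refl w) = -refl (localField Θ z₀ H w) := fun w => by
    apply Θ.injective
    rw [map_neg, N.map_refl, localField, localField, Θ.apply_symm_apply, Θ.apply_symm_apply,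
      N.map_refl, ← hamVectorField_reversor hH hR, ← reversorL_apply (z₀ + Θ w), map_add,
      reversorL_apply, reversorL_apply, N.reversor_base]
  rw [clampedField, clampedField, clamp_refl hρ, h1, linSC_refl, linSC_refl, ← reflL_apply,
    ← reflL_apply, ← reflL_apply, ← reflL_apply, map_add, map_sub]
  abel

end IsNormalChart

/-- The inverse of `linSC`. -/
theorem exists_linSC_eq (hω : 0 < ω) (hl : 0 < l) (z : LiftedPhase) :
    linSC ω l !₂[z 1 / ω, -(z 0 / ω), z 2 / l, -(z 3 / l)] = z := by
  apply lifted_ext <;> simp <;> field_simp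

/-- A nearly linear vector field has exactly one zero. -/
theorem existsUnique_zero (hω : 0 < ω) (hl : 0 < l) {ε : ℝ}
    (hε : ε ≤ min (ω / 2) (l / 2)) {f : LiftedPhase → LiftedPhase}
    (hf : ∀ z z', ‖f z - f z' - linSC ω l (z - z')‖ ≤ ε * ‖z - z'‖) : ∃! z, f z = 0 := by
  set m := min (ω / 2) (l / 2) with hm
  have hm0 : 0 < m := lt_min (by positivity) (by positivity)
  have m1 : m ≤ ω / 2 := min_le_left _ _
  have m2 : m ≤ l / 2 := min_le_right _ _
  have hlow : ∀ z, 2 * m * ‖z‖ ≤ ‖linSC ω l z‖ := fun z =>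
    IsSaddleCenterSystem.le_norm_linSC (by positivity) (by linarith) (by linarith) z
  choose inv hinv using fun z : LiftedPhase => (⟨_, exists_linSC_eq hω hl z⟩ : ∃ w, linSC ω l w = z)
  have hsub : ∀ z w, linSC ω l (z - w) = linSC ω l z - linSC ω l w := fun z w => by
    simpa using map_sub (linSCL ω l) z w
  have hcon : ContractingWith (1 / 2) fun z => inv (linSC ω l z - f z) := by
    refine ⟨by norm_num, LipschitzWith.of_dist_le_mul fun z z' => ?_⟩
    rw [dist_eq_norm, dist_eq_norm]
    have h1 := hlow (inv (linSC ω l z - f z) - inv (linSC ω l z' - f z'))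
    rw [hsub, hinv, hinv] at h1
    have h2 := hf z z'
    rw [hsub, norm_sub_rev, show linSC ω l z - linSC ω l z' - (f z - f z') =
      linSC ω l z - f z - (linSC ω l z' - f z') by abel] at h2
    have h3 := mul_le_mul_of_nonneg_right hε (norm_nonneg (z - z'))
    push_cast
    rw [div_mul_eq_mul_div, one_mul, le_div_iff₀ two_pos]
    refine le_of_mul_le_mul_left ?_ hm0
    linarith
  refine ⟨hcon.fixedPoint, ?_, fun z hz => ?_⟩
  · have h1 := hcon.fixedPoint_isFixedPt
    have h2 := hinv (linSC ω l hcon.fixedPoint - f hcon.fixedPoint)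
    simp only [Function.IsFixedPt] at h1
    rw [h1] at h2
    exact sub_eq_self.1 h2.symm
  · refine hcon.fixedPoint_unique ?_
    simp only [Function.IsFixedPt, hz, sub_zero]
    have h1 := hlow (inv (linSC ω l z) - z)
    rw [hsub, hinv, sub_self, norm_zero] at h1
    have h2 : ‖inv (linSC ω l z) - z‖ ≤ 0 := by
      by_contra hcon
      nlinarith [mul_pos hm0 (not_le.1 hcon)]
    exact sub_eq_zero.1 (norm_le_zero_iff.1 h2)

/-- A Hamiltonian whose Hessian is close to the normal form defines a saddle-center system. -/
theorem IsNormalChart.exists_isSaddleCenterSystem (N : IsNormalChart ω l a A Θ z₀)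
    (hH : ContDiff ℝ 2 H) (hR : ∀ z, H (reversor z) = H z) {ε η r : ℝ} (hε0 : 0 ≤ ε)
    (hεl : 18 * ε ≤ l) (hεω : 5 * ε ≤ ω) (hε1 : 10 * ε ≤ 1) (hρ : 0 < ρ)
    (h1 : ‖(Θ.symm : LiftedPhase →L[ℝ] LiftedPhase)‖ * η *
      ‖(Θ : LiftedPhase →L[ℝ] LiftedPhase)‖ ≤ ε)
    (h2 : a⁻¹ * ‖(Θ : LiftedPhase →L[ℝ] LiftedPhase)‖ * η *
      ‖(Θ : LiftedPhase →L[ℝ] LiftedPhase)‖ ≤ ε)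
    (hη : ∀ w, ‖w‖ ≤ 2 * ρ → ‖hess H (z₀ + Θ w) - A‖ ≤ η) (hr : r ≤ ρ / 2)
    (h3 : ‖(Θ.symm : LiftedPhase →L[ℝ] LiftedPhase)‖ * ‖gradient H z₀‖ ≤
      min (ω / 2) (l / 2) * r) :
    ∃ zs, ‖zs‖ ≤ r ∧ IsSaddleCenterSystem ω l ε ρ (clampedField ω l Θ z₀ H ρ)
      (localEnergy a Θ z₀ H) (localGradient a Θ z₀ H) zs := by
  have hω := N.ω_pos
  have hl := N.l_pos
  have hHd : Differentiable ℝ H := hH.differentiable two_ne_zero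
  have hnear : ∀ z z', ‖clampedField ω l Θ z₀ H ρ z - clampedField ω l Θ z₀ H ρ z'
      - linSC ω l (z - z')‖ ≤ ε * ‖z - z'‖ := fun z z' => by
    have e : clampedField ω l Θ z₀ H ρ z - clampedField ω l Θ z₀ H ρ z' - linSC ω l (z - z') =
        localField Θ z₀ H (clamp ρ z) - localField Θ z₀ H (clamp ρ z')
          - linSC ω l (clamp ρ z - clamp ρ z') := by
      simp only [clampedField, ← linSCL_apply, map_sub]
      abel
    rw [e]
    refine (N.norm_localField_sub_le hH hη (norm_clamp_le hρ.le z)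
      (norm_clamp_le hρ.le z')).trans ?_
    exact mul_le_mul h1 (norm_clamp_sub_le ρ z z') (norm_nonneg _) hε0
  have hεm : ε ≤ min (ω / 2) (l / 2) := le_min (by linarith) (by linarith)
  obtain ⟨zs, hzs, huniq⟩ := existsUnique_zero hω hl hεm hnear
  have hm0 : 0 < min (ω / 2) (l / 2) := lt_min (by positivity) (by positivity)
  have hnorm : ‖zs‖ ≤ r := by
    have e1 := hnear zs 0
    rw [hzs, sub_zero, zero_sub, ← norm_neg, neg_sub, sub_neg_eq_add,
      clampedField_eq (by simpa using hρ.le)] at e1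
    have e2 := IsSaddleCenterSystem.le_norm_linSC (ω := ω) (l := l)
      (m := 2 * min (ω / 2) (l / 2)) (by positivity) (by linarith [min_le_left (ω / 2) (l / 2)])
      (by linarith [min_le_right (ω / 2) (l / 2)]) zs
    have e3 : ‖localField Θ z₀ H 0‖ ≤ min (ω / 2) (l / 2) * r := by
      refine le_trans ?_ h3
      refine ((Θ.symm : LiftedPhase →L[ℝ] LiftedPhase).le_opNorm _).trans ?_
      rw [map_zero, add_zero, hamVectorField, norm_stdJ]
    have e4 := norm_sub_le (linSC ω l zs + localField Θ z₀ H 0) (localField Θ z₀ H 0)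
    rw [add_sub_cancel_right] at e4
    have e5 := mul_le_mul_of_nonneg_right hεm (norm_nonneg zs)
    refine le_of_mul_le_mul_left ?_ hm0
    linarith
  have hzρ : ‖zs‖ ≤ ρ := by linarith
  have hloc : localField Θ z₀ H zs = 0 := by rw [← clampedField_eq hzρ]; exact hzs
  have hgrad : gradient H (z₀ + Θ zs) = 0 := by
    rw [localField, map_eq_zero_iff _ Θ.symm.injective, hamVectorField] at hloc
    rw [← norm_eq_zero, ← norm_stdJ, hloc, norm_zero]
  refine ⟨zs, hnorm, hω, hl, hε0, hεl, hεω, hε1, hρ, hnear, N.clampedField_refl hHd hR hρ.le, ?_,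
    hzs, by linarith, fun z _ => hasGradientAt_localEnergy hHd z, fun z hz => ?_,
    fun z z' hz hz' => ?_, ?_⟩
  · refine huniq _ ?_
    simp only
    rw [N.clampedField_refl hHd hR hρ.le, hzs]
    apply lifted_ext <;> simp
  · rw [clampedField_eq hz, localGradient, inner_smul_left,
      ContinuousLinearMap.adjoint_inner_left, localField, ContinuousLinearEquiv.coe_coe,
      Θ.apply_symm_apply, hamVectorField]
    have : ∀ v : LiftedPhase, ⟪v, stdJ v⟫ = 0 := fun v => by
      rw [inner_lifted]; simp; ring
    rw [this, mul_zero]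
  · refine (N.norm_localGradient_sub_le hH hη (by linarith) (by linarith)).trans ?_
    gcongr
  · rw [localGradient, hgrad, map_zero, smul_zero]

end

end CR3BP

namespace CR3BP

/-! ## Periodic orbits -/

theorem eqOn_of_hasDerivAt {X : LiftedPhase → LiftedPhase} (hX : ContDiff ℝ 1 X) {a b t₀ : ℝ}
    (ht₀ : t₀ ∈ Set.Ioo a b) {γ₁ γ₂ : ℝ → LiftedPhase}
    (h₁ : ∀ t ∈ Set.Icc a b, HasDerivAt γ₁ (X (γ₁ t)) t)
    (h₂ : ∀ t ∈ Set.Icc a b, HasDerivAt γ₂ (X (γ₂ t)) t) (h : γ₁ t₀ = γ₂ t₀) :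
    Set.EqOn γ₁ γ₂ (Set.Icc a b) := by
  have c₁ : ContinuousOn γ₁ (Set.Icc a b) := HasDerivAt.continuousOn h₁
  have c₂ : ContinuousOn γ₂ (Set.Icc a b) := HasDerivAt.continuousOn h₂
  have hK : IsCompact (γ₁ '' Set.Icc a b ∪ γ₂ '' Set.Icc a b) :=
    (isCompact_Icc.image_of_continuousOn c₁).union (isCompact_Icc.image_of_continuousOn c₂)
  obtain ⟨K, hKL⟩ := (hX.locallyLipschitz.locallyLipschitzOn
    (s := γ₁ '' Set.Icc a b ∪ γ₂ '' Set.Icc a b)).exists_lipschitzOnWith_of_compact hK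
  exact ODE_solution_unique_of_mem_Icc (v := fun _ => X) (s := fun _ => _) (fun _ _ => hKL) ht₀ c₁
    (fun t ht => h₁ t (Set.Ioo_subset_Icc_self ht))
    (fun t ht => Or.inl ⟨t, Set.Ioo_subset_Icc_self ht, rfl⟩) c₂
    (fun t ht => h₂ t (Set.Ioo_subset_Icc_self ht))
    (fun t ht => Or.inr ⟨t, Set.Ioo_subset_Icc_self ht, rfl⟩) h

theorem eq_of_hasDerivAt {X : LiftedPhase → LiftedPhase} (hX : ContDiff ℝ 1 X) {t₀ : ℝ}
    {γ₁ γ₂ : ℝ → LiftedPhase} (h₁ : ∀ t, HasDerivAt γ₁ (X (γ₁ t)) t)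
    (h₂ : ∀ t, HasDerivAt γ₂ (X (γ₂ t)) t) (h : γ₁ t₀ = γ₂ t₀) : γ₁ = γ₂ := by
  funext t
  exact eqOn_of_hasDerivAt hX (a := min t t₀ - 1) (b := max t t₀ + 1)
    ⟨by linarith [min_le_right t t₀], by linarith [le_max_right t t₀]⟩ (fun t _ => h₁ t)
    (fun t _ => h₂ t) h ⟨by linarith [min_le_left t t₀], by linarith [le_max_left t t₀]⟩

theorem contDiff_hamVectorField {H : LiftedPhase → ℝ} (hH : ContDiff ℝ 2 H) :
    ContDiff ℝ 1 (hamVectorField H) :=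
  stdJL.contDiff.comp (contDiff_gradient hH)

/-- The deck transformation `x₂ ↦ x₂ + 2πk` of the universal cover. -/
def deck (k : ℤ) : LiftedPhase := !₂[0, 0, 0, 2 * Real.pi * k]

theorem toPhase_eq_iff {z w : LiftedPhase} :
    toPhase z = toPhase w ↔ ∃ k : ℤ, z = w + deck k := by
  simp only [toPhase, Prod.mk.injEq, Real.Angle.angle_eq_iff_two_pi_dvd_sub]
  constructor
  · rintro ⟨⟨h0, h1⟩, h2, k, h3⟩
    refine ⟨k, ?_⟩
    apply lifted_ext <;> simp [deck, h0, h1, h2]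
    linarith
  · rintro ⟨k, rfl⟩
    refine ⟨⟨by simp [deck], by simp [deck]⟩, by simp [deck], k, by simp [deck]⟩

theorem toPhase_add_deck (z : LiftedPhase) (k : ℤ) : toPhase (z + deck k) = toPhase z :=
  toPhase_eq_iff.2 ⟨k, rfl⟩

theorem eq_of_toPhase_eq {z w : LiftedPhase} (h : toPhase z = toPhase w)
    (hd : ‖z - w‖ < 2 * Real.pi) : z = w := by
  obtain ⟨k, rfl⟩ := toPhase_eq_iff.1 h
  rw [add_sub_cancel_left] at hd
  have h1 := (abs_coord_le_norm (deck k) 3).trans_lt hd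
  have h2 : deck k 3 = 2 * Real.pi * k := rfl
  rw [h2, abs_mul, abs_of_pos Real.two_pi_pos] at h1
  have h3 : |(k : ℝ)| < 1 := by
    by_contra hcon
    nlinarith [Real.two_pi_pos]
  have h4 : k = 0 := Int.abs_lt_one_iff.1 (by exact_mod_cast h3)
  rw [h4]
  apply lifted_ext <;> simp [deck]

theorem continuous_toPhase : Continuous toPhase := by
  unfold toPhase
  exact ((continuous_coord 0).prodMk (continuous_coord 1)).prodMk
    ((continuous_coord 2).prodMk (Real.Angle.continuous_coe.comp (continuous_coord 3)))

section

variable {H : LiftedPhase → ℝ} {γ : ℝ → LiftedPhase} {T : ℝ}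

theorem gradient_add_deck (hp : ∀ z k, H (z + deck k) = H z) (z : LiftedPhase) (k : ℤ) :
    gradient H (z + deck k) = gradient H z := by
  have h1 : fderiv ℝ H (z + deck k) = fderiv ℝ H z := by
    rw [← fderiv_comp_add_right]
    simp only [hp]
  rw [gradient, gradient, h1]

theorem hess_add_deck (hp : ∀ z k, H (z + deck k) = H z) (z : LiftedPhase) (k : ℤ) :
    hess H (z + deck k) = hess H z := by
  rw [hess, ← fderiv_comp_add_right]
  simp only [gradient_add_deck hp]
  rfl

theorem hamVectorField_add_deck (hp : ∀ z k, H (z + deck k) = H z) (z : LiftedPhase) (k : ℤ) :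
    hamVectorField H (z + deck k) = hamVectorField H z := by
  rw [hamVectorField, gradient_add_deck hp, hamVectorField]

namespace IsPeriodicOrbit

theorem continuous (h : IsPeriodicOrbit H γ T) : Continuous γ := continuous_trajectory h.trajectory

theorem gradient_ne_zero (h : IsPeriodicOrbit H γ T) (hH : ContDiff ℝ 2 H) (t : ℝ) :
    gradient H (γ t) ≠ 0 := by
  intro h0
  have h1 : hamVectorField H (γ t) = 0 := by
    rw [hamVectorField, ← norm_eq_zero, norm_stdJ, h0, norm_zero]
  have h2 : γ = fun _ => γ t := by
    refine eq_of_hasDerivAt (contDiff_hamVectorField hH) (t₀ := t) h.trajectory (fun s => ?_) rfl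
    rw [h1]
    exact hasDerivAt_const s _
  obtain ⟨s, hs⟩ := h.nonconstant
  rw [h2] at hs
  exact hs rfl

theorem exists_deck (h : IsPeriodicOrbit H γ T) (hp : ∀ z k, H (z + deck k) = H z) :
    ∃ k : ℤ, ∀ t, γ (t + T) = γ t + deck k := by
  have h1 : ∀ t, HasDerivAt (fun t => γ (t + T) - γ t) 0 t := fun t => by
    have h2 := ((h.trajectory (t + T)).comp_add_const t T).sub (h.trajectory t)
    obtain ⟨k, hk⟩ := toPhase_eq_iff.1 (h.periodic t)
    rwa [hk, hamVectorField_add_deck hp, sub_self] at h2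
  obtain ⟨k, hk⟩ := toPhase_eq_iff.1 (h.periodic 0)
  refine ⟨k, fun t => ?_⟩
  have h3 := is_const_of_deriv_eq_zero (fun t => (h1 t).differentiableAt)
    (fun t => (h1 t).deriv) t 0
  rw [hk, add_sub_cancel_left] at h3
  rw [← h3, add_sub_cancel]

theorem exists_norm_hess_le (h : IsPeriodicOrbit H γ T) (hH : ContDiff ℝ 2 H)
    (hp : ∀ z k, H (z + deck k) = H z) : ∃ K, ∀ t, ‖hess H (γ t)‖ ≤ K := by
  obtain ⟨k, hk⟩ := h.exists_deck hp
  have hper : Function.Periodic (fun t => ‖hess H (γ t)‖) T := fun t => by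
    simp only [hk, hess_add_deck hp]
  have hc : Continuous fun t => ‖hess H (γ t)‖ := ((continuous_hess hH).comp h.continuous).norm
  obtain ⟨K, hK⟩ := (hper.compact_of_continuous h.pos.ne' hc).bddAbove
  exact ⟨K, fun t => hK ⟨t, rfl⟩⟩

/-- A long stay in a region where the Hessian is positive on average forces a large index. -/
theorem exists_large_index (h : IsPeriodicOrbit H γ T) (hH : ContDiff ℝ 2 H)
    (hp : ∀ z k, H (z + deck k) = H z)
    (hv : ∀ K, ∃ C : ℝ, ∀ z, ‖hess H z‖ ≤ K → ∀ v : LiftedPhase,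
      -C * (v 2 ^ 2 + v 3 ^ 2) ≤ ⟪hess H z v, v⟫)
    {s₁ s₂ : ℝ} (h₁ : 0 < s₁) (h₂ : 0 < s₂) (c : ℝ) {m₁ m₂ t₁ t₂ : ℝ} (ht₁ : 0 ≤ t₁)
    (ht : t₁ ≤ t₂) (ht₂ : t₂ ≤ T)
    (hm : ∀ t ∈ Set.Icc t₁ t₂, ∀ z, m₁ * (twist s₁ s₂ c z 0 ^ 2 + twist s₁ s₂ c z 2 ^ 2)
      + m₂ * (twist s₁ s₂ c z 1 ^ 2 + twist s₁ s₂ c z 3 ^ 2) ≤ ⟪hess H (γ t) z, z⟫) :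
    ∃ m : ℤ, IsConleyZehnderIndex H γ T m ∧ (m₁ + m₂) * (t₂ - t₁) / Real.pi - 7 ≤ m := by
  obtain ⟨K, hK⟩ := h.exists_norm_hess_le hH hp
  obtain ⟨C, hC⟩ := hv K
  have hreg := h.gradient_ne_zero hH
  have hpi := Real.pi_pos
  obtain ⟨m, hm', hle⟩ := exists_isConleyZehnderIndex hH h.trajectory hreg hK (T := T)
    (D := ((m₁ + m₂) * (t₂ - t₁) - 6 * Real.pi) / (2 * Real.pi)) (by
      rintro d ⟨v, θ, hv, h0, hne, hcont, hpol, rfl⟩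
      have hθ : IsArgument (fun t => transverseCoord H (γ t) (v t)) θ := ⟨hcont, hpol⟩
      have i1 := hθ.increment_ge_of_vertical hH h.trajectory hreg hv h0 hne ht₁
        (fun t _ => hC _ (hK t))
      have i2 := hθ.increment_ge_of_twist hH h.trajectory hreg hv h0 hne h₁ h₂ c ht hm
      have i3 := hθ.increment_ge_of_vertical hH h.trajectory hreg hv h0 hne ht₂
        (fun t _ => hC _ (hK t))
      refine div_le_div_of_nonneg_right ?_ (by positivity)
      linarith)
  refine ⟨m, hm', le_trans (le_of_eq ?_) hle⟩
  field_simp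
  ring

end IsPeriodicOrbit

end

/-- The vertical bound of the Hessian of the regularized Hamiltonian. -/
theorem exists_vertical_bound (μ E K : ℝ) : ∃ C : ℝ, ∀ z, ‖hess (regHamiltonian μ E) z‖ ≤ K →
    ∀ v : LiftedPhase, -C * (v 2 ^ 2 + v 3 ^ 2) ≤ ⟪hess (regHamiltonian μ E) z v, v⟫ := by
  refine ⟨K ^ 2 + K, fun z hz v => ?_⟩
  have hK : 0 ≤ K := (norm_nonneg _).trans hz
  set a : LiftedPhase := !₂[v 0, v 1, 0, 0] with ha
  set b : LiftedPhase := !₂[0, 0, v 2, v 3] with hb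
  set A := hess (regHamiltonian μ E) z with hA
  have hv : v = a + b := by apply lifted_ext <;> simp [ha, hb]
  have hbn : ‖b‖ ^ 2 = v 2 ^ 2 + v 3 ^ 2 := by rw [norm_sq_lifted]; simp [hb]
  have e1 : ⟪A a, a⟫ = ‖a‖ ^ 2 := by
    rw [inner_lifted, norm_sq_lifted, hA, hess_apply_zero, hess_apply_one]
    simp [ha]
    ring
  have e2 : ⟪A a, b⟫ = ⟪A b, a⟫ := hess_symm (contDiff_regHamiltonian μ E) z a b
  have e3 : -(K * ‖b‖ * ‖a‖) ≤ ⟪A b, a⟫ := by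
    have h1 := (abs_le.1 (abs_real_inner_le_norm (A b) a)).1
    have h2 : ‖A b‖ ≤ K * ‖b‖ := (A.le_opNorm b).trans (by gcongr)
    nlinarith [norm_nonneg a]
  have e4 : -(K * ‖b‖ * ‖b‖) ≤ ⟪A b, b⟫ := by
    have h1 := (abs_le.1 (abs_real_inner_le_norm (A b) b)).1
    have h2 : ‖A b‖ ≤ K * ‖b‖ := (A.le_opNorm b).trans (by gcongr)
    nlinarith [norm_nonneg b]
  have e5 : ⟪A v, v⟫ = ⟪A a, a⟫ + ⟪A a, b⟫ + (⟪A b, a⟫ + ⟪A b, b⟫) := by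
    conv_lhs => rw [hv]
    rw [map_add, inner_add_left, inner_add_right, inner_add_right]
  rw [e5, e1, e2, ← hbn]
  nlinarith [sq_nonneg (‖a‖ - K * ‖b‖)]

theorem regHamiltonian_add_deck (μ E : ℝ) (z : LiftedPhase) (k : ℤ) :
    regHamiltonian μ E (z + deck k) = regHamiltonian μ E z := by
  have h3 : (z + deck k) 3 = z 3 + k * (2 * Real.pi) := by simp [deck]; ring
  have h4 : 2 * (z + deck k) 3 = 2 * z 3 + (2 * k : ℤ) * (2 * Real.pi) := by
    rw [h3]; push_cast; ring
  have e1 : Real.sin (2 * (z + deck k) 3) = Real.sin (2 * z 3) := by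
    rw [h4, Real.sin_add_int_mul_two_pi]
  have e2 : Real.cos ((z + deck k) 3) = Real.cos (z 3) := by
    rw [h3, Real.cos_add_int_mul_two_pi]
  have e3 : (z + deck k) 0 = z 0 := by simp [deck]
  have e4 : (z + deck k) 1 = z 1 := by simp [deck]
  have e5 : (z + deck k) 2 = z 2 := by simp [deck]
  unfold regHamiltonian regPotential
  rw [e1, e2, e3, e4, e5]

theorem regHamiltonian_reversor (μ E : ℝ) (z : LiftedPhase) :
    regHamiltonian μ E (reversor z) = regHamiltonian μ E z := by
  have e0 : reversor z 0 = z 0 := rfl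
  have e1 : reversor z 1 = -z 1 := rfl
  have e2 : reversor z 2 = -z 2 := rfl
  have e3 : reversor z 3 = z 3 := rfl
  unfold regHamiltonian regPotential
  rw [e0, e1, e2, e3, mul_neg, Real.sinh_neg, Real.cosh_neg]
  ring

end CR3BP

namespace CR3BP

/-! ## Estimates near the saddle-center -/

/-- The quadratic form at the saddle-center dominates a twisted diagonal form of positive trace, and
so do its perturbations. -/
theorem exists_twist_bound {b v : ℝ} (hb : 0 < b) (hv : 0 < v) (g : ℝ) :
    ∃ s₁ s₂ m₁ m₂ η : ℝ, 0 < s₁ ∧ 0 < s₂ ∧ 0 < m₁ + m₂ ∧ 0 < η ∧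
      ∀ B : LiftedPhase → LiftedPhase, (∀ z, ‖B z - saddleHess b v g z‖ ≤ η * ‖z‖) → ∀ z,
        m₁ * (twist s₁ s₂ (1 / 4 - g) z 0 ^ 2 + twist s₁ s₂ (1 / 4 - g) z 2 ^ 2)
          + m₂ * (twist s₁ s₂ (1 / 4 - g) z 1 ^ 2 + twist s₁ s₂ (1 / 4 - g) z 3 ^ 2)
          ≤ ⟪B z, z⟫ := by
  set c := 1 / 4 - g with hc
  set β := Real.sqrt b with hβ
  have hβ0 : 0 < β := Real.sqrt_pos.2 hb
  have hβ2 : β ^ 2 = b := Real.sq_sqrt hb.le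
  set s₁ := Real.sqrt (1 / β) with hs₁
  have h₁ : s₁ ^ 2 = 1 / β := Real.sq_sqrt (by positivity)
  set s₂ := Real.sqrt (β / (8 * v)) with hs₂
  have h₂ : s₂ ^ 2 = β / (8 * v) := Real.sq_sqrt (by positivity)
  set n := min (min (1 / 2) (b / 2)) (min (b / (32 * v)) v) with hn
  have hn0 : 0 < n := lt_min (lt_min (by positivity) (by positivity))
    (lt_min (by positivity) (by positivity))
  have n1 : n ≤ 1 / 2 := (min_le_left _ _).trans (min_le_left _ _)
  have n2 : n ≤ b / 2 := (min_le_left _ _).trans (min_le_right _ _)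
  have n3 : n ≤ b / (32 * v) := (min_le_right _ _).trans (min_le_left _ _)
  have n4 : n ≤ v := (min_le_right _ _).trans (min_le_right _ _)
  refine ⟨s₁, s₂, β / 2, -(β / 4), n / (2 + 2 * c ^ 2), Real.sqrt_pos.2 (by positivity),
    Real.sqrt_pos.2 (by positivity), by linarith, by positivity, fun B hB z => ?_⟩
  have e1 : -(n / (2 + 2 * c ^ 2) * ‖z‖ ^ 2) ≤ ⟪B z - saddleHess b v g z, z⟫ := by
    have i1 := (abs_le.1 (abs_real_inner_le_norm (B z - saddleHess b v g z) z)).1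
    have i2 := mul_le_mul_of_nonneg_right (hB z) (norm_nonneg z)
    nlinarith
  have e2 : ⟪saddleHess b v g z, z⟫ = (z 0 + c * z 3) ^ 2 + (z 1 + c * z 2 + g * z 2) ^ 2
      + b * z 2 ^ 2 - v * z 3 ^ 2 := by
    rw [inner_lifted, hc]
    simp only [saddleHess, Matrix.cons_val]
    ring
  have e3 : n / (2 + 2 * c ^ 2) * ‖z‖ ^ 2 ≤
      n * ((z 0 + c * z 3) ^ 2 + (z 1 + c * z 2) ^ 2 + z 2 ^ 2 + z 3 ^ 2) := by
    rw [div_mul_eq_mul_div, div_le_iff₀ (by positivity), mul_assoc, norm_sq_lifted]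
    gcongr
    nlinarith [sq_nonneg (z 0 + 2 * (c * z 3)), sq_nonneg (z 1 + 2 * (c * z 2)),
      mul_nonneg (sq_nonneg c) (sq_nonneg (z 0 + c * z 3)),
      mul_nonneg (sq_nonneg c) (sq_nonneg (z 1 + c * z 2)), sq_nonneg (z 2), sq_nonneg (z 3)]
  rw [inner_sub_left, e2] at e1
  have t0 : twist s₁ s₂ c z 0 ^ 2 = 1 / β * (z 0 + c * z 3) ^ 2 := by
    rw [← h₁, ← mul_pow]; rfl
  have t1 : twist s₁ s₂ c z 1 ^ 2 = β / (8 * v) * (z 1 + c * z 2) ^ 2 := by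
    rw [← h₂, ← mul_pow]; rfl
  have t2 : twist s₁ s₂ c z 2 ^ 2 = z 2 ^ 2 / (1 / β) := by
    rw [← h₁, ← div_pow]; rfl
  have t3 : twist s₁ s₂ c z 3 ^ 2 = z 3 ^ 2 / (β / (8 * v)) := by
    rw [← h₂, ← div_pow]; rfl
  have e4 : β / 2 * (twist s₁ s₂ c z 0 ^ 2 + twist s₁ s₂ c z 2 ^ 2) +
      -(β / 4) * (twist s₁ s₂ c z 1 ^ 2 + twist s₁ s₂ c z 3 ^ 2) =
      (z 0 + c * z 3) ^ 2 / 2 + b / 2 * z 2 ^ 2 - b / (32 * v) * (z 1 + c * z 2) ^ 2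
        - 2 * v * z 3 ^ 2 := by
    rw [t0, t1, t2, t3, ← hβ2]
    field_simp
    ring
  rw [e4]
  have f1 := mul_le_mul_of_nonneg_right n1 (sq_nonneg (z 0 + c * z 3))
  have f2 := mul_le_mul_of_nonneg_right n2 (sq_nonneg (z 2))
  have f3 := mul_le_mul_of_nonneg_right n3 (sq_nonneg (z 1 + c * z 2))
  have f4 := mul_le_mul_of_nonneg_right n4 (sq_nonneg (z 3))
  have f5 := sq_nonneg (z 1 + c * z 2 + g * z 2)
  linarith

/-- The Hessian is close to its value at the saddle-center, uniformly in the parameters. -/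
theorem exists_hess_close (μ₀ E₀ : ℝ) (z₀ : LiftedPhase) {η : ℝ} (hη : 0 < η) :
    ∃ R > 0, ∃ δ > 0, ∀ μ E, |μ - μ₀| < δ → |E - E₀| < δ → ∀ z, ‖z - z₀‖ ≤ R →
      ‖hess (regHamiltonian μ E) z - hess (regHamiltonian μ₀ E₀) z₀‖ ≤ η := by
  have hc := continuous_hess_regHamiltonian.continuousAt (x := ((μ₀, E₀), z₀))
  obtain ⟨δ, hδ, h⟩ := Metric.continuousAt_iff.1 hc η hη
  refine ⟨δ / 2, by positivity, δ, hδ, fun μ E hμ hE z hz => ?_⟩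
  have := h (x := ((μ, E), z)) (by
    rw [Prod.dist_eq, Prod.dist_eq, max_lt_iff, max_lt_iff, Real.dist_eq, Real.dist_eq,
      dist_eq_norm]
    exact ⟨⟨hμ, hE⟩, hz.trans_lt (by linarith)⟩)
  rw [dist_eq_norm] at this
  exact this.le

theorem exists_gradient_close (μ₀ E₀ : ℝ) (z₀ : LiftedPhase)
    (h0 : gradient (regHamiltonian μ₀ E₀) z₀ = 0) {η : ℝ} (hη : 0 < η) :
    ∃ δ > 0, ∀ μ E, |μ - μ₀| < δ → |E - E₀| < δ → ‖gradient (regHamiltonian μ E) z₀‖ ≤ η := by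
  have hc := (contDiff_regGradient (n := 0)).continuous.continuousAt (x := ((μ₀, E₀), z₀))
  obtain ⟨δ, hδ, h⟩ := Metric.continuousAt_iff.1 hc η hη
  refine ⟨δ, hδ, fun μ E hμ hE => ?_⟩
  have := h (x := ((μ, E), z₀)) (by
    rw [Prod.dist_eq, Prod.dist_eq, max_lt_iff, max_lt_iff, Real.dist_eq, Real.dist_eq, dist_self]
    exact ⟨⟨hμ, hE⟩, hδ⟩)
  rw [gradient_regHamiltonian] at h0 ⊢
  simp only [h0, dist_zero_right] at this
  exact this.le

/-- The derivative of the gradient with respect to the energy. -/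
theorem regGradient_sub (μ E E' : ℝ) (z : LiftedPhase) :
    regGradient μ E z - regGradient μ E' z = (E - E') •
      !₂[0, 0, -(Real.cosh (z 2) * Real.sinh (z 2)) / 2, -(Real.cos (z 3) * Real.sin (z 3)) / 2] := by
  apply lifted_ext <;> simp [regGradient, potentialC, potentialK] <;> ring

theorem exists_gradient_lipschitz (z₀ : LiftedPhase) (R : ℝ) :
    ∃ L, 0 ≤ L ∧ ∀ μ E E' z, ‖z - z₀‖ ≤ R →
      ‖gradient (regHamiltonian μ E) z - gradient (regHamiltonian μ E') z‖ ≤ L * |E - E'| := by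
  have hc : Continuous fun z : LiftedPhase => (!₂[0, 0, -(Real.cosh (z 2) * Real.sinh (z 2)) / 2,
      -(Real.cos (z 3) * Real.sin (z 3)) / 2] : LiftedPhase) := by
    have h2 := continuous_coord 2
    have h3 := continuous_coord 3
    refine (PiLp.continuous_toLp 2 _).comp (continuous_pi fun i => ?_)
    fin_cases i <;> simp <;> fun_prop
  obtain ⟨L, hL⟩ := ((isCompact_closedBall z₀ R).image hc.norm).bddAbove
  refine ⟨max L 0, le_max_right _ _, fun μ E E' z hz => ?_⟩
  rw [gradient_regHamiltonian, gradient_regHamiltonian, regGradient_sub, norm_smul,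
    Real.norm_eq_abs, mul_comm]
  gcongr
  exact (hL ⟨z, by simpa [dist_eq_norm] using hz, rfl⟩).trans (le_max_left _ _)

/-! ## The potential along the axis -/

/-- The second derivative of the potential along the axis `x₁ = 0`. -/
def axisCurvature (μ E t : ℝ) : ℝ :=
  potentialKK μ E (Real.cos t) * Real.sin t ^ 2 - potentialK μ E 1 (Real.cos t) * Real.cos t

theorem hasDerivAt_axis (μ E t : ℝ) : HasDerivAt (fun t => regPotential μ E 0 t)
    (-(potentialK μ E 1 (Real.cos t) * Real.sin t)) t := by
  have := hasDerivAt_regPotential μ E (hasDerivAt_const t (0 : ℝ)) (hasDerivAt_id t)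
  refine this.congr_deriv ?_
  simp

theorem hasDerivAt_axis_deriv (μ E t : ℝ) :
    HasDerivAt (fun t => -(potentialK μ E 1 (Real.cos t) * Real.sin t)) (axisCurvature μ E t) t := by
  have hc := Real.hasDerivAt_cos t
  have hK := (((hc.const_mul E).div_const 2).sub ((hc.sub ((hc.fun_pow 3).const_mul 2)).div_const
    16)).add ((((((hc.fun_pow 2).const_sub (1 ^ 2)).const_mul 1).sub ((hc.const_mul 2).mul
      ((hc.const_mul 1).const_add (1 / 2 - μ)))).div_const 16).const_sub (1 / 2) |>.const_mul
        (1 - 2 * μ))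
  have key := (hK.mul (Real.hasDerivAt_sin t)).neg
  refine key.congr_deriv ?_
  simp only [axisCurvature, potentialK, potentialKK, Pi.add_apply, Pi.sub_apply, Pi.mul_apply,
    Nat.cast_ofNat]
  ring

/-- A critical point on an interval of concavity is a maximum. -/
theorem le_of_axisCurvature_neg {μ E a r x y : ℝ}
    (h : ∀ t, |t - a| ≤ r → axisCurvature μ E t < 0) (hx : |x - a| ≤ r) (hy : |y - a| ≤ r)
    (h0 : potentialK μ E 1 (Real.cos x) * Real.sin x = 0) :
    regPotential μ E 0 y ≤ regPotential μ E 0 x := by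
  have hanti : AntitoneOn (fun t => -(potentialK μ E 1 (Real.cos t) * Real.sin t))
      (Set.Icc (a - r) (a + r)) := by
    refine antitoneOn_of_deriv_nonpos (convex_Icc _ _)
      (fun t _ => (hasDerivAt_axis_deriv μ E t).continuousAt.continuousWithinAt)
      (fun t _ => (hasDerivAt_axis_deriv μ E t).differentiableAt.differentiableWithinAt)
      fun t ht => ?_
    rw [(hasDerivAt_axis_deriv μ E t).deriv]
    rw [interior_Icc] at ht
    exact (h t (abs_le.2 ⟨by linarith [ht.1], by linarith [ht.2]⟩)).le
  have hx' : x ∈ Set.Icc (a - r) (a + r) := by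
    rw [abs_le] at hx; constructor <;> linarith
  have hy' : y ∈ Set.Icc (a - r) (a + r) := by
    rw [abs_le] at hy; constructor <;> linarith
  have hd := fun t => hasDerivAt_axis μ E t
  rcases le_total x y with hxy | hxy
  · have := antitoneOn_of_deriv_nonpos (convex_Icc x y) (f := fun t => regPotential μ E 0 t)
      (fun t _ => (hd t).continuousAt.continuousWithinAt)
      (fun t _ => (hd t).differentiableAt.differentiableWithinAt) fun t ht => by
        rw [(hd t).deriv]
        rw [interior_Icc] at ht
        have := hanti hx' ⟨by linarith [hx'.1, ht.1], by linarith [hy'.2, ht.2]⟩ ht.1.le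
        simp only [h0, neg_zero] at this
        exact this
    exact this ⟨le_rfl, hxy⟩ ⟨hxy, le_rfl⟩ hxy
  · have := monotoneOn_of_deriv_nonneg (convex_Icc y x) (f := fun t => regPotential μ E 0 t)
      (fun t _ => (hd t).continuousAt.continuousWithinAt)
      (fun t _ => (hd t).differentiableAt.differentiableWithinAt) fun t ht => by
        rw [(hd t).deriv]
        rw [interior_Icc] at ht
        have := hanti ⟨by linarith [hy'.1, ht.1], by linarith [hx'.2, ht.2]⟩ hx' ht.2.le
        simp only [h0, neg_zero] at this
        exact this
    exact this ⟨le_rfl, hxy⟩ ⟨hxy, le_rfl⟩ hxy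

theorem exists_axisCurvature_neg {μ₀ σ : ℝ} (h0 : 0 < μ₀) (h1 : μ₀ < 1) (hσ : σ = 1 ∨ σ = -1) :
    ∃ r > 0, ∃ δ > 0, ∀ μ E t, |μ - μ₀| < δ → |E - firstLagrangeValue μ₀| < δ →
      |t - saddleCenter μ₀ σ 3| ≤ r → axisCurvature μ E t < 0 ∧ Real.sin t ≠ 0 := by
  have hc : Continuous fun p : (ℝ × ℝ) × ℝ => axisCurvature p.1.1 p.1.2 p.2 := by
    unfold axisCurvature potentialK potentialKK
    fun_prop
  set t₀ := saddleCenter μ₀ σ 3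
  have hcos := cos_saddleCenter h0 h1 hσ
  have hneg : axisCurvature μ₀ (firstLagrangeValue μ₀) t₀ < 0 := by
    have := curvatureV_pos h0 h1
    unfold axisCurvature
    rw [hcos, sin_sq_saddleCenter h0 h1 hσ, potentialK_lagrange h0 h1, potentialKK_lagrange h0 h1]
    unfold curvatureV at this
    linarith
  have hsin : Real.sin t₀ ≠ 0 := by
    intro h
    have h2 := sin_sq_saddleCenter h0 h1 hσ
    have h3 := radius_mul_pos h0 h1
    rw [h] at h2
    linarith
  have ev1 : ∀ᶠ p : (ℝ × ℝ) × ℝ in 𝓝 ((μ₀, firstLagrangeValue μ₀), t₀),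
      axisCurvature p.1.1 p.1.2 p.2 < 0 := hc.continuousAt.eventually_lt continuousAt_const hneg
  have ev2 : ∀ᶠ p : (ℝ × ℝ) × ℝ in 𝓝 ((μ₀, firstLagrangeValue μ₀), t₀), Real.sin p.2 ≠ 0 :=
    (Real.continuous_sin.comp continuous_snd).continuousAt.eventually_ne hsin
  obtain ⟨δ, hδ, h⟩ := Metric.eventually_nhds_iff.1 (ev1.and ev2)
  refine ⟨δ / 2, by positivity, δ, hδ, fun μ E t hμ hE ht => ?_⟩
  refine h (y := ((μ, E), t)) ?_
  rw [Prod.dist_eq, Prod.dist_eq, max_lt_iff, max_lt_iff, Real.dist_eq, Real.dist_eq, Real.dist_eq]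
  exact ⟨⟨hμ, hE⟩, ht.trans_lt (by linarith)⟩

theorem regPotential_sub_energy (μ E E' t : ℝ) :
    regPotential μ E 0 t - regPotential μ E' 0 t = -((E - E') * Real.sin t ^ 2 / 4) := by
  rw [regPotential_eq, regPotential_eq, Real.cosh_zero, Real.sin_sq]
  ring

theorem regPotential_saddleCenter {μ σ : ℝ} (h0 : 0 < μ) (h1 : μ < 1) (E : ℝ)
    (hσ : σ = 1 ∨ σ = -1) : regPotential μ E 0 (saddleCenter μ σ 3) =
      firstLagrangeRadius μ * (1 - firstLagrangeRadius μ) * (firstLagrangeValue μ - E) := by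
  rw [← regHamiltonian_saddleCenter h0 h1 E hσ, regHamiltonian, saddleCenter_zero_add,
    saddleCenter_one_apply, saddleCenter_two_apply]
  simp

/-- The energy of a symmetric critical point near the saddle-center. -/
theorem energy_of_critical {μ σ E a r : ℝ} (h0 : 0 < μ) (h1 : μ < 1) (hσ : σ = 1 ∨ σ = -1)
    (hE : ∀ t, |t - a| ≤ r → axisCurvature μ E t < 0)
    (hL : ∀ t, |t - a| ≤ r → axisCurvature μ (firstLagrangeValue μ) t < 0 ∧ Real.sin t ≠ 0)
    (hS : |saddleCenter μ σ 3 - a| ≤ r) {z : LiftedPhase} (hz : |z 3 - a| ≤ r)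
    (hR : reversor z = z) (hg : gradient (regHamiltonian μ E) z = 0) :
    firstLagrangeRadius μ * (1 - firstLagrangeRadius μ) * (firstLagrangeValue μ - E)
      ≤ regHamiltonian μ E z ∧
      (firstLagrangeValue μ < E → regHamiltonian μ E z < 0) := by
  rw [gradient_regHamiltonian] at hg
  have z1 : z 1 = 0 := by
    have : -z 1 = z 1 := congrArg (fun w : LiftedPhase => w 1) hR
    linarith
  have z2 : z 2 = 0 := by
    have : -z 2 = z 2 := congrArg (fun w : LiftedPhase => w 2) hR
    linarith
  have z0 : z 0 + Real.sin (2 * z 3) / 8 = 0 := congrArg (fun w : LiftedPhase => w 0) hg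
  have z3 : potentialK μ E 1 (Real.cos (z 3)) * Real.sin (z 3) = 0 := by
    have : (z 0 + Real.sin (2 * z 3) / 8) * (Real.cos (2 * z 3) / 4)
      - potentialK μ E (Real.cosh (z 2)) (Real.cos (z 3)) * Real.sin (z 3) = 0 :=
      congrArg (fun w : LiftedPhase => w 3) hg
    rw [z0, z2, Real.cosh_zero] at this
    linarith
  have hH : regHamiltonian μ E z = regPotential μ E 0 (z 3) := by
    rw [regHamiltonian, z0, z1, z2]; simp
  rw [hH]
  refine ⟨?_, fun hlt => ?_⟩
  · rw [← regPotential_saddleCenter h0 h1 E hσ]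
    exact le_of_axisCurvature_neg hE hz hS z3
  · have k1 := le_of_axisCurvature_neg (fun t ht => (hL t ht).1) hS hz (by
      rw [cos_saddleCenter h0 h1 hσ, potentialK_lagrange h0 h1, zero_mul])
    rw [regPotential_saddleCenter h0 h1 _ hσ, sub_self, mul_zero] at k1
    have k2 := regPotential_sub_energy μ E (firstLagrangeValue μ) (z 3)
    have k3 : 0 < Real.sin (z 3) ^ 2 := by
      have := (hL _ hz).2
      positivity
    have k4 := mul_pos (sub_pos.2 hlt) k3
    linarith

end CR3BP

namespace CR3BP

/-! ## The local model at the saddle-center -/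

/-- The constants of a chart at the saddle-center `S_σ(μ₀)` in which the regularized problem is close
to its normal form, uniformly in the parameters. -/
structure IsLocalModel (μ₀ σ ω l a ε ρ L : ℝ) (Θ : LiftedPhase ≃L[ℝ] LiftedPhase)
    (s₁ s₂ c m₁ m₂ δ : ℝ) : Prop where
  mass_pos : 0 < μ₀
  mass_lt : μ₀ < 1
  sign : σ = 1 ∨ σ = -1
  chart : IsNormalChart ω l a
    (hess (regHamiltonian μ₀ (firstLagrangeValue μ₀)) (saddleCenter μ₀ σ)) Θ (saddleCenter μ₀ σ)
  ρ_pos : 0 < ρ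
  L_nonneg : 0 ≤ L
  δ_pos : 0 < δ
  s₁_pos : 0 < s₁
  s₂_pos : 0 < s₂
  trace_pos : 0 < m₁ + m₂
  small : ‖(Θ : LiftedPhase →L[ℝ] LiftedPhase)‖ * ρ < Real.pi
  twist : ∀ μ E, |μ - μ₀| < δ → |E - firstLagrangeValue μ₀| < δ → ∀ w, ‖w‖ ≤ ρ → ∀ z,
    m₁ * (twist s₁ s₂ c z 0 ^ 2 + twist s₁ s₂ c z 2 ^ 2)
      + m₂ * (twist s₁ s₂ c z 1 ^ 2 + twist s₁ s₂ c z 3 ^ 2)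
      ≤ ⟪hess (regHamiltonian μ E) (saddleCenter μ₀ σ + Θ w) z, z⟫
  system : ∀ r, 0 < r → r ≤ ρ / 2 → ∃ δ' > 0, δ' ≤ δ ∧ ∀ μ E, |μ - μ₀| < δ' →
    |E - firstLagrangeValue μ₀| < δ' → ∃ zs, ‖zs‖ ≤ r ∧ IsSaddleCenterSystem ω l ε ρ
      (clampedField ω l Θ (saddleCenter μ₀ σ) (regHamiltonian μ E) ρ)
      (localEnergy a Θ (saddleCenter μ₀ σ) (regHamiltonian μ E))
      (localGradient a Θ (saddleCenter μ₀ σ) (regHamiltonian μ E)) zs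
  lipschitz_param : ∀ μ E E' w,
    ‖clampedField ω l Θ (saddleCenter μ₀ σ) (regHamiltonian μ E) ρ w
      - clampedField ω l Θ (saddleCenter μ₀ σ) (regHamiltonian μ E') ρ w‖ ≤ L * |E - E'|
  axis : ∀ μ E t, |μ - μ₀| < δ → |E - firstLagrangeValue μ₀| < δ →
    |t - saddleCenter μ₀ σ 3| ≤ ‖(Θ : LiftedPhase →L[ℝ] LiftedPhase)‖ * ρ →
    axisCurvature μ E t < 0 ∧ Real.sin t ≠ 0

theorem reversor_saddleCenter (μ σ : ℝ) : reversor (saddleCenter μ σ) = saddleCenter μ σ := by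
  apply lifted_ext <;> simp [reversor, saddleCenter]

theorem norm_chart_le (Θ : LiftedPhase ≃L[ℝ] LiftedPhase) {w : LiftedPhase} {r : ℝ}
    (hw : ‖w‖ ≤ r) : ‖Θ w‖ ≤ ‖(Θ : LiftedPhase →L[ℝ] LiftedPhase)‖ * r :=
  ((Θ : LiftedPhase →L[ℝ] LiftedPhase).le_opNorm w).trans (by gcongr)

theorem norm_clampedField_sub_le {ω l ρ : ℝ} {Θ : LiftedPhase ≃L[ℝ] LiftedPhase}
    {z₀ : LiftedPhase} {H H' : LiftedPhase → ℝ} (hρ : 0 ≤ ρ) {M : ℝ}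
    (h : ∀ z, ‖z - z₀‖ ≤ ‖(Θ : LiftedPhase →L[ℝ] LiftedPhase)‖ * (2 * ρ) →
      ‖gradient H z - gradient H' z‖ ≤ M) (w : LiftedPhase) :
    ‖clampedField ω l Θ z₀ H ρ w - clampedField ω l Θ z₀ H' ρ w‖ ≤
      ‖(Θ.symm : LiftedPhase →L[ℝ] LiftedPhase)‖ * M := by
  have e : clampedField ω l Θ z₀ H ρ w - clampedField ω l Θ z₀ H' ρ w =
      (Θ.symm : LiftedPhase →L[ℝ] LiftedPhase) (stdJL (gradient H (z₀ + Θ (clamp ρ w))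
        - gradient H' (z₀ + Θ (clamp ρ w)))) := by
    rw [map_sub, map_sub]
    simp only [clampedField, localField, hamVectorField, stdJL_apply,
      ContinuousLinearEquiv.coe_coe]
    abel
  rw [e]
  refine (ContinuousLinearMap.le_opNorm _ _).trans ?_
  rw [stdJL_apply, norm_stdJ]
  gcongr
  refine h _ ?_
  rw [add_sub_cancel_left]
  exact norm_chart_le Θ (norm_clamp_le hρ w)

theorem exists_localModel {μ₀ σ : ℝ} (h0 : 0 < μ₀) (h1 : μ₀ < 1) (hσ : σ = 1 ∨ σ = -1) :
    ∃ (ω l a ε ρ L : ℝ) (Θ : LiftedPhase ≃L[ℝ] LiftedPhase) (s₁ s₂ c m₁ m₂ δ : ℝ),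
      IsLocalModel μ₀ σ ω l a ε ρ L Θ s₁ s₂ c m₁ m₂ δ := by
  have hb := curvatureB_pos h0 h1
  have hv := curvatureV_pos h0 h1
  have hg := gyration_pos h0 h1
  set E₀ := firstLagrangeValue μ₀ with hE₀
  set z₀ := saddleCenter μ₀ σ with hz₀
  obtain ⟨ω, l, a, Θ, hω, hl, ha, hflow, hquad, hrefl⟩ := exists_normalForm hb hv hg
  obtain ⟨s₁, s₂, m₁, m₂, η₁, hs₁, hs₂, hm, hη₁, htwist⟩ := exists_twist_bound hb hv (gyration μ₀)
  have hA := hess_saddleCenter h0 h1 hσ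
  have N : IsNormalChart ω l a (hess (regHamiltonian μ₀ E₀) z₀) Θ z₀ :=
    ⟨hω, hl, ha, fun w => by rw [hA, hflow], fun w w' => by rw [hA, hquad], hrefl,
      reversor_saddleCenter μ₀ σ⟩
  set nΘ := ‖(Θ : LiftedPhase →L[ℝ] LiftedPhase)‖ with hnΘ
  set nS := ‖(Θ.symm : LiftedPhase →L[ℝ] LiftedPhase)‖ with hnS
  have hnΘ0 : 0 ≤ nΘ := norm_nonneg _
  have hnS0 : 0 ≤ nS := norm_nonneg _
  set ε := min (min (l / 18) (ω / 5)) (1 / 10) with hε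
  have hε0 : 0 < ε := lt_min (lt_min (by positivity) (by positivity)) (by norm_num)
  have ε1 : ε ≤ l / 18 := (min_le_left _ _).trans (min_le_left _ _)
  have ε2 : ε ≤ ω / 5 := (min_le_left _ _).trans (min_le_right _ _)
  have ε3 : ε ≤ 1 / 10 := min_le_right _ _
  set η := min η₁ (min (ε / (nS * nΘ + 1)) (ε / (a⁻¹ * nΘ * nΘ + 1))) with hη
  have hη0 : 0 < η := lt_min hη₁ (lt_min (by positivity) (by positivity))
  have η2 : nS * η * nΘ ≤ ε := by
    have : η ≤ ε / (nS * nΘ + 1) := (min_le_right _ _).trans (min_le_left _ _)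
    rw [le_div_iff₀ (by positivity)] at this
    linarith
  have η3 : a⁻¹ * nΘ * η * nΘ ≤ ε := by
    have : η ≤ ε / (a⁻¹ * nΘ * nΘ + 1) := (min_le_right _ _).trans (min_le_right _ _)
    rw [le_div_iff₀ (by positivity)] at this
    linarith
  obtain ⟨R₁, hR₁, δ₁, hδ₁, hclose⟩ := exists_hess_close μ₀ E₀ z₀ hη0
  obtain ⟨R₂, hR₂, δ₂, hδ₂, haxis⟩ := exists_axisCurvature_neg h0 h1 hσ
  set R := min (min R₁ R₂) 3 with hR
  have hR0 : 0 < R := lt_min (lt_min hR₁ hR₂) (by norm_num)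
  have R1 : R ≤ R₁ := (min_le_left _ _).trans (min_le_left _ _)
  have R2 : R ≤ R₂ := (min_le_left _ _).trans (min_le_right _ _)
  have R3 : R ≤ 3 := min_le_right _ _
  set ρ := R / (2 * (nΘ + 1)) with hρ
  have hρ0 : 0 < ρ := by positivity
  have hρR : nΘ * (2 * ρ) ≤ R := by
    have : 2 * ρ * (nΘ + 1) = R := by rw [hρ]; field_simp
    nlinarith
  have hρR' : nΘ * ρ ≤ R := by nlinarith [mul_nonneg hnΘ0 hρ0.le]
  obtain ⟨L, hL0, hL⟩ := exists_gradient_lipschitz z₀ (nΘ * (2 * ρ))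
  set δ := min δ₁ δ₂ with hδ
  have hδ0 : 0 < δ := lt_min hδ₁ hδ₂
  have d1 : δ ≤ δ₁ := min_le_left _ _
  have d2 : δ ≤ δ₂ := min_le_right _ _
  have hcl : ∀ μ E, |μ - μ₀| < δ → |E - E₀| < δ → ∀ w, ‖w‖ ≤ 2 * ρ →
      ‖hess (regHamiltonian μ E) (z₀ + Θ w) - hess (regHamiltonian μ₀ E₀) z₀‖ ≤ η :=
    fun μ E hμ hE w hw => hclose μ E (hμ.trans_le d1) (hE.trans_le d1) _ (by
      rw [add_sub_cancel_left]
      exact (norm_chart_le Θ hw).trans (hρR.trans R1))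
  refine ⟨ω, l, a, ε, ρ, nS * L, Θ, s₁, s₂, 1 / 4 - gyration μ₀, m₁, m₂, δ, h0, h1, hσ, N, hρ0,
    by positivity, hδ0, hs₁, hs₂, hm, ?_, ?_, ?_, ?_, ?_⟩
  · exact lt_of_le_of_lt (hρR'.trans R3) Real.pi_gt_three
  · intro μ E hμ hE w hw
    refine htwist _ fun z => ?_
    have e : hess (regHamiltonian μ E) (z₀ + Θ w) z
        - saddleHess (curvatureB μ₀) (curvatureV μ₀) (gyration μ₀) z =
        (hess (regHamiltonian μ E) (z₀ + Θ w) - hess (regHamiltonian μ₀ E₀) z₀) z := by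
      rw [sub_apply, hA]
    rw [e]
    refine (ContinuousLinearMap.le_opNorm _ _).trans ?_
    gcongr
    exact (hcl μ E hμ hE w (by linarith)).trans (min_le_left _ _)
  · intro r hr hrρ
    set m := min (ω / 2) (l / 2) with hm
    have hm0 : 0 < m := lt_min (by positivity) (by positivity)
    obtain ⟨δ₃, hδ₃, hgr⟩ := exists_gradient_close μ₀ E₀ z₀ (gradient_saddleCenter h0 h1 hσ)
      (η := m * r / (nS + 1)) (by positivity)
    refine ⟨min δ δ₃, lt_min hδ0 hδ₃, min_le_left _ _, fun μ E hμ hE => ?_⟩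
    refine N.exists_isSaddleCenterSystem (contDiff_regHamiltonian μ E)
      (regHamiltonian_reversor μ E) hε0.le (by linarith) (by linarith) (by linarith) hρ0 η2 η3
      (hcl μ E (hμ.trans_le (min_le_left _ _)) (hE.trans_le (min_le_left _ _))) hrρ ?_
    have h3 := hgr μ E (hμ.trans_le (min_le_right _ _)) (hE.trans_le (min_le_right _ _))
    rw [le_div_iff₀ (by positivity)] at h3
    have h4 := norm_nonneg (gradient (regHamiltonian μ E) z₀)
    linarith
  · intro μ E E' w
    rw [mul_assoc]
    exact norm_clampedField_sub_le hρ0.le (fun z hz => hL μ E E' z hz) w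
  · intro μ E t hμ hE ht
    exact haxis μ E t (hμ.trans_le d2) (hE.trans_le d2) (ht.trans (hρR'.trans R2))

/-! ## Trajectories in the chart -/

section

variable {ω l a ρ ε : ℝ} {A : LiftedPhase →L[ℝ] LiftedPhase}
  {Θ : LiftedPhase ≃L[ℝ] LiftedPhase} {z₀ : LiftedPhase} {H : LiftedPhase → ℝ}

theorem hasDerivAt_chart_trajectory {w : ℝ → LiftedPhase}
    (hw : IsTrajectory (clampedField ω l Θ z₀ H ρ) w) {t : ℝ} (hb : ‖w t‖ ≤ ρ) :
    HasDerivAt (fun t => z₀ + Θ (w t)) (hamVectorField H (z₀ + Θ (w t))) t := by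
  have h1 := (hasFDerivAt_chart (Θ := Θ) (z₀ := z₀) (w t)).comp_hasDerivAt t (hw t)
  rw [clampedField_eq hb, localField, ContinuousLinearEquiv.coe_coe, Θ.apply_symm_apply] at h1
  exact h1

theorem isTrajectory_chart {γ : ℝ → LiftedPhase} (hγ : ∀ t, HasDerivAt γ (hamVectorField H (γ t)) t)
    (hb : ∀ t, ‖Θ.symm (γ t - z₀)‖ ≤ ρ) :
    IsTrajectory (clampedField ω l Θ z₀ H ρ) fun t => Θ.symm (γ t - z₀) := fun t => by
  have h1 := (Θ.symm : LiftedPhase →L[ℝ] LiftedPhase).hasFDerivAt.comp_hasDerivAt t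
    ((hγ t).sub_const z₀)
  rw [clampedField_eq (hb t), localField, Θ.apply_symm_apply, add_sub_cancel]
  exact h1

/-- A trajectory which starts near the rest point stays in the chart for a long time. -/
theorem IsSaddleCenterSystem.norm_chart_le {zs : LiftedPhase}
    (S : IsSaddleCenterSystem ω l ε ρ (clampedField ω l Θ z₀ H ρ) (localEnergy a Θ z₀ H)
      (localGradient a Θ z₀ H) zs) (hH : ContDiff ℝ 2 H) {r τ : ℝ} (hzs : ‖zs‖ ≤ r) (hτ : 0 < τ)
    (hr : 2 * r * Real.exp ((ω + l + ε) * τ) + r ≤ ρ) {γ : ℝ → LiftedPhase}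
    (hγ : ∀ t, HasDerivAt γ (hamVectorField H (γ t)) t) {t₀ : ℝ}
    (h0 : ‖Θ.symm (γ t₀ - z₀)‖ ≤ r) {t : ℝ} (ht : |t - t₀| ≤ τ) :
    ‖Θ.symm (γ t - z₀)‖ ≤ ρ := by
  have hω := S.ω_pos
  have hl := S.l_pos
  have hε := S.ε_nonneg
  have hr0 : 0 ≤ r := (norm_nonneg _).trans hzs
  obtain ⟨w₁, hw₁0, hw₁⟩ := S.exists_trajectory (Θ.symm (γ t₀ - z₀))
  set w : ℝ → LiftedPhase := fun t => w₁ (t + -t₀) with hwdef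
  have hw : IsTrajectory (clampedField ω l Θ z₀ H ρ) w := hw₁.shift (-t₀)
  have hw0 : w t₀ = Θ.symm (γ t₀ - z₀) := by
    rw [hwdef]; simp only; rw [add_neg_cancel, hw₁0]
  have hb : ∀ t, |t - t₀| ≤ τ → ‖w t‖ ≤ ρ := fun t ht => by
    have h1 := dist_trajectories_le (f := clampedField ω l Θ z₀ H ρ)
      (g := clampedField ω l Θ z₀ H ρ) (η := 0) S.lipschitz (fun z => by simp) hw₁
      S.isTrajectory_rest (t + -t₀)
    rw [gronwallBound_ε0, Real.coe_toNNReal _ (by positivity), dist_eq_norm, dist_eq_norm,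
      hw₁0] at h1
    have h2 : ‖Θ.symm (γ t₀ - z₀) - zs‖ ≤ 2 * r := (norm_sub_le _ _).trans (by linarith)
    have h3 : Real.exp ((ω + l + ε) * |t + -t₀|) ≤ Real.exp ((ω + l + ε) * τ) := by
      rw [← sub_eq_add_neg]
      gcongr
    have h4 := mul_le_mul h2 h3 (Real.exp_pos _).le (by positivity)
    have h5 := norm_add_le (w t - zs) zs
    rw [sub_add_cancel] at h5
    have h6 : ‖w t - zs‖ ≤ 2 * r * Real.exp ((ω + l + ε) * τ) := h1.trans h4
    linarith
  have ht' := abs_le.1 ht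
  have heq := eqOn_of_hasDerivAt (contDiff_hamVectorField hH) (a := t₀ - τ) (b := t₀ + τ)
    (t₀ := t₀) ⟨by linarith, by linarith⟩ (γ₁ := γ) (γ₂ := fun t => z₀ + Θ (w t))
    (fun t _ => hγ t) (fun t ht => hasDerivAt_chart_trajectory hw
      (hb t (abs_le.2 ⟨by linarith [ht.1], by linarith [ht.2]⟩)))
    (by simp only [hw0]; rw [Θ.apply_symm_apply, add_sub_cancel])
    (x := t) ⟨by linarith, by linarith⟩
  rw [heq]
  simp only
  rw [add_sub_cancel_left, Θ.symm_apply_apply]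
  exact hb t ht

end

end CR3BP

namespace CR3BP

theorem IsPeriodicOrbit.add_deck {H : LiftedPhase → ℝ} {γ : ℝ → LiftedPhase} {T : ℝ}
    (h : IsPeriodicOrbit H γ T) (hp : ∀ z k, H (z + deck k) = H z) (k : ℤ) :
    IsPeriodicOrbit H (fun t => γ t + deck k) T where
  pos := h.pos
  trajectory t := by
    rw [hamVectorField_add_deck hp]
    exact (h.trajectory t).add_const _
  level t := by rw [hp, h.level]
  periodic t := by rw [toPhase_add_deck, toPhase_add_deck, h.periodic]
  nonconstant := by
    obtain ⟨t, ht⟩ := h.nonconstant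
    exact ⟨t, by rwa [toPhase_add_deck, toPhase_add_deck]⟩

theorem continuous_regHamiltonian_energy (μ : ℝ) :
    Continuous fun p : ℝ × LiftedPhase => regHamiltonian μ p.1 p.2 := by
  have h0 := (continuous_coord 0).comp (continuous_snd (X := ℝ))
  have h1 := (continuous_coord 1).comp (continuous_snd (X := ℝ))
  have h2 := (continuous_coord 2).comp (continuous_snd (X := ℝ))
  have h3 := (continuous_coord 3).comp (continuous_snd (X := ℝ))
  simp only [Function.comp_def] at h0 h1 h2 h3
  unfold regHamiltonian regPotential
  fun_prop

theorem IsSaddleCenterSystem.gradient_chart_rest {ω l a ρ ε : ℝ}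
    {Θ : LiftedPhase ≃L[ℝ] LiftedPhase} {z₀ zs : LiftedPhase} {H : LiftedPhase → ℝ}
    (S : IsSaddleCenterSystem ω l ε ρ (clampedField ω l Θ z₀ H ρ) (localEnergy a Θ z₀ H)
      (localGradient a Θ z₀ H) zs) : gradient H (z₀ + Θ zs) = 0 := by
  have h := S.rest
  rw [clampedField_eq S.norm_rest_le, localField, map_eq_zero_iff _ Θ.symm.injective,
    hamVectorField] at h
  rw [← norm_eq_zero, ← norm_stdJ, h, norm_zero]

namespace IsLocalModel

variable {μ₀ σ ω l a ε ρ L : ℝ} {Θ : LiftedPhase ≃L[ℝ] LiftedPhase} {s₁ s₂ c m₁ m₂ δ : ℝ}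

theorem abs_chart_sub_le {w : LiftedPhase} (hw : ‖w‖ ≤ ρ) (z₀ : LiftedPhase) :
    |(z₀ + Θ w) 3 - z₀ 3| ≤ ‖(Θ : LiftedPhase →L[ℝ] LiftedPhase)‖ * ρ := by
  rw [PiLp.add_apply, add_sub_cancel_left]
  exact (abs_coord_le_norm _ 3).trans (norm_chart_le Θ hw)

theorem eq_of_toPhase_chart_eq (M : IsLocalModel μ₀ σ ω l a ε ρ L Θ s₁ s₂ c m₁ m₂ δ)
    {z₀ w w' : LiftedPhase} (hw : ‖w‖ ≤ ρ) (hw' : ‖w'‖ ≤ ρ)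
    (h : toPhase (z₀ + Θ w) = toPhase (z₀ + Θ w')) : w = w' := by
  have h1 := eq_of_toPhase_eq h (by
    rw [add_sub_add_left_eq_sub]
    refine (norm_sub_le _ _).trans_lt ?_
    have := M.small
    linarith [norm_chart_le Θ hw, norm_chart_le Θ hw'])
  exact Θ.injective (add_left_cancel h1)

/-- The energy of the rest point changes its sign at the first Lagrange value. -/
theorem energy_rest (M : IsLocalModel μ₀ σ ω l a ε ρ L Θ s₁ s₂ c m₁ m₂ δ) {μ E : ℝ} (h0 : 0 < μ)
    (h1 : μ < 1) (hμ : |μ - μ₀| < δ) (hL : |firstLagrangeValue μ - firstLagrangeValue μ₀| < δ)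
    (hE : |E - firstLagrangeValue μ₀| < δ)
    (hS : ‖Θ.symm (saddleCenter μ σ - saddleCenter μ₀ σ)‖ ≤ ρ) {zs : LiftedPhase}
    (S : IsSaddleCenterSystem ω l ε ρ
      (clampedField ω l Θ (saddleCenter μ₀ σ) (regHamiltonian μ E) ρ)
      (localEnergy a Θ (saddleCenter μ₀ σ) (regHamiltonian μ E))
      (localGradient a Θ (saddleCenter μ₀ σ) (regHamiltonian μ E)) zs) :
    a⁻¹ * (firstLagrangeRadius μ * (1 - firstLagrangeRadius μ) * (firstLagrangeValue μ - E)) ≤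
        localEnergy a Θ (saddleCenter μ₀ σ) (regHamiltonian μ E) zs ∧
      (firstLagrangeValue μ < E →
        localEnergy a Θ (saddleCenter μ₀ σ) (regHamiltonian μ E) zs < 0) := by
  have ha := M.chart.a_pos
  have hS3 : |saddleCenter μ σ 3 - saddleCenter μ₀ σ 3| ≤
      ‖(Θ : LiftedPhase →L[ℝ] LiftedPhase)‖ * ρ := by
    have := abs_chart_sub_le (Θ := Θ) hS (saddleCenter μ₀ σ)
    rwa [Θ.apply_symm_apply, add_sub_cancel] at this
  have hrev : reversor (saddleCenter μ₀ σ + Θ zs) = saddleCenter μ₀ σ + Θ zs := by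
    rw [← reversorL_apply, map_add, reversorL_apply, reversorL_apply, reversor_saddleCenter,
      ← M.chart.map_refl, S.refl_rest]
  obtain ⟨k1, k2⟩ := energy_of_critical h0 h1 M.sign (fun t ht => (M.axis μ E t hμ hE ht).1)
    (fun t ht => M.axis μ _ t hμ hL ht) hS3
    (abs_chart_sub_le S.norm_rest_le _) hrev S.gradient_chart_rest
  exact ⟨mul_le_mul_of_nonneg_left k1 (by positivity),
    fun hlt => mul_neg_of_pos_of_neg (by positivity) (k2 hlt)⟩

/-- A periodic orbit in the chart has energy above the first Lagrange value and covers a Lyapunov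
orbit. -/
theorem exists_lyapunov (M : IsLocalModel μ₀ σ ω l a ε ρ L Θ s₁ s₂ c m₁ m₂ δ) {μ E δ' : ℝ}
    (h0 : 0 < μ) (h1 : μ < 1) (hδ' : δ' ≤ δ) (hμ : |μ - μ₀| < δ')
    (hL : |firstLagrangeValue μ - firstLagrangeValue μ₀| < δ')
    (hE : |E - firstLagrangeValue μ₀| < δ')
    (hS : ‖Θ.symm (saddleCenter μ σ - saddleCenter μ₀ σ)‖ ≤ ρ)
    (ha : a⁻¹ * δ' ≤ ρ ^ 2 / 196)
    (hsys : ∀ e, |e - firstLagrangeValue μ₀| < δ' → ∃ zs, IsSaddleCenterSystem ω l ε ρ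
      (clampedField ω l Θ (saddleCenter μ₀ σ) (regHamiltonian μ e) ρ)
      (localEnergy a Θ (saddleCenter μ₀ σ) (regHamiltonian μ e))
      (localGradient a Θ (saddleCenter μ₀ σ) (regHamiltonian μ e)) zs)
    {γ : ℝ → LiftedPhase} {T : ℝ} (hγ : IsPeriodicOrbit (regHamiltonian μ E) γ T)
    (hb : ∀ t, ‖Θ.symm (γ t - saddleCenter μ₀ σ)‖ ≤ ρ) :
    ∃ (γ' : ℝ → LiftedPhase) (T' : ℝ), IsLyapunovOrbit μ E γ' T' ∧ IsCoverOf γ T γ' T' := by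
  have ha0 := M.chart.a_pos
  have hρ := M.ρ_pos
  choose! zs hzs using hsys
  set z₀ := saddleCenter μ₀ σ with hz₀
  set E₁ := firstLagrangeValue μ with hE₁
  set ϱ := firstLagrangeRadius μ * (1 - firstLagrangeRadius μ) with hϱ
  have hϱ0 : 0 < ϱ := radius_mul_pos h0 h1
  have hϱ4 : ϱ ≤ 1 / 4 := by nlinarith [sq_nonneg (firstLagrangeRadius μ - 1 / 2)]
  have hen := fun e (he : |e - firstLagrangeValue μ₀| < δ') =>
    M.energy_rest h0 h1 (hμ.trans_le hδ') (hL.trans_le hδ') (he.trans_le hδ') hS (hzs e he)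
  set w : ℝ → LiftedPhase := fun t => Θ.symm (γ t - z₀) with hw
  have hwγ : ∀ t, γ t = z₀ + Θ (w t) := fun t => by
    rw [hw]; simp only; rw [Θ.apply_symm_apply, add_sub_cancel]
  have hwt := isTrajectory_chart (ω := ω) (l := l) hγ.trajectory hb
  have hw0 : localEnergy a Θ z₀ (regHamiltonian μ E) (w 0) = 0 := by
    rw [localEnergy, ← hwγ, hγ.level, mul_zero]
  have hne : w 0 ≠ zs E := fun heq => by
    have h2 := (hzs E hE).unique hwt (hzs E hE).isTrajectory_rest (t₀ := 0) heq
    obtain ⟨t, ht⟩ := hγ.nonconstant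
    refine ht ?_
    rw [hwγ, hwγ]
    have e1 : w t = zs E := congrFun h2 t
    rw [e1, heq]
  have hwT : ∀ t, w (t + T) = w t := fun t =>
    M.eq_of_toPhase_chart_eq (hb _) (hb _) (by rw [← hwγ, ← hwγ, hγ.periodic])
  -- no such orbit below the Lagrange value
  have hlt : E₁ < E := by
    by_contra hcon
    have k1 := (hen E hE).1
    have k2 : 0 ≤ a⁻¹ * (ϱ * (E₁ - E)) := by
      have := sub_nonneg.2 (not_lt.1 hcon)
      positivity
    have c1 := (hzs E hE).inCenterCone_sub_rest hwt hb 0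
    have k3 := ((hzs E hE).energy_bounds (d := w 0 - zs E)
      (by rw [add_sub_cancel]; exact hb 0) c1).1
    rw [add_sub_cancel, hw0] at k3
    have k4 := c1.norm_sq_le
    refine hne (sub_eq_zero.1 (norm_eq_zero.1 ?_))
    have k5 : ‖w 0 - zs E‖ ^ 2 ≤ 0 := by linarith
    exact pow_eq_zero_iff two_ne_zero |>.1 (le_antisymm k5 (sq_nonneg _))
  have habs : ∀ e ∈ Set.Icc E₁ E, |e - firstLagrangeValue μ₀| < δ' := fun e he => by
    rw [abs_lt] at hL hE ⊢
    exact ⟨by linarith [he.1], by linarith [he.2]⟩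
  have habs' : ∀ e ∈ Set.Ioc E₁ E, |e - firstLagrangeValue μ₀| < δ' := fun e he =>
    habs e (Set.Ioc_subset_Icc_self he)
  have F : IsSaddleCenterFamily ω l ε ρ L (Set.Ioc E₁ E)
      (fun e => clampedField ω l Θ z₀ (regHamiltonian μ e) ρ)
      (fun e => localEnergy a Θ z₀ (regHamiltonian μ e))
      (fun e => localGradient a Θ z₀ (regHamiltonian μ e)) zs :=
    { system := fun e he => hzs e (habs' e he)
      lipschitz_param := fun e _ e' _ z => M.lipschitz_param μ e e' z
      continuousOn_energy := by
        have hc : Continuous fun p : ℝ × LiftedPhase => (p.1, z₀ + Θ p.2) :=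
          continuous_fst.prodMk (continuous_const.add (Θ.continuous.comp continuous_snd))
        exact (continuous_const.mul ((continuous_regHamiltonian_energy μ).comp hc)).continuousOn
      energy_neg := fun e he => (hen e (habs' e he)).2 he.1
      energy_ge := fun e he => by
        refine le_trans ?_ (hen e (habs' e he)).1
        have i1 : e - E₁ ≤ 2 * δ' := by
          have := (abs_lt.1 (habs' e he)).2
          have := (abs_lt.1 hL).1
          linarith
        have i2 : ϱ * (e - E₁) ≤ δ' := by
          have := mul_le_mul hϱ4 i1 (by linarith [he.1]) (by norm_num)
          have := (abs_nonneg _).trans_lt hμ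
          linarith
        have i3 := mul_le_mul_of_nonneg_left i2 (inv_pos.2 ha0).le
        linarith }
  obtain ⟨G, P, hGc, hPc, hG⟩ := F.exists_family
  have hE' : E ∈ Set.Ioc E₁ E := ⟨hlt, le_rfl⟩
  refine ⟨fun t => z₀ + Θ (G E t), P E, ⟨hlt, fun e t => z₀ + Θ (G e t), P, rfl, rfl, ?_, hPc, ?_,
    σ, M.sign, ?_⟩, ?_⟩
  · exact continuousOn_const.add (Θ.continuous.comp_continuousOn hGc)
  · intro e he
    obtain ⟨g1, g2, g3, g4, g5, g6, g7⟩ := hG e he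
    have hmin : ∀ t, 0 < t → t < P e →
        toPhase (z₀ + Θ (G e t)) ≠ toPhase (z₀ + Θ (G e 0)) := fun t ht0 htP heq => by
      obtain ⟨k, hk1, hk2⟩ := g7 t ht0 (M.eq_of_toPhase_chart_eq (g2 t) (g2 0) heq)
      have hk1' : (1 : ℝ) ≤ k := by exact_mod_cast hk1
      nlinarith
    exact
      { pos := g5
        trajectory := fun t => hasDerivAt_chart_trajectory g1 (g2 t)
        level := fun t => by
          have := (hzs e (habs' e he)).energy_eq g1 g2 t 0
          rw [g3, localEnergy] at this
          exact (mul_eq_zero.1 this).resolve_left (inv_ne_zero ha0.ne')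
        periodic := fun t => by
          change toPhase (z₀ + Θ (G e (t + P e))) = toPhase (z₀ + Θ (G e t))
          rw [g6]
        nonconstant := ⟨P e / 2, hmin _ (by linarith) (by linarith)⟩
        minimal := hmin }
  · -- the family shrinks to the saddle-center
    intro W hW
    set wS := Θ.symm (saddleCenter μ σ - z₀) with hwS
    have hzS : z₀ + Θ wS = saddleCenter μ σ := by
      rw [hwS, Θ.apply_symm_apply, add_sub_cancel]
    have hI₁ : E₁ ∈ Set.Icc E₁ E := ⟨le_rfl, hlt.le⟩
    have S₁ := hzs E₁ (habs E₁ hI₁)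
    have hrest : zs E₁ = wS := by
      have hX : IsTrajectory (clampedField ω l Θ z₀ (regHamiltonian μ E₁) ρ) fun _ => wS :=
        fun t => by
          have : clampedField ω l Θ z₀ (regHamiltonian μ E₁) ρ wS = 0 := by
            rw [clampedField_eq hS, localField, hzS, hamVectorField,
              gradient_saddleCenter h0 h1 M.sign, ← stdJL_apply, map_zero, map_zero]
          rw [this]
          exact hasDerivAt_const t wS
      have c1 := S₁.inCenterCone_sub_rest hX (fun _ => hS) 0
      have k1 := (S₁.energy_bounds (d := wS - zs E₁) (by simpa using hS) c1).1
      have k2 : localEnergy a Θ z₀ (regHamiltonian μ E₁) wS = 0 := by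
        rw [localEnergy, hzS, regHamiltonian_saddleCenter h0 h1 _ M.sign, sub_self, mul_zero,
          mul_zero]
      have k3 := (hen E₁ (habs E₁ hI₁)).1
      rw [sub_self, mul_zero, mul_zero] at k3
      rw [add_sub_cancel, k2] at k1
      have k4 := c1.norm_sq_le
      have k5 : ‖wS - zs E₁‖ ^ 2 ≤ 0 := by linarith
      exact (sub_eq_zero.1 (norm_eq_zero.1
        (pow_eq_zero_iff two_ne_zero |>.1 (le_antisymm k5 (sq_nonneg _))))).symm
    obtain ⟨η, hη, hηW⟩ := Metric.mem_nhds_iff.1 (continuous_toPhase.continuousAt hW)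
    have hω := S₁.ω_pos
    have hl := S₁.l_pos
    set m := min (ω / 2) (l / 2) with hm
    have hm0 : 0 < m := lt_min (by positivity) (by positivity)
    set B : ℝ → ℝ := fun e => ‖(Θ : LiftedPhase →L[ℝ] LiftedPhase)‖ *
      (Real.sqrt (5 * (a⁻¹ * (ϱ * (e - E₁)))) + L * |E₁ - e| / m) with hB
    have hBc : Continuous B := by fun_prop
    have hB0 : B E₁ = 0 := by simp [hB]
    have hBlt : ∀ᶠ e in 𝓝[>] E₁, B e < η :=
      (hBc.continuousAt.eventually_lt continuousAt_const (by rw [hB0]; exact hη)).filter_mono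
        nhdsWithin_le_nhds
    filter_upwards [hBlt, Ioc_mem_nhdsGT hlt] with e he heI t
    obtain ⟨g1, g2, g3, -⟩ := hG e heI
    have Se := hzs e (habs' e heI)
    refine hηW ?_
    rw [Metric.mem_ball, dist_eq_norm, ← hzS, add_sub_add_left_eq_sub, ← map_sub]
    refine lt_of_le_of_lt (norm_chart_le Θ ?_) he
    have d1 : ‖G e t - zs e‖ ≤ Real.sqrt (5 * (a⁻¹ * (ϱ * (e - E₁)))) := by
      refine Real.le_sqrt_of_sq_le ?_
      have c1 := Se.inCenterCone_sub_rest g1 g2 t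
      have k1 := (Se.energy_bounds (d := G e t - zs e) (by simpa using g2 t) c1).1
      rw [add_sub_cancel, Se.energy_eq g1 g2 t 0, g3] at k1
      have k2 := (hen e (habs' e heI)).1
      have k3 := c1.norm_sq_le
      linarith
    have d2 : ‖zs e - zs E₁‖ ≤ L * |E₁ - e| / m := by
      rw [le_div_iff₀' hm0]
      exact S₁.norm_rest_sub_le Se (M.lipschitz_param μ E₁ e)
    have d3 := norm_sub_le_norm_sub_add_norm_sub (G e t) (zs e) wS
    rw [← hrest] at d3 ⊢
    linarith
  · -- the given orbit is a cover
    obtain ⟨g1, g2, g3, g4, g5, g6, g7⟩ := hG E hE'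
    obtain ⟨s, hs⟩ := (hzs E hE).exists_shift hwt g1 hb g2 hne g4 (by rw [g3]; exact hw0)
    have hs' : ∀ t, w t = G E (t + s) := hs
    obtain ⟨k, hk1, hk2⟩ := g7 T hγ.pos (by
      have := hwT (-s)
      rw [hs', hs', neg_add_cancel, show -s + T + s = T by ring] at this
      exact this)
    refine ⟨k, hk1, hk2, s, fun t => ?_⟩
    rw [hwγ, hs']

/-- A periodic orbit near the saddle-center either stays in the chart or has a large index. -/
theorem exists_index_of_long (M : IsLocalModel μ₀ σ ω l a ε ρ L Θ s₁ s₂ c m₁ m₂ δ) {μ E r τ : ℝ}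
    (hμ : |μ - μ₀| < δ) (hE : |E - firstLagrangeValue μ₀| < δ) {zs : LiftedPhase}
    (S : IsSaddleCenterSystem ω l ε ρ
      (clampedField ω l Θ (saddleCenter μ₀ σ) (regHamiltonian μ E) ρ)
      (localEnergy a Θ (saddleCenter μ₀ σ) (regHamiltonian μ E))
      (localGradient a Θ (saddleCenter μ₀ σ) (regHamiltonian μ E)) zs) (hzs : ‖zs‖ ≤ r)
    (hτ : 0 < τ) (hr : 2 * r * Real.exp ((ω + l + ε) * τ) + r ≤ ρ) {γ : ℝ → LiftedPhase} {T : ℝ}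
    (hγ : IsPeriodicOrbit (regHamiltonian μ E) γ T) {k : ℤ} {t₀ : ℝ} (ht₀ : t₀ ∈ Set.Ico 0 T)
    (hstart : ‖Θ.symm (γ t₀ + deck k - saddleCenter μ₀ σ)‖ ≤ r) :
    (∀ t, ‖Θ.symm (γ t + deck k - saddleCenter μ₀ σ)‖ ≤ ρ) ∨
      ∃ m : ℤ, IsConleyZehnderIndex (regHamiltonian μ E) γ T m ∧
        (m₁ + m₂) * (τ / 2) / Real.pi - 7 ≤ m := by
  have hp := regHamiltonian_add_deck μ E
  have hH := contDiff_regHamiltonian μ E (n := 2)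
  have hγ' := hγ.add_deck hp k
  have hstay : ∀ t, |t - t₀| ≤ τ → ‖Θ.symm (γ t + deck k - saddleCenter μ₀ σ)‖ ≤ ρ := fun t ht =>
    S.norm_chart_le hH hzs hτ hr hγ'.trajectory hstart ht
  have hchart : ∀ t, γ t + deck k =
      saddleCenter μ₀ σ + Θ (Θ.symm (γ t + deck k - saddleCenter μ₀ σ)) := fun t => by
    rw [Θ.apply_symm_apply, add_sub_cancel]
  rcases lt_or_ge T τ with hT | hT
  · left
    have h1 : γ (t₀ + T) = γ t₀ := by
      have e1 := hstay (t₀ + T) (by rw [add_sub_cancel_left, abs_of_pos hγ.pos]; exact hT.le)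
      have e2 := hstay t₀ (by rw [sub_self, abs_zero]; exact hτ.le)
      have e3 := M.eq_of_toPhase_chart_eq (z₀ := saddleCenter μ₀ σ) e1 e2 (by
        rw [← hchart, ← hchart]
        exact hγ'.periodic t₀)
      have e4 := hchart (t₀ + T)
      rw [e3, ← hchart] at e4
      exact add_right_cancel e4
    obtain ⟨j, hj⟩ := hγ.exists_deck hp
    have hj0 : deck j = 0 := by
      have := hj t₀
      rw [h1] at this
      exact left_eq_add.1 this
    have hper : Function.Periodic γ T := fun t => by rw [hj, hj0, add_zero]
    intro t
    obtain ⟨y, hy, hyt⟩ := hper.exists_mem_Ico hγ.pos t t₀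
    rw [hyt]
    refine hstay y (abs_le.2 ⟨by linarith [hy.1], by linarith [hy.2]⟩)
  · right
    obtain ⟨t₁, h₁, h₂, h₃⟩ : ∃ t₁, 0 ≤ t₁ ∧ t₁ + τ / 2 ≤ T ∧
        ∀ t ∈ Set.Icc t₁ (t₁ + τ / 2), |t - t₀| ≤ τ := by
      rcases le_total t₀ (τ / 2) with h | h
      · exact ⟨t₀, ht₀.1, by linarith, fun t ht => abs_le.2 ⟨by linarith [ht.1], by linarith [ht.2]⟩⟩
      · exact ⟨t₀ - τ / 2, by linarith, by linarith [ht₀.2], fun t ht =>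
          abs_le.2 ⟨by linarith [ht.1], by linarith [ht.2]⟩⟩
    obtain ⟨m, hm, hle⟩ := hγ.exists_large_index hH hp (exists_vertical_bound μ E) M.s₁_pos
      M.s₂_pos c (m₁ := m₁) (m₂ := m₂) (t₁ := t₁) (t₂ := t₁ + τ / 2) h₁ (by linarith) h₂
      (fun t ht z => by
        have := M.twist μ E hμ hE _ (hstay t (h₃ t ht)) z
        rwa [← hchart, hess_add_deck hp] at this)
    refine ⟨m, hm, ?_⟩
    rwa [add_sub_cancel_left] at hle

end IsLocalModel

end CR3BP

namespace CR3BP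

theorem isOpenMap_toPhase : IsOpenMap toPhase := by
  have e : toPhase = (Prod.map id (Prod.map id ((↑) : ℝ → Real.Angle))) ∘
      (fun z : LiftedPhase => ((z 0, z 1), (z 2, z 3))) := rfl
  rw [e]
  refine IsOpenMap.comp (IsOpenMap.id.prodMap (IsOpenMap.id.prodMap
    (QuotientAddGroup.isOpenMap_coe))) ?_
  refine IsOpenMap.of_sections fun z => ⟨fun p => !₂[p.1.1, p.1.2, p.2.1, p.2.2], ?_, ?_, ?_⟩
  · refine ((PiLp.continuous_toLp 2 _).comp ?_).continuousAt
    refine continuous_pi fun i => ?_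
    fin_cases i <;> simp <;> fun_prop
  · ext i
    fin_cases i <;> rfl
  · intro p
    rfl

theorem IsCoverOf.of_add_deck {γ γ' : ℝ → LiftedPhase} {T T' : ℝ} {k : ℤ}
    (h : IsCoverOf (fun t => γ t + deck k) T γ' T') : IsCoverOf γ T γ' T' := by
  obtain ⟨n, hn, hT, s, hs⟩ := h
  exact ⟨n, hn, hT, s, fun t => by rw [← hs t, toPhase_add_deck]⟩

/-- Close to one of the saddle-centers, periodic orbits which do not cover a Lyapunov orbit have
large index. -/
theorem exists_neighborhood_index {μ₀ σ : ℝ} (h0 : 0 < μ₀) (h1 : μ₀ < 1)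
    (hσ : σ = 1 ∨ σ = -1) (N : ℕ) :
    ∃ U : Set Phase, IsOpen U ∧ toPhase (saddleCenter μ₀ σ) ∈ U ∧
      ∃ δ > 0, ∀ μ E : ℝ, |μ - μ₀| < δ → |E - firstLagrangeValue μ₀| < δ →
        ∀ (γ : ℝ → LiftedPhase) (T : ℝ),
          IsPeriodicOrbit (regHamiltonian μ E) γ T →
          (∃ t, toPhase (γ t) ∈ U) →
          (¬ ∃ (γ' : ℝ → LiftedPhase) (T' : ℝ),
            IsLyapunovOrbit μ E γ' T' ∧ IsCoverOf γ T γ' T') →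
          ∃ m : ℤ, IsConleyZehnderIndex (regHamiltonian μ E) γ T m ∧ (N : ℤ) < m := by
  obtain ⟨ω, l, a, ε, ρ, L, Θ, s₁, s₂, c, m₁, m₂, δ, M⟩ := exists_localModel h0 h1 hσ
  have ha := M.chart.a_pos
  have hρ := M.ρ_pos
  have hm := M.trace_pos
  obtain ⟨τ, hτ, hτN⟩ : ∃ τ : ℝ, 0 < τ ∧ (N : ℝ) < (m₁ + m₂) * (τ / 2) / Real.pi - 7 := by
    have hπ := Real.pi_pos
    refine ⟨2 * Real.pi * (N + 8) / (m₁ + m₂), by positivity, ?_⟩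
    have : (m₁ + m₂) * (2 * Real.pi * (N + 8) / (m₁ + m₂) / 2) / Real.pi = N + 8 := by
      field_simp
    rw [this]
    linarith
  set B := 2 * Real.exp ((ω + l + ε) * τ) + 2 with hB
  have hB2 : 2 < B := by have := Real.exp_pos ((ω + l + ε) * τ); linarith
  have hr0 : 0 < ρ / B := by positivity
  have hr2 : ρ / B ≤ ρ / 2 := div_le_div_of_nonneg_left hρ.le two_pos hB2.le
  have hrτ : 2 * (ρ / B) * Real.exp ((ω + l + ε) * τ) + ρ / B ≤ ρ := by
    have e1 : ρ / B * B = ρ := div_mul_cancel₀ _ (by positivity)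
    nlinarith
  obtain ⟨δ₁, hδ₁, hδ₁δ, hsys⟩ := M.system (ρ / B) hr0 hr2
  set δ₂ := min δ₁ (a * (ρ ^ 2 / 196)) with hδ₂
  have hδ₂0 : 0 < δ₂ := lt_min hδ₁ (by positivity)
  have hδ₂a : a⁻¹ * δ₂ ≤ ρ ^ 2 / 196 := by
    rw [inv_mul_le_iff₀ ha]
    exact min_le_right _ _
  have hev : ∀ᶠ μ in 𝓝 μ₀, (0 < μ ∧ μ < 1) ∧
      |firstLagrangeValue μ - firstLagrangeValue μ₀| < δ₂ ∧
      ‖Θ.symm (saddleCenter μ σ - saddleCenter μ₀ σ)‖ ≤ ρ := by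
    refine ((eventually_gt_nhds h0).and (eventually_lt_nhds h1)).and (Eventually.and ?_ ?_)
    · exact (Metric.tendsto_nhds.1 (tendsto_firstLagrangeValue h0 h1) δ₂ hδ₂0).mono
        fun μ h => by rwa [Real.dist_eq] at h
    · have hc : Tendsto (fun μ => ‖Θ.symm (saddleCenter μ σ - saddleCenter μ₀ σ)‖) (𝓝 μ₀)
          (𝓝 0) := by
        have h2 := (Θ.symm.continuous.norm.tendsto (0 : LiftedPhase)).comp
          (tendsto_sub_nhds_zero_iff.2 (tendsto_saddleCenter h0 h1 σ))
        simpa only [Function.comp_def, map_zero, norm_zero] using h2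
      exact hc.eventually (ge_mem_nhds hρ)
  obtain ⟨δ₃, hδ₃, hδ₃μ⟩ := Metric.eventually_nhds_iff.1 hev
  refine ⟨toPhase '' {z | ‖Θ.symm (z - saddleCenter μ₀ σ)‖ < ρ / B},
    isOpenMap_toPhase _ (isOpen_lt (by fun_prop) continuous_const),
    ⟨_, by simpa using hr0, rfl⟩, min δ₂ δ₃, lt_min hδ₂0 hδ₃, ?_⟩
  rintro μ E hμ hE γ T hγ ⟨t, z, hz, hzt⟩ hLy
  obtain ⟨⟨hμ0, hμ1⟩, hL, hS⟩ := hδ₃μ (y := μ)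
    (by rw [Real.dist_eq]; exact hμ.trans_le (min_le_right _ _))
  have hμ₂ : |μ - μ₀| < δ₂ := hμ.trans_le (min_le_left _ _)
  have hE₂ : |E - firstLagrangeValue μ₀| < δ₂ := hE.trans_le (min_le_left _ _)
  have hδ₂₁ : δ₂ ≤ δ₁ := min_le_left _ _
  obtain ⟨zs, hzs, S⟩ := hsys μ E (hμ₂.trans_le hδ₂₁) (hE₂.trans_le hδ₂₁)
  have hper : Function.Periodic (fun t => toPhase (γ t)) T := hγ.periodic
  obtain ⟨t₀, ht₀, htt⟩ := hper.exists_mem_Ico₀ hγ.pos t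
  obtain ⟨k, hk⟩ := toPhase_eq_iff.1 (hzt.trans htt)
  rw [hk] at hz
  rcases M.exists_index_of_long (hμ₂.trans_le (hδ₂₁.trans hδ₁δ)) (hE₂.trans_le (hδ₂₁.trans hδ₁δ)) S
    hzs hτ hrτ hγ ht₀ (le_of_lt hz) with hb | ⟨m, hm1, hm2⟩
  · obtain ⟨γ', T', h3, h4⟩ := M.exists_lyapunov hμ0 hμ1 (hδ₂₁.trans hδ₁δ) hμ₂ hL hE₂ hS hδ₂a
      (fun e he => by
        obtain ⟨ze, _, Se⟩ := hsys μ e (hμ₂.trans_le hδ₂₁) (he.trans_le hδ₂₁)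
        exact ⟨ze, Se⟩)
      (hγ.add_deck (regHamiltonian_add_deck μ E) k) hb
    exact absurd ⟨γ', T', h3, h4.of_add_deck⟩ hLy
  · exact ⟨m, hm1, by exact_mod_cast hτN.trans_le hm2⟩

end CR3BP

end

theorem theorem1p4 (μ₀ : ℝ) (hμ₀ : 0 < μ₀) (hμ₀' : μ₀ < 1) (N : ℕ) :
    ∃ U : Set CR3BP.Phase, IsOpen U ∧
      CR3BP.toPhase (CR3BP.saddleCenter μ₀ 1) ∈ U ∧
      CR3BP.toPhase (CR3BP.saddleCenter μ₀ (-1)) ∈ U ∧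
      ∃ δ > 0, ∀ μ E : ℝ, |μ - μ₀| < δ → |E - CR3BP.firstLagrangeValue μ₀| < δ →
        ∀ (γ : ℝ → CR3BP.LiftedPhase) (T : ℝ),
          CR3BP.IsPeriodicOrbit (CR3BP.regHamiltonian μ E) γ T →
          (∃ t, CR3BP.toPhase (γ t) ∈ U) →
          (¬ ∃ (γ' : ℝ → CR3BP.LiftedPhase) (T' : ℝ),
            CR3BP.IsLyapunovOrbit μ E γ' T' ∧ CR3BP.IsCoverOf γ T γ' T') →
          ∃ m : ℤ, CR3BP.IsConleyZehnderIndex (CR3BP.regHamiltonian μ E) γ T m ∧ (N : ℤ) < m := by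
  obtain ⟨U₁, hU₁, hm₁, δ₁, hδ₁, h₁⟩ := CR3BP.exists_neighborhood_index hμ₀ hμ₀' (Or.inl rfl) N
  obtain ⟨U₂, hU₂, hm₂, δ₂, hδ₂, h₂⟩ := CR3BP.exists_neighborhood_index hμ₀ hμ₀' (Or.inr rfl) N
  refine ⟨U₁ ∪ U₂, hU₁.union hU₂, Or.inl hm₁, Or.inr hm₂, min δ₁ δ₂, lt_min hδ₁ hδ₂, ?_⟩
  rintro μ E hμ hE γ T hγ ⟨t, ht | ht⟩ hLy
  · exact h₁ μ E (hμ.trans_le (min_le_left _ _)) (hE.trans_le (min_le_left _ _)) γ T hγ ⟨t, ht⟩ hLy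
  · exact h₂ μ E (hμ.trans_le (min_le_right _ _)) (hE.trans_le (min_le_right _ _)) γ T hγ
      ⟨t, ht⟩ hLy
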